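/- Let $x=(x_1,\dots,x_n)$ be an array over a linearly ordered set. A position $p\in\{1,\dots,n\}$ is a pivot position if $x_a\le x_b$ whenever $a<p\le b$. The $\phi$ pivot positions $p_1<\dots<p_\phi$ cut $x$, just before each $p_k$, into $\phi+1$ consecutive sub-instances $I_0,\dots,I_\phi$ of sizes $n_0,\dots,n_\phi$ (so $I_0$ is empty if $n\ge 1$, as $p_1=1$). A sub-instance is formed by $\rho$ runs if it is written as the concatenation of $\rho$ nonempty nondecreasing sequences, its runs; the maximal nondecreasing runs are one such decomposition, but runs need not be maximal. The runs induce a partition $\pi$ of the distinct values of the sub-instance: a value that occurs in at least two runs forms a singleton, and the other members of $\pi$ are the maximal sets of consecutive values (consecutive among the distinct values of the sub-instance) that all occur in one and the same run and in no other run. For a member $J$ of $\pi$ and a run that meets $J$, the entries of this run with values in $J$ form a block. The value $m$ of $J$ is its number of blocks, that is, $1$ or the number of runs that contain the repeated value. Let $I_i$ be formed by $\rho_i$ runs, with blocks of sizes $g_{i1},\dots,g_{i\delta_i}$ (listed by increasing value, those of equal value by the order of the runs) and with a partition whose members have, in increasing order, the values $m_{i1},\dots,m_{i\chi_i}$. Call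 $(n_i,\rho_i,(g_{ij})_{j\le\delta_i},(m_{ij})_{j\le\chi_i})_{0\le i\le\phi}$ parameters of $x$, and put $$B=n+\sum_{i=0}^{\phi}\Big\{\sum_{j=1}^{\delta_i}\log_2 g_{ij}+\sum_{j=1}^{\chi_i}\log_2\binom{\rho_i}{m_{ij}}\Big\}.$$ There are absolute constants $C,c>0$ with the following two properties. 1. There is a deterministic comparison algorithm (for every $n$ a decision tree whose nodes compare two entries with outcomes $<,=,>$, and whose leaves output a permutation of the positions) that sorts every array over every linearly ordered set and that performs at most $C\cdot B$ comparisons on every array $x$, for all parameters of $x$; in particular for those given by its maximal runs. 2. This is optimal in the worst case: for every $n\ge 2$, for all parameters that some array of length $n$ has, and for every comparison algorithm that sorts all arrays of length $n$ with natural-number entries, there is an array of length $n$ with these same parameters on which the algorithm performs at least $c\cdot B$ comparisons. -/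

import Mathlib

/-! ### Comparison-based sorting algorithms -/

/-- A deterministic comparison algorithm on arrays of length `n`, as a decision tree: an inner node
compares the entries at positions `i` and `j` and branches on the three possible outcomes; a leaf
outputs a rearrangement of the positions. -/
inductive CompTree (n : ℕ) : Type
  | output (σ : Equiv.Perm (Fin n)) : CompTree n
  | compare (i j : Fin n) (lt eq gt : CompTree n) : CompTree n

namespace CompTree

/-- The permutation that is output on the array `x`. -/
def result {α : Type*} [LinearOrder α] {n : ℕ} (x : Fin n → α) :
    CompTree n → Equiv.Perm (Fin n)
  | output σ => σ
  | compare i j lt eq gt =>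
      if x i < x j then result x lt else if x i = x j then result x eq else result x gt

/-- The number of data comparisons performed on the array `x`. -/
def cost {α : Type*} [LinearOrder α] {n : ℕ} (x : Fin n → α) : CompTree n → ℕ
  | output _ => 0
  | compare i j lt eq gt =>
      1 + (if x i < x j then cost x lt else if x i = x j then cost x eq else cost x gt)

/-- The tree sorts every array of length `n` with entries in `α`. -/
def Sorts {n : ℕ} (T : CompTree n) (α : Type*) [LinearOrder α] : Prop :=
  ∀ x : Fin n → α, Monotone fun k => x (T.result x k)

end CompTree

/-! ### Pivot positions and sub-instances -/

/-- With positions counted from `0`: every entry before `p` is at most every entry at `p` or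
after it. -/
def IsPivotPosition {α : Type*} [LinearOrder α] {n : ℕ} (x : Fin n → α) (p : Fin n) : Prop :=
  ∀ a b : Fin n, a < p → p ≤ b → x a ≤ x b

instance {α : Type*} [LinearOrder α] {n : ℕ} (x : Fin n → α) :
    DecidablePred (IsPivotPosition x) :=
  fun p => inferInstanceAs (Decidable (∀ a b : Fin n, a < p → p ≤ b → x a ≤ x b))

/-- The pivot positions in increasing order. -/
def pivotPositions {α : Type*} [LinearOrder α] {n : ℕ} (x : Fin n → α) : List (Fin n) :=
  (List.finRange n).filter fun p => decide (IsPivotPosition x p)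

/-- The `φ + 1` sub-instances into which the `φ` pivot positions cut the array, a cut being made
just before each pivot position. -/
def subInstances {α : Type*} [LinearOrder α] {n : ℕ} (x : Fin n → α) : List (List α) :=
  let cuts : List ℕ := (pivotPositions x).map Fin.val
  List.zipWith (fun a b => ((List.ofFn x).drop a).take (b - a)) (0 :: cuts) (cuts ++ [n])

/-! ### Runs, blocks and the induced partition of the output -/

/-- `R` is a way to write `y` as a concatenation of nonempty sorted runs. The runs need not be
maximal; the decomposition into maximal runs, `y.splitBy (· ≤ ·)`, is one of them. -/
def IsRunDecomposition {α : Type*} [LinearOrder α] (y : List α) (R : List (List α)) : Prop :=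
  R.flatten = y ∧ ∀ r ∈ R, r ≠ [] ∧ r.Pairwise (· ≤ ·)

/-- The maximal runs of `y` are a run decomposition of `y`. -/
theorem isRunDecomposition_maximalRuns {α : Type*} [LinearOrder α] (y : List α) :
    IsRunDecomposition y (y.splitBy fun a b => decide (a ≤ b)) := by
  refine ⟨List.flatten_splitBy _ _,
    fun r hr => ⟨fun h => List.nil_notMem_splitBy _ _ (h ▸ hr), ?_⟩⟩
  have h := List.isChain_of_mem_splitBy hr
  simp only [decide_eq_true_eq] at h
  exact List.isChain_iff_pairwise.1 h

/-- The indices of the runs that contain the value `v`. -/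
def owners {α : Type*} [LinearOrder α] (R : List (List α)) (v : α) : Finset (Fin R.length) :=
  Finset.univ.filter fun r => v ∈ R.get r

/-- The partition `π` of the output, as the list of its members in increasing order, each member
being given by the increasing list of its distinct values. A value that occurs in at least two runs
forms a singleton; the other members are the maximal sets of consecutive values of the output that
all occur in one and the same run and in no other. -/
def outputPartition {α : Type*} [LinearOrder α] (R : List (List α)) : List (List α) :=
  (R.flatten.toFinset.sort (· ≤ ·)).splitBy fun a b =>
    decide (owners R a = owners R b ∧ (owners R a).card = 1)

/-- The sizes of the blocks that correspond to the member `J` of the partition: in every run that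
meets `J`, the entries with values in `J` form a block. -/
def memberBlockSizes {α : Type*} [LinearOrder α] (R : List (List α)) (J : List α) : List ℕ :=
  (R.map fun r => r.countP fun v => decide (v ∈ J)).filter fun g => decide (0 < g)

/-- The parameters of a sub-instance: its size, its number `ρ` of runs, the sizes
`g₁, …, g_δ` of its blocks, and the values `m₁, …, m_χ` of the members of the partition of
the output. -/
structure SubParams where
  size : ℕ
  runs : ℕ
  blockSizes : List ℕ
  memberValues : List ℕ

/-- The parameters of a sub-instance that is given by its runs. Blocks are listed by increasing
value, those of equal value by the order of the runs; the value of a member of the partition is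
the number of its blocks (`1` for a block, and the number of runs that contain it for a value that
occurs in several runs). -/
def subParams {α : Type*} [LinearOrder α] (R : List (List α)) : SubParams where
  size := R.flatten.length
  runs := R.length
  blockSizes := (outputPartition R).flatMap (memberBlockSizes R)
  memberValues := (outputPartition R).map fun J => (memberBlockSizes R J).length

/-- The pivot positions of `x` cut it into sub-instances that are formed by runs with the
parameters `P`. -/
def HasParams {α : Type*} [LinearOrder α] {n : ℕ} (x : Fin n → α) (P : List SubParams) : Prop :=
  ∃ D : List (List (List α)),
    List.Forall₂ IsRunDecomposition (subInstances x) D ∧ D.map subParams = P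

/-- `n + ∑ᵢ (∑ⱼ log gᵢⱼ + ∑ⱼ log (ρᵢ choose mᵢⱼ))` -/
noncomputable def comparisonBound (n : ℕ) (P : List SubParams) : ℝ :=
  n + (P.map fun p =>
    (p.blockSizes.map fun g => Real.logb 2 (g : ℝ)).sum +
    (p.memberValues.map fun m => Real.logb 2 (p.runs.choose m : ℝ)).sum).sum

/-! ### Sorting by weighted insertion -/

/-! Let Q be the product of all binomials `p.runs.choose m`, over all members of all sub-instances
(`totalChoices`). As log g ≤ g and the block sizes add up to n, the bound B lies between n + log Q
and 2n + log Q (`le_comparisonBound`, `comparisonBound_le`). Both halves of the theorem then follow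
from one fact: the number of order types of arrays with given parameters is Q, up to a factor
exponential in n.

Upper bound. An order type with parameters P is encoded by the sets of runs that meet the members of
the partitions, for which there are Q choices, and by O(n) further bits: sizes of the members,
multiplicities of the values in the runs, and a bit per sub-instance for equality across the cut
(`orderSimilar_of_runCode_eq`, `card_rankHasParams_le`). One tree has to serve all parameters, so an
order type gets as weight the sum of 1/Q(P) over all parameters P that it admits. There are only
exponentially many P (`exists_params_finset`), hence the total weight is exponential in n. Inserting
the entries by weighted binary search takes at most 2n + 2 log(total weight / weight) comparisons
(`solvable_of_weights`), which is O(n + log Q(P)) for every admitted P.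

Lower bound. A sorting tree separates arrays that are ordered differently
(`Sorts.le_iff_of_outcomes_eq`), so D comparisons handle at most 3^D order types
(`card_le_three_pow`); and every entry must be touched, so D ≥ n/2 (`Sorts.le_two_mul_cost`). It
remains to construct Q / 2^O(n) order types with the given parameters. Sub-instances are built
separately and concatenated after a shift. Inside one, every member of the partition becomes a
single value, repeated according to the block sizes in the runs of a chosen set of the prescribed
cardinality. Adjacent sets must not be the same singleton, or the members would merge; every run
must be used; and no cut may be possible. The last condition is ensured by putting the least value
into the last run but not the first, and the greatest into the first but not the last. There is room
for this because in an indecomposable list with at least two runs neither extreme member meets every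
run (`memberValues_head_lt`, `memberValues_last_lt`). By `exists_ownerSeqs` these restrictions cost
only an exponential factor. -/

namespace CompTree

/-- This allows an array over any linear order to be replaced by its array of ranks, so that
finitely many arrays represent all inputs. -/
theorem result_cost_congr {α β : Type*} [LinearOrder α] [LinearOrder β] {n : ℕ}
    {x : Fin n → α} {w : Fin n → β} (h : ∀ i j, x i ≤ x j ↔ w i ≤ w j) (T : CompTree n) :
    T.result x = T.result w ∧ T.cost x = T.cost w := by
  have hlt : ∀ i j, x i < x j ↔ w i < w j := fun i j => by
    rw [← not_le, ← not_le, h]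
  have heq : ∀ i j, x i = x j ↔ w i = w j := fun i j => by
    rw [le_antisymm_iff, le_antisymm_iff, h, h]
  induction T with
  | output σ => simp [result, cost]
  | compare i j lt eq gt h1 h2 h3 =>
    simp only [result, cost, hlt, heq, h1.1, h2.1, h3.1, h1.2, h2.2, h3.2, and_self]

/-- Some tree sorts all members of `Ω`, at a cost bounded by `f`. -/
def Solvable {β : Type*} [LinearOrder β] {n : ℕ} (Ω : Finset (Fin n → β))
    (f : (Fin n → β) → ℝ) : Prop :=
  ∃ T : CompTree n, ∀ w ∈ Ω, (Monotone fun k => w (T.result w k)) ∧ (T.cost w : ℝ) ≤ f w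

section

variable {β : Type*} [LinearOrder β] {n : ℕ}

theorem Solvable.mono {Ω Ω' : Finset (Fin n → β)} {f g : (Fin n → β) → ℝ}
    (h : Solvable Ω f) (hs : Ω' ⊆ Ω) (hfg : ∀ w ∈ Ω', f w ≤ g w) : Solvable Ω' g := by
  obtain ⟨T, hT⟩ := h
  exact ⟨T, fun w hw => ⟨(hT w (hs hw)).1, (hT w (hs hw)).2.trans (hfg w hw)⟩⟩

theorem Solvable.compare {Ω : Finset (Fin n → β)} {f : (Fin n → β) → ℝ} (i j : Fin n)
    (h1 : Solvable (Ω.filter fun w => w i < w j) fun w => f w - 1)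
    (h2 : Solvable (Ω.filter fun w => w i = w j) fun w => f w - 1)
    (h3 : Solvable (Ω.filter fun w => w j < w i) fun w => f w - 1) : Solvable Ω f := by
  obtain ⟨T1, h1⟩ := h1
  obtain ⟨T2, h2⟩ := h2
  obtain ⟨T3, h3⟩ := h3
  refine ⟨CompTree.compare i j T1 T2 T3, fun w hw => ?_⟩
  simp only [result, cost]
  rcases lt_trichotomy (w i) (w j) with h | h | h
  · have := h1 w (by simp [hw, h])
    simp only [h, if_true]
    exact ⟨this.1, by push_cast; linarith [this.2]⟩
  · have := h2 w (by simp [hw, h])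
    simp only [h, lt_irrefl, if_true, if_false]
    exact ⟨this.1, by push_cast; linarith [this.2]⟩
  · have := h3 w (by simp [hw, h])
    simp only [h.not_gt, h.ne', if_false]
    exact ⟨this.1, by push_cast; linarith [this.2]⟩

/-- All members of `Ω` order the first `k` positions in the same way. -/
def AgreeBelow (k : ℕ) (Ω : Finset (Fin n → β)) : Prop :=
  ∀ w ∈ Ω, ∀ w' ∈ Ω, ∀ i j : Fin n, i.val < k → j.val < k → (w i ≤ w j ↔ w' i ≤ w' j)

theorem AgreeBelow.subset {k : ℕ} {Ω Ω' : Finset (Fin n → β)} (h : AgreeBelow k Ω)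
    (hs : Ω' ⊆ Ω) : AgreeBelow k Ω' :=
  fun w hw w' hw' => h w (hs hw) w' (hs hw')

/-- The place of the value `v` among the first `k` entries of `w`. -/
def place (k : ℕ) (w : Fin n → β) (v : β) : ℕ :=
  (Finset.univ.filter fun i : Fin n => i.val < k ∧ w i < v).card +
    (Finset.univ.filter fun i : Fin n => i.val < k ∧ w i ≤ v).card

theorem place_mono (k : ℕ) (w : Fin n → β) : Monotone (place k w) := by
  intro u v huv
  refine Nat.add_le_add (Finset.card_le_card fun i => ?_) (Finset.card_le_card fun i => ?_)
  · simp only [Finset.mem_filter, Finset.mem_univ, true_and]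
    exact fun h => ⟨h.1, h.2.trans_le huv⟩
  · simp only [Finset.mem_filter, Finset.mem_univ, true_and]
    exact fun h => ⟨h.1, h.2.trans huv⟩

/-- Adding the strict and the weak count separates the value of an entry from the gaps on both sides
of it: passing from below the entry up to it, entry `i` joins the weak count; passing beyond it,
entry `i` joins the strict count. -/
theorem place_lt_place_entry {k : ℕ} {w : Fin n → β} {v : β} {i : Fin n} (hi : i.val < k)
    (h : v < w i) : place k w v < place k w (w i) := by
  refine Nat.add_lt_add_of_le_of_lt (Finset.card_le_card fun j => ?_)
    (Finset.card_lt_card (Finset.ssubset_iff_of_subset (fun j => ?_) |>.2 ⟨i, ?_, ?_⟩))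
  · simp only [Finset.mem_filter, Finset.mem_univ, true_and]
    exact fun h' => ⟨h'.1, h'.2.trans h⟩
  · simp only [Finset.mem_filter, Finset.mem_univ, true_and]
    exact fun h' => ⟨h'.1, h'.2.trans h.le⟩
  · simp [hi]
  · simp [h]

theorem place_entry_lt_place {k : ℕ} {w : Fin n → β} {v : β} {i : Fin n} (hi : i.val < k)
    (h : w i < v) : place k w (w i) < place k w v := by
  refine Nat.add_lt_add_of_lt_of_le
    (Finset.card_lt_card (Finset.ssubset_iff_of_subset (fun j => ?_) |>.2 ⟨i, ?_, ?_⟩))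
    (Finset.card_le_card fun j => ?_)
  · simp only [Finset.mem_filter, Finset.mem_univ, true_and]
    exact fun h' => ⟨h'.1, h'.2.trans h⟩
  · simp [hi, h]
  · simp
  · simp only [Finset.mem_filter, Finset.mem_univ, true_and]
    exact fun h' => ⟨h'.1, h'.2.trans h.le⟩

theorem place_lt_iff {k : ℕ} {w : Fin n → β} {v : β} {i : Fin n} (hi : i.val < k) :
    place k w v < place k w (w i) ↔ v < w i :=
  ⟨fun h => lt_of_not_ge fun h' => h.not_ge (place_mono k w h'), place_lt_place_entry hi⟩

theorem lt_place_iff {k : ℕ} {w : Fin n → β} {v : β} {i : Fin n} (hi : i.val < k) :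
    place k w (w i) < place k w v ↔ w i < v :=
  ⟨fun h => lt_of_not_ge fun h' => h.not_ge (place_mono k w h'), place_entry_lt_place hi⟩

theorem AgreeBelow.place_eq {k : ℕ} {Ω : Finset (Fin n → β)} (h : AgreeBelow k Ω)
    {w w' : Fin n → β} (hw : w ∈ Ω) (hw' : w' ∈ Ω) {i : Fin n} (hi : i.val < k) :
    place k w (w i) = place k w' (w' i) := by
  have h1 : ∀ j : Fin n, j.val < k → (w j ≤ w i ↔ w' j ≤ w' i) :=
    fun j hj => h w hw w' hw' j i hj hi
  have h2 : ∀ j : Fin n, j.val < k → (w j < w i ↔ w' j < w' i) := fun j hj => by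
    rw [← not_le, ← not_le, h w hw w' hw' i j hi hj]
  unfold place
  congr 2
  · ext j
    simp only [Finset.mem_filter, Finset.mem_univ, true_and]
    exact and_congr_right (h2 j)
  · ext j
    simp only [Finset.mem_filter, Finset.mem_univ, true_and]
    exact and_congr_right (h1 j)

/-- The place of entry `k` decides all its comparisons with earlier entries, because the places of
the earlier entries are constant on `Ω`. -/
theorem AgreeBelow.succ {k : Fin n} {Ω : Finset (Fin n → β)} (h : AgreeBelow k.val Ω)
    (hu : ∀ w ∈ Ω, ∀ w' ∈ Ω, place k.val w (w k) = place k.val w' (w' k)) :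
    AgreeBelow (k.val + 1) Ω := by
  intro w hw w' hw' i j hi hj
  rcases Nat.lt_succ_iff_lt_or_eq.1 hi with hi | hi <;>
    rcases Nat.lt_succ_iff_lt_or_eq.1 hj with hj | hj
  · exact h w hw w' hw' i j hi hj
  · obtain rfl : j = k := Fin.ext hj
    rw [← not_lt, ← not_lt, ← place_lt_iff hi, ← place_lt_iff hi, hu w hw w' hw',
      h.place_eq hw hw' hi]
  · obtain rfl : i = k := Fin.ext hi
    rw [← not_lt, ← not_lt, ← lt_place_iff hj, ← lt_place_iff hj, hu w hw w' hw',
      h.place_eq hw hw' hj]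
  · obtain rfl : i = k := Fin.ext hi
    obtain rfl : j = i := Fin.ext hj
    simp

/-- Between two different places there is an entry. -/
theorem exists_place_between {k : ℕ} {w w' : Fin n → β} {v v' : β}
    (hlt : place k w v < place k w' v') :
    ∃ i : Fin n, i.val < k ∧ place k w v ≤ place k w (w i) ∧
      place k w' (w' i) ≤ place k w' v' := by
  by_contra! hcon
  refine hlt.not_ge (Nat.add_le_add (Finset.card_le_card fun j => ?_)
    (Finset.card_le_card fun j => ?_)) <;>
  simp only [Finset.mem_filter, Finset.mem_univ, true_and] <;>
  rintro ⟨hj, hjv⟩ <;> refine ⟨hj, ?_⟩ <;> by_contra! hj'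
  · exact absurd (hcon j hj (place_mono k w hj')) (place_mono k w' hjv.le).not_gt
  · exact absurd (hcon j hj (place_mono k w hj'.le)) (place_mono k w' hjv).not_gt

/-- The tree that inserts the entries one after the other by weighted binary search. -/
theorem solvable_of_agreeBelow_succ {W : (Fin n → β) → ℝ} {k : Fin n}
    (ih : ∀ Ω : Finset (Fin n → β), (∀ w ∈ Ω, 0 < W w) → AgreeBelow (k.val + 1) Ω →
      Solvable Ω fun w => 2 * ((n : ℝ) - (k.val + 1)) +
        2 * Real.logb 2 ((∑ u ∈ Ω, W u) / W w))
    (Ω : Finset (Fin n → β)) (hW : ∀ w ∈ Ω, 0 < W w) (hΩ : AgreeBelow k.val Ω) :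
    Solvable Ω fun w => 2 * ((n : ℝ) - k.val) + 2 * Real.logb 2 ((∑ u ∈ Ω, W u) / W w) := by
  -- The bound is a potential. Two comparisons are paid for either by halving the weight of the
  -- remaining candidates, which lowers `2 * logb` by 2, or by fixing the place of entry `k`, which
  -- lowers `2 * (n - k)` by 2.
  induction Ω using Finset.strongInduction with
  | H Ω ihΩ =>
  set S : Finset (Fin n → β) → ℝ := fun Ω' => ∑ u ∈ Ω', W u with hS
  set o : (Fin n → β) → ℕ := fun w => place k.val w (w k) with ho
  set f : (Fin n → β) → ℝ := fun w => 2 * ((n : ℝ) - k.val) + 2 * Real.logb 2 (S Ω / W w)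
    with hf
  change Solvable Ω f
  rcases Ω.eq_empty_or_nonempty with rfl | ⟨w₀, hw₀⟩
  · exact ⟨.output 1, by simp⟩
  have hSpos : 0 < S Ω := Finset.sum_pos hW ⟨w₀, hw₀⟩
  have hSle : ∀ Ω' ⊆ Ω, S Ω' ≤ S Ω := fun Ω' h' =>
    Finset.sum_le_sum_of_subset_of_nonneg h' fun w hw _ => (hW w hw).le
  have hSpos' : ∀ Ω' ⊆ Ω, ∀ w ∈ Ω', 0 < S Ω' := fun Ω' h' w hw =>
    Finset.sum_pos (fun w hw => hW w (h' hw)) ⟨w, hw⟩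
  have huni : ∀ Ω' ⊆ Ω, (∃ m, ∀ w ∈ Ω', o w = m) → Solvable Ω' fun w => f w - 2 := by
    rintro Ω' h' ⟨m, hm⟩
    refine (ih Ω' (fun w hw => hW w (h' hw)) ((hΩ.subset h').succ fun w hw w' hw' =>
      (hm w hw).trans (hm w' hw').symm)).mono subset_rfl fun w hw => ?_
    have : Real.logb 2 (S Ω' / W w) ≤ Real.logb 2 (S Ω / W w) :=
      Real.logb_le_logb_of_le one_lt_two (div_pos (hSpos' Ω' h' w hw) (hW w (h' hw)))
        (div_le_div_of_nonneg_right (hSle Ω' h') (hW w (h' hw)).le)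
    simp only [hf, hS] at this ⊢
    linarith
  have hlight : ∀ Ω' ⊆ Ω, 2 * S Ω' ≤ S Ω → Solvable Ω' fun w => f w - 2 := by
    intro Ω' h' hle
    have hne : Ω' ≠ Ω := by
      rintro rfl
      linarith
    refine (ihΩ Ω' (h'.ssubset_of_ne hne) (fun w hw => hW w (h' hw)) (hΩ.subset h')).mono
      subset_rfl fun w hw => ?_
    have hw' := hW w (h' hw)
    have h0 := hSpos' Ω' h' w hw
    have : Real.logb 2 (S Ω' / W w) + 1 ≤ Real.logb 2 (S Ω / W w) := by
      rw [← Real.logb_self_eq_one (b := 2) one_lt_two,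
        ← Real.logb_mul (div_pos h0 hw').ne' two_ne_zero]
      refine Real.logb_le_logb_of_le one_lt_two (by positivity) ?_
      rw [div_mul_eq_mul_div, mul_comm]
      exact div_le_div_of_nonneg_right hle hw'.le
    simp only [hf, hS] at this ⊢
    linarith
  -- the weighted median
  have hex : ∃ m, S Ω ≤ 2 * S (Ω.filter fun w => o w ≤ m) := by
    refine ⟨Ω.sup o, ?_⟩
    rw [Finset.filter_true_of_mem fun w hw => Finset.le_sup hw]
    linarith
  obtain ⟨m, hm, hmin⟩ : ∃ m, S Ω ≤ 2 * S (Ω.filter fun w => o w ≤ m) ∧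
      2 * S (Ω.filter fun w => o w < m) ≤ S Ω := by
    classical
    refine ⟨Nat.find hex, Nat.find_spec hex, ?_⟩
    rcases Nat.eq_zero_or_pos (Nat.find hex) with h0 | h0
    · rw [h0]
      simpa [S] using hSpos.le
    · have := Nat.find_min hex (Nat.sub_lt h0 one_pos)
      have h1 : ∀ w, o w < Nat.find hex ↔ o w ≤ Nat.find hex - 1 := fun w => by omega
      simp only [h1]
      linarith
  have hmax : 2 * S (Ω.filter fun w => m < o w) ≤ S Ω := by
    have := Finset.sum_filter_add_sum_filter_not Ω (fun w => o w ≤ m) W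
    simp only [not_le] at this
    simp only [hS] at hm ⊢
    linarith
  have hlow : ∀ Ω' ⊆ Ω, (∀ w ∈ Ω', o w < m) → Solvable Ω' fun w => f w - 2 := by
    intro Ω' h' hm'
    refine hlight Ω' h' (le_trans ?_ hmin)
    have : S Ω' ≤ S (Ω.filter fun w => o w < m) :=
      Finset.sum_le_sum_of_subset_of_nonneg
        (fun w hw => Finset.mem_filter.2 ⟨h' hw, hm' w hw⟩)
        fun w hw _ => (hW w (Finset.mem_filter.1 hw).1).le
    linarith
  have hhigh : ∀ Ω' ⊆ Ω, (∀ w ∈ Ω', m < o w) → Solvable Ω' fun w => f w - 2 := by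
    intro Ω' h' hm'
    refine hlight Ω' h' (le_trans ?_ hmax)
    have : S Ω' ≤ S (Ω.filter fun w => m < o w) :=
      Finset.sum_le_sum_of_subset_of_nonneg
        (fun w hw => Finset.mem_filter.2 ⟨h' hw, hm' w hw⟩)
        fun w hw _ => (hW w (Finset.mem_filter.1 hw).1).le
    linarith
  have hweak : ∀ Ω', (Solvable Ω' fun w => f w - 2) → Solvable Ω' fun w => f w - 1 :=
    fun Ω' h' => h'.mono subset_rfl fun w _ => by linarith
  have hweak' : ∀ Ω', (Solvable Ω' fun w => f w - 2) → Solvable Ω' fun w => f w - 1 - 1 :=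
    fun Ω' h' => h'.mono subset_rfl fun w _ => by linarith
  set c : Fin n → ℕ := fun i => place k.val w₀ (w₀ i) with hc
  have hcw : ∀ w ∈ Ω, ∀ i : Fin n, i.val < k.val → place k.val w (w i) = c i :=
    fun w hw i hi => hΩ.place_eq hw hw₀ hi
  have hlt : ∀ w ∈ Ω, ∀ i : Fin n, i.val < k.val → w k < w i → o w < c i :=
    fun w hw i hi h => by
      rw [← hcw w hw i hi]
      exact place_lt_place_entry hi h
  have heq : ∀ w ∈ Ω, ∀ i : Fin n, i.val < k.val → w k = w i → o w = c i :=
    fun w hw i hi h => by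
      rw [← hcw w hw i hi, ← h]
  have hgt : ∀ w ∈ Ω, ∀ i : Fin n, i.val < k.val → w i < w k → c i < o w :=
    fun w hw i hi h => by
      rw [← hcw w hw i hi]
      exact place_entry_lt_place hi h
  have hbet : ∀ w ∈ Ω, ∀ w' ∈ Ω, o w < o w' → ∃ i : Fin n, i.val < k.val ∧
      o w ≤ c i ∧ c i ≤ o w' := by
    intro w hw w' hw' h
    obtain ⟨i, hi, h1, h2⟩ := exists_place_between h
    exact ⟨i, hi, by rwa [← hcw w hw i hi], by rwa [← hcw w' hw' i hi]⟩
  have hsub : ∀ p : (Fin n → β) → Prop, [DecidablePred p] → Ω.filter p ⊆ Ω :=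
    fun p _ => Finset.filter_subset _ _
  -- If the median place is that of an earlier entry, one comparison with this entry suffices:
  -- strict outcomes leave at most half of the weight, equality fixes the place.
  by_cases hA : ∃ i : Fin n, i.val < k.val ∧ c i = m
  · obtain ⟨i, hi, him⟩ := hA
    refine Solvable.compare k i (hweak _ (hlow _ (hsub _) fun w hw => ?_))
      (hweak _ (huni _ (hsub _) ⟨m, fun w hw => ?_⟩))
      (hweak _ (hhigh _ (hsub _) fun w hw => ?_)) <;> rw [Finset.mem_filter] at hw
    · exact him ▸ hlt w hw.1 i hi hw.2
    · exact him ▸ heq w hw.1 i hi hw.2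
    · exact him ▸ hgt w hw.1 i hi hw.2
  push Not at hA
  -- The median is now a gap. Candidates above all entries below `m` and below all entries above `m`
  -- have no entry between their places, so their places coincide.
  have huni' : ∀ Ω' ⊆ Ω, (∀ w ∈ Ω', ∀ i : Fin n, i.val < k.val → c i < m → c i < o w) →
      (∀ w ∈ Ω', ∀ i : Fin n, i.val < k.val → m < c i → o w < c i) →
      ∃ m', ∀ w ∈ Ω', o w = m' := by
    intro Ω' h' h1 h2
    rcases Ω'.eq_empty_or_nonempty with rfl | ⟨u, hu⟩
    · simp
    refine ⟨o u, ?_⟩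
    have key : ∀ w ∈ Ω', ∀ w' ∈ Ω', ¬ o w < o w' := by
      intro w hw w' hw' h
      obtain ⟨i, hi, hi1, hi2⟩ := hbet w (h' hw) w' (h' hw') h
      rcases lt_or_gt_of_ne (hA i hi) with h3 | h3
      · exact absurd (h1 w hw i hi h3) hi1.not_gt
      · exact absurd (h2 w' hw' i hi h3) hi2.not_gt
    exact fun w hw => le_antisymm (not_lt.1 (key u hu w hw)) (not_lt.1 (key w hw u hu))
  -- the search above the greatest entry below the median
  have hB : ∀ Ω' ⊆ Ω, (∀ w ∈ Ω', ∀ i : Fin n, i.val < k.val → c i < m → c i < o w) →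
      Solvable Ω' fun w => f w - 1 := by
    intro Ω' h' h1
    have hsub' : ∀ p : (Fin n → β) → Prop, [DecidablePred p] → Ω'.filter p ⊆ Ω :=
      fun p _ => (Finset.filter_subset _ _).trans h'
    rcases (Finset.univ.filter fun i : Fin n => i.val < k.val ∧ m < c i).eq_empty_or_nonempty
      with he | hne
    · refine hweak _ (huni _ h' (huni' _ h' h1 fun w _ i hi him => ?_))
      exact absurd (Finset.mem_filter.2 ⟨Finset.mem_univ _, hi, him⟩)
        (he ▸ Finset.notMem_empty i)
    · obtain ⟨i, hi, himin⟩ := Finset.exists_min_image _ c hne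
      obtain ⟨-, hik, him⟩ := Finset.mem_filter.1 hi
      refine Solvable.compare k i (hweak' _ (huni _ (hsub' _) (huni' _ (hsub' _) ?_ ?_)))
        (hweak' _ (hhigh _ (hsub' _) fun w hw => ?_))
        (hweak' _ (hhigh _ (hsub' _) fun w hw => ?_))
      · exact fun w hw => h1 w (Finset.mem_filter.1 hw).1
      · intro w hw j hj hmj
        rw [Finset.mem_filter] at hw
        exact (hlt w (h' hw.1) i hik hw.2).trans_le
          (himin j (Finset.mem_filter.2 ⟨Finset.mem_univ _, hj, hmj⟩))
      · rw [Finset.mem_filter] at hw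
        exact heq w (h' hw.1) i hik hw.2 ▸ him
      · rw [Finset.mem_filter] at hw
        exact him.trans (hgt w (h' hw.1) i hik hw.2)
  -- Entry `k` is compared with the lower neighbour of the gap and, only if it is greater, with the
  -- upper neighbour. Every other outcome falls on one side of the median and halves the weight.
  rcases (Finset.univ.filter fun i : Fin n => i.val < k.val ∧ c i < m).eq_empty_or_nonempty
    with he | hne
  · refine (hB Ω subset_rfl fun w _ i hi him => ?_).mono subset_rfl fun w _ => by linarith
    exact absurd (Finset.mem_filter.2 ⟨Finset.mem_univ _, hi, him⟩)
      (he ▸ Finset.notMem_empty i)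
  · obtain ⟨i, hi, himax⟩ := Finset.exists_max_image _ c hne
    obtain ⟨-, hik, him⟩ := Finset.mem_filter.1 hi
    refine Solvable.compare k i (hweak _ (hlow _ (hsub _) fun w hw => ?_))
      (hweak _ (hlow _ (hsub _) fun w hw => ?_)) (hB _ (hsub _) fun w hw j hj hjm => ?_) <;>
      rw [Finset.mem_filter] at hw
    · exact (hlt w hw.1 i hik hw.2).trans him
    · exact heq w hw.1 i hik hw.2 ▸ him
    · exact (himax j (Finset.mem_filter.2 ⟨Finset.mem_univ _, hj, hjm⟩)).trans_lt
        (hgt w hw.1 i hik hw.2)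

/-- Here `d` counts the entries still to be inserted. At `d = 0` all candidates are ordered alike,
and the sorting permutation of any one of them serves for all. -/
theorem solvable_of_agreeBelow {W : (Fin n → β) → ℝ} (d : ℕ) (hd : d ≤ n)
    (Ω : Finset (Fin n → β)) (hW : ∀ w ∈ Ω, 0 < W w) (hΩ : AgreeBelow (n - d) Ω) :
    Solvable Ω fun w => 2 * (d : ℝ) + 2 * Real.logb 2 ((∑ u ∈ Ω, W u) / W w) := by
  induction d generalizing Ω with
  | zero =>
    rcases Ω.eq_empty_or_nonempty with rfl | ⟨w₀, hw₀⟩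
    · exact ⟨.output 1, by simp⟩
    refine ⟨.output (Tuple.sort w₀), fun w hw => ⟨fun a b hab => ?_, ?_⟩⟩
    · exact (hΩ w hw w₀ hw₀ _ _ (Fin.is_lt _) (Fin.is_lt _)).2 (Tuple.monotone_sort w₀ hab)
    · have : 0 ≤ Real.logb 2 ((∑ u ∈ Ω, W u) / W w) := by
        refine Real.logb_nonneg one_lt_two ((one_le_div (hW w hw)).2 ?_)
        exact Finset.single_le_sum (f := W) (fun u hu => (hW u hu).le) hw
      simpa [cost] using this
  | succ d ih =>
    have h1 : n - (d + 1) < n := by omega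
    have h2 : n - (d + 1) + 1 = n - d := by omega
    have h3 : ((n - (d + 1) : ℕ) : ℝ) = n - (d + 1) := by
      rw [Nat.cast_sub hd]
      push_cast
      ring
    have := solvable_of_agreeBelow_succ (k := ⟨n - (d + 1), h1⟩) (W := W) (fun Ω' hW' hΩ' => by
      simp only [h2] at hΩ'
      refine (ih (by omega) Ω' hW' hΩ').mono subset_rfl fun w _ => ?_
      simp only [h3]
      apply le_of_eq
      ring) Ω hW hΩ
    refine this.mono subset_rfl fun w _ => ?_
    simp only [h3]
    push_cast
    apply le_of_eq
    ring

theorem solvable_of_weights {W : (Fin n → β) → ℝ} (Ω : Finset (Fin n → β))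
    (hW : ∀ w ∈ Ω, 0 < W w) :
    Solvable Ω fun w => 2 * (n : ℝ) + 2 * Real.logb 2 ((∑ u ∈ Ω, W u) / W w) :=
  solvable_of_agreeBelow n le_rfl Ω hW fun _ _ _ _ _ _ hi => by simp at hi

end

end CompTree

/-! ### Lower bounds on the depth of sorting trees -/

namespace CompTree

/-- The outcomes of the comparisons performed on `x`. -/
def outcomes {α : Type*} [LinearOrder α] {n : ℕ} (x : Fin n → α) : CompTree n → List Ordering
  | output _ => []
  | compare i j lt eq gt =>
      if x i < x j then .lt :: outcomes x lt
      else if x i = x j then .eq :: outcomes x eq else .gt :: outcomes x gt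

/-- The array `x` with the entry at position `k` replaced by `v` and the others increased. -/
def replaceAt {n : ℕ} (x : Fin n → ℕ) (k : Fin n) (v : ℕ) : Fin n → ℕ :=
  Function.update (fun i => x i + 1) k v

/-- A comparison touches two positions, and changing an untouched entry changes no outcome. The
other entries are raised by 1 so that the value 0 lies strictly below them. -/
theorem exists_touched {n : ℕ} (x : Fin n → ℕ) (T : CompTree n) :
    ∃ t : Finset (Fin n), t.card ≤ 2 * T.cost x ∧
      ∀ k ∉ t, ∀ v, T.result (replaceAt x k v) = T.result x := by
  have key : ∀ k v i, i ≠ k → replaceAt x k v i = x i + 1 := fun k v i h => by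
    simp [replaceAt, h]
  induction T with
  | output σ => exact ⟨∅, by simp, fun _ _ _ => rfl⟩
  | compare i j lt eq gt h1 h2 h3 =>
    obtain ⟨t1, h1, h1'⟩ := h1
    obtain ⟨t2, h2, h2'⟩ := h2
    obtain ⟨t3, h3, h3'⟩ := h3
    have hcard : ∀ t : Finset (Fin n), (insert i (insert j t)).card ≤ t.card + 2 := fun t =>
      (Finset.card_insert_le _ _).trans (Nat.succ_le_succ (Finset.card_insert_le _ _))
    simp only [result, cost]
    rcases lt_trichotomy (x i) (x j) with h | h | h
    · refine ⟨insert i (insert j t1), ?_, fun k hk v => ?_⟩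
      · have := hcard t1
        simp only [h, if_true]
        omega
      · simp only [Finset.mem_insert, not_or] at hk
        rw [key k v i (Ne.symm hk.1), key k v j (Ne.symm hk.2.1)]
        simp [h, h1' k hk.2.2 v]
    · refine ⟨insert i (insert j t2), ?_, fun k hk v => ?_⟩
      · have := hcard t2
        simp only [h, lt_irrefl, if_true, if_false]
        omega
      · simp only [Finset.mem_insert, not_or] at hk
        rw [key k v i (Ne.symm hk.1), key k v j (Ne.symm hk.2.1)]
        simp [h, h2' k hk.2.2 v]
    · refine ⟨insert i (insert j t3), ?_, fun k hk v => ?_⟩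
      · have := hcard t3
        simp only [h.not_gt, h.ne', if_false]
        omega
      · simp only [Finset.mem_insert, not_or] at hk
        rw [key k v i (Ne.symm hk.1), key k v j (Ne.symm hk.2.1)]
        simp [h.not_gt, h.ne', h3' k hk.2.2 v]

/-- A sorting tree has to look at every entry. -/
theorem Sorts.le_two_mul_cost {n : ℕ} (hn : 2 ≤ n) {T : CompTree n} (hT : T.Sorts ℕ)
    (x : Fin n → ℕ) : n ≤ 2 * T.cost x := by
  obtain ⟨t, ht, hres⟩ := exists_touched x T
  refine le_trans ?_ ht
  by_contra! hlt
  obtain ⟨k, hk⟩ : ∃ k, k ∉ t := by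
    by_contra! hall
    have := Finset.card_le_card (fun k _ => hall k : Finset.univ ⊆ t)
    simp only [Finset.card_univ, Fintype.card_fin] at this
    omega
  have : Nontrivial (Fin n) := Fin.nontrivial_iff_two_le.2 hn
  obtain ⟨j, hj⟩ := exists_ne k
  -- Entry `j` becomes `x j + 1`, so the two replacements put entry `k` strictly below and strictly
  -- above it; one permutation cannot sort both.
  have h1 := hT (replaceAt x k 0)
  have h2 := hT (replaceAt x k (x j + 2))
  rw [hres k hk] at h1 h2
  set σ := T.result x
  rcases le_total (σ.symm j) (σ.symm k) with h | h
  · have := h1 h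
    simp [replaceAt, hj] at this
  · have := h2 h
    simp [replaceAt, hj] at this

/-- Along the common branch each comparison has the same outcome on `x` and `x'`, and the hypotheses
pass this outcome on to `x''`. -/
theorem result_eq_of_outcomes_eq {α : Type*} [LinearOrder α] {n : ℕ} {x x' x'' : Fin n → α}
    (h1 : ∀ i j, x i < x j → x' i < x' j → x'' i < x'' j)
    (h2 : ∀ i j, x i = x j → x' i = x' j → x'' i = x'' j)
    (T : CompTree n) (h : T.outcomes x = T.outcomes x') :
    T.result x' = T.result x ∧ T.result x'' = T.result x := by
  induction T with
  | output σ => exact ⟨rfl, rfl⟩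
  | compare i j lt eq gt i1 i2 i3 =>
    simp only [outcomes] at h
    simp only [result]
    split_ifs at h with hx hx' hx' hx hx' hx' hx' hx' <;>
      simp only [List.cons.injEq, reduceCtorEq, false_and, true_and] at h
    · have := h1 i j hx hx'
      simpa [hx, hx', this] using i1 h
    · have := h2 i j hx (by assumption)
      simp [*]
    · have h3 := lt_of_le_of_ne (not_lt.1 ‹¬ x i < x j›) (Ne.symm ‹¬ x i = x j›)
      have h4 := lt_of_le_of_ne (not_lt.1 ‹¬ x' i < x' j›) (Ne.symm ‹¬ x' i = x' j›)
      have := h1 j i h3 h4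
      simpa [h3.not_gt, h4.not_gt, h3.ne', h4.ne', this.not_gt, this.ne'] using i3 h

/-- Arrays that a sorting tree does not tell apart are ordered in the same way. -/
theorem Sorts.le_iff_of_outcomes_eq {n : ℕ} {T : CompTree n} (hT : T.Sorts ℕ)
    {x x' : Fin n → ℕ} (h : T.outcomes x = T.outcomes x') (i j : Fin n) :
    x i ≤ x j ↔ x' i ≤ x' j := by
  have key : ∀ {x x' : Fin n → ℕ}, T.outcomes x = T.outcomes x' →
      ∀ i j, x i ≤ x j → x' i ≤ x' j := by
    clear h i j x x'
    intro x x' h i j hij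
    by_contra! hji
    set K := Finset.univ.sup x' with hK
    have hxK : ∀ a, x' a ≤ K := fun a => Finset.le_sup (Finset.mem_univ a)
    -- `x''` orders by `x` and breaks ties by the reverse of `x'`, so it follows the same branch and
    -- one permutation sorts all three arrays. It puts `j` before `i` because of `x'`; then `x`
    -- forces `x i = x j`, and the tie in `x''` is broken the wrong way.
    set x'' : Fin n → ℕ := fun a => (K + 1) * x a + (K - x' a) with hx''
    obtain ⟨hr, hr'⟩ := result_eq_of_outcomes_eq (x'' := x'') (fun a b hab _ => by
      have h1 : (K + 1) * (x a + 1) ≤ (K + 1) * x b := Nat.mul_le_mul_left _ hab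
      simp only [hx'']
      have : K - x' a ≤ K := Nat.sub_le _ _
      rw [Nat.mul_add] at h1
      omega) (fun a b hab hab' => by simp only [hx'', hab, hab']) T h
    have m := hT x
    have m' := hT x'
    have m'' := hT x''
    rw [hr] at m'
    rw [hr'] at m''
    set σ := T.result x
    have hle : σ.symm j ≤ σ.symm i := by
      by_contra! hlt
      have := m' hlt.le
      simp only [Equiv.apply_symm_apply] at this
      omega
    have e1 := m hle
    have e2 := m'' hle
    simp only [Equiv.apply_symm_apply, hx''] at e1 e2
    have e3 : x i = x j := le_antisymm hij e1
    rw [e3] at e2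
    have := hxK i
    omega
  exact ⟨key h i j, key h.symm i j⟩

theorem card_le_three_pow {α : Type*} [LinearOrder α] {n : ℕ} (T : CompTree n) (D : ℕ)
    (F : Finset (Fin n → α)) (hF : Set.InjOn (fun x => T.outcomes x) (F : Set (Fin n → α)))
    (hD : ∀ x ∈ F, T.cost x ≤ D) : F.card ≤ 3 ^ D := by
  induction T generalizing D F with
  | output σ =>
    refine le_trans (Finset.card_le_one.2 fun x hx y hy => hF hx hy rfl)
      (Nat.one_le_pow _ _ (by norm_num))
  | compare i j lt eq gt i1 i2 i3 =>
    rcases F.eq_empty_or_nonempty with rfl | ⟨x₀, hx₀⟩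
    · simp
    obtain ⟨D, rfl⟩ : ∃ D', D = D' + 1 := by
      have := hD x₀ hx₀
      simp only [cost] at this
      exact ⟨D - 1, by omega⟩
    have h1 := i1 D (F.filter fun x => x i < x j) (fun x hx y hy hxy => by
      simp only [Finset.coe_filter, Set.mem_ofPred_eq] at hx hy
      refine hF hx.1 hy.1 ?_
      simpa [outcomes, hx.2, hy.2] using hxy) (fun x hx => by
      rw [Finset.mem_filter] at hx
      have := hD x hx.1
      simp only [cost, hx.2, if_true] at this
      omega)
    have h2 := i2 D (F.filter fun x => x i = x j) (fun x hx y hy hxy => by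
      simp only [Finset.coe_filter, Set.mem_ofPred_eq] at hx hy
      refine hF hx.1 hy.1 ?_
      simpa [outcomes, hx.2, hy.2] using hxy) (fun x hx => by
      rw [Finset.mem_filter] at hx
      have := hD x hx.1
      simp only [cost, hx.2, lt_irrefl, if_true, if_false] at this
      omega)
    have h3 := i3 D (F.filter fun x => x j < x i) (fun x hx y hy hxy => by
      simp only [Finset.coe_filter, Set.mem_ofPred_eq] at hx hy
      refine hF hx.1 hy.1 ?_
      simpa [outcomes, hx.2.not_gt, hy.2.not_gt, hx.2.ne', hy.2.ne'] using hxy) (fun x hx => by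
      rw [Finset.mem_filter] at hx
      have := hD x hx.1
      simp only [cost, hx.2.not_gt, hx.2.ne', if_false] at this
      omega)
    have hsub : F ⊆ (F.filter fun x => x i < x j) ∪ (F.filter fun x => x i = x j) ∪
        (F.filter fun x => x j < x i) := fun x hx => by
      simp only [Finset.mem_union, Finset.mem_filter, hx, true_and]
      rcases lt_trichotomy (x i) (x j) with h | h | h <;> tauto
    have := (Finset.card_le_card hsub).trans ((Finset.card_union_le _ _).trans
      (Nat.add_le_add_right (Finset.card_union_le _ _) _))
    rw [pow_succ]
    omega

end CompTree

/-! ### Pivot positions in terms of lists -/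

/-- The starting positions of consecutive lists. -/
def startPositions {α : Type*} : ℕ → List (List α) → List ℕ
  | _, [] => []
  | a, y :: ys => a :: startPositions (a + y.length) ys

theorem zipWith_startPositions {α : Type*} (ys : List (List α)) (pre : List α) :
    List.zipWith (fun a b => ((pre ++ ys.flatten).drop a).take (b - a))
      (startPositions pre.length ys)
      ((startPositions pre.length ys).tail ++ [(pre ++ ys.flatten).length]) = ys := by
  induction ys generalizing pre with
  | nil => rfl
  | cons y ys ih =>
    cases ys with
    | nil => simp [startPositions]
    | cons z zs =>
      have := ih (pre ++ y)
      rw [List.length_append, List.append_assoc, ← List.flatten_cons] at this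
      conv_rhs => rw [← this]
      simp [startPositions]

/-- The list cannot be cut so that all entries before the cut are at most those after it. -/
def Indecomposable {α : Type*} [LinearOrder α] (l : List α) : Prop :=
  ∀ l₁ l₂, l = l₁ ++ l₂ → l₁ ≠ [] → l₂ ≠ [] → ∃ a ∈ l₁, ∃ b ∈ l₂, b < a

/-- The members are nonempty and indecomposable, and their entries increase from one to the
next. -/
def IsPivotCutting {α : Type*} [LinearOrder α] (ys : List (List α)) : Prop :=
  (∀ y ∈ ys, y ≠ [] ∧ Indecomposable y) ∧ ys.Pairwise fun y z => ∀ a ∈ y, ∀ b ∈ z, a ≤ b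

section

variable {α : Type*} [LinearOrder α]

theorem isPivotCutting_cons {y : List α} {ys : List (List α)} :
    IsPivotCutting (y :: ys) ↔ y ≠ [] ∧ Indecomposable y ∧
      (∀ a ∈ y, ∀ b ∈ ys.flatten, a ≤ b) ∧ IsPivotCutting ys := by
  simp only [IsPivotCutting, List.mem_cons, forall_eq_or_imp, List.pairwise_cons,
    List.mem_flatten]
  constructor
  · rintro ⟨⟨⟨h1, h2⟩, h3⟩, h4, h5⟩
    exact ⟨h1, h2, fun a ha b ⟨l, hl, hb⟩ => h4 l hl a ha b hb, h3, h5⟩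
  · rintro ⟨h1, h2, h3, h4, h5⟩
    exact ⟨⟨⟨h1, h2⟩, h4⟩, fun z hz a ha b hb => h3 a ha b ⟨z, hz, hb⟩, h5⟩

theorem IsPivotCutting.append {ys zs : List (List α)} (h : IsPivotCutting ys)
    (h' : IsPivotCutting zs) (hle : ∀ a ∈ ys.flatten, ∀ b ∈ zs.flatten, a ≤ b) :
    IsPivotCutting (ys ++ zs) := by
  refine ⟨fun y hy => ?_, List.pairwise_append.2 ⟨h.2, h'.2, fun y hy z hz a ha b hb => ?_⟩⟩
  · rcases List.mem_append.1 hy with hy | hy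
    exacts [h.1 y hy, h'.1 y hy]
  · exact hle a (List.mem_flatten.2 ⟨y, hy, ha⟩) b (List.mem_flatten.2 ⟨z, hz, hb⟩)

theorem exists_isPivotCutting (l : List α) : ∃ ys, IsPivotCutting ys ∧ ys.flatten = l := by
  induction hn : l.length using Nat.strong_induction_on generalizing l with
  | _ n ih =>
  by_cases h0 : l = []
  · exact ⟨[], ⟨by simp, by simp⟩, by simp [h0]⟩
  by_cases hl : Indecomposable l
  · exact ⟨[l], ⟨by simp [h0, hl], by simp⟩, by simp⟩
  · unfold Indecomposable at hl
    push Not at hl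
    obtain ⟨l₁, l₂, rfl, h1, h2, hle⟩ := hl
    have p1 := List.length_pos_iff.2 h1
    have p2 := List.length_pos_iff.2 h2
    rw [List.length_append] at hn
    obtain ⟨ys, hys, rfl⟩ := ih l₁.length (by omega) l₁ rfl
    obtain ⟨zs, hzs, rfl⟩ := ih l₂.length (by omega) l₂ rfl
    exact ⟨ys ++ zs, hys.append hzs hle, by simp⟩

/-- A cut inside a piece would contradict its indecomposability, and one at the start of a piece is
admissible. The prefix `pre` holds the pieces already passed. -/
theorem filter_isCut {ys : List (List α)} (hys : IsPivotCutting ys) (pre : List α)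
    (hpre : ∀ a ∈ pre, ∀ b ∈ ys.flatten, a ≤ b) :
    (List.range' pre.length ys.flatten.length).filter (fun p => decide
      (∀ a ∈ (pre ++ ys.flatten).take p, ∀ b ∈ (pre ++ ys.flatten).drop p, a ≤ b)) =
    startPositions pre.length ys := by
  induction ys generalizing pre with
  | nil => rfl
  | cons y ys ih =>
    obtain ⟨hy0, hyi, hle, hys'⟩ := isPivotCutting_cons.1 hys
    have hpos := List.length_pos_iff.2 hy0
    have e1 := ih hys' (pre ++ y) fun a ha b hb => by
      rcases List.mem_append.1 ha with ha | ha
      · exact hpre a ha b (by simp only [List.flatten_cons, List.mem_append, hb, or_true])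
      · exact hle a ha b hb
    rw [List.length_append, List.append_assoc, ← List.flatten_cons] at e1
    have e2 : List.range' pre.length (y :: ys).flatten.length =
        pre.length :: (List.range' (pre.length + 1) (y.length - 1) ++
          List.range' (pre.length + y.length) ys.flatten.length) := by
      have e3 : List.range' pre.length y.length =
          pre.length :: List.range' (pre.length + 1) (y.length - 1) := by
        obtain ⟨k, hk⟩ : ∃ k, y.length = k + 1 := ⟨y.length - 1, by omega⟩
        rw [hk, List.range'_succ, Nat.add_sub_cancel]
      rw [← List.cons_append, ← e3, List.range'_append_1, List.flatten_cons,
        List.length_append]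
    rw [e2, List.filter_cons_of_pos, List.filter_append, e1, startPositions,
      List.filter_eq_nil_iff.2, List.nil_append]
    · intro p hp
      rw [List.mem_range'_1] at hp
      simp only [decide_eq_true_eq]
      intro hcut
      obtain ⟨a, ha, b, hb, hba⟩ := hyi (y.take (p - pre.length)) (y.drop (p - pre.length))
        (List.take_append_drop _ _).symm
        (by rw [← List.length_pos_iff, List.length_take]; omega)
        (by rw [← List.length_pos_iff, List.length_drop]; omega)
      refine hba.not_ge (hcut a ?_ b ?_)
      · rw [List.take_append, List.mem_append, List.flatten_cons, List.take_append,
          List.mem_append]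
        exact Or.inr (Or.inl ha)
      · rw [List.drop_append, List.mem_append, List.flatten_cons, List.drop_append,
          List.mem_append]
        exact Or.inr (Or.inl hb)
    · rw [decide_eq_true_eq, List.take_left, List.drop_left]
      exact hpre

theorem isPivotPosition_iff {n : ℕ} (x : Fin n → α) (p : Fin n) :
    IsPivotPosition x p ↔
      ∀ a ∈ (List.ofFn x).take p, ∀ b ∈ (List.ofFn x).drop p, a ≤ b := by
  constructor
  · intro h a ha b hb
    obtain ⟨i, hi, rfl⟩ := List.mem_take_iff_getElem.1 ha
    obtain ⟨j, hj, rfl⟩ := List.mem_drop_iff_getElem.1 hb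
    simp only [List.length_ofFn] at hi hj
    simp only [List.getElem_ofFn]
    exact h ⟨i, by omega⟩ ⟨p + j, by omega⟩ (Fin.lt_def.2 (by simp only; omega))
      (Fin.le_def.2 (by simp only; omega))
  · intro h a b ha hb
    refine h _ (List.mem_take_iff_getElem.2 ⟨a, ?_, ?_⟩) _
      (List.mem_drop_iff_getElem.2 ⟨b - p, ?_, ?_⟩)
    · have := Fin.lt_def.1 ha
      simp only [List.length_ofFn]
      omega
    · simp
    · have := Fin.le_def.1 hb
      simp only [List.length_ofFn]
      omega
    · have := Fin.le_def.1 hb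
      simp only [List.getElem_ofFn]
      congr 1
      exact Fin.ext (by simp only; omega)

theorem map_val_pivotPositions {n : ℕ} (x : Fin n → α) :
    (pivotPositions x).map Fin.val = (List.range n).filter fun p => decide
      (∀ a ∈ (List.ofFn x).take p, ∀ b ∈ (List.ofFn x).drop p, a ≤ b) := by
  rw [← List.map_coe_finRange_eq_range, List.filter_map]
  unfold pivotPositions
  congr 2
  funext p
  exact decide_eq_decide.2 (isPivotPosition_iff x p)

/-- Position `0` is vacuously a pivot position, which produces the empty first sub-instance. -/
theorem subInstances_eq {n : ℕ} (hn : n ≠ 0) (x : Fin n → α) {ys : List (List α)}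
    (hys : IsPivotCutting ys) (hx : List.ofFn x = ys.flatten) : subInstances x = [] :: ys := by
  have hlen : ys.flatten.length = n := by rw [← hx, List.length_ofFn]
  have h1 := filter_isCut hys [] (by simp)
  have h2 := zipWith_startPositions ys []
  simp only [List.nil_append, List.length_nil, hlen] at h1 h2
  rw [← List.range_eq_range'] at h1
  unfold subInstances
  simp only [map_val_pivotPositions, hx, h1]
  obtain ⟨y, ys, rfl⟩ : ∃ y ys', ys = y :: ys' := by
    cases ys with
    | nil => exact absurd (by simpa using hlen.symm) hn
    | cons y ys => exact ⟨y, ys, rfl⟩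
  conv_rhs => rw [← h2]
  simp [startPositions]

end

/-- A union bound. Since every run meets some member of the partition, it yields
`runs_le_sum_memberValues`. -/
theorem countP_exists_le {α β : Type*} (R : List β) (Js : List (List α))
    (p : List α → β → Prop) [∀ J r, Decidable (p J r)] :
    (R.countP fun r => decide (∃ J ∈ Js, p J r)) ≤
      (Js.map fun J => R.countP fun r => decide (p J r)).sum := by
  induction Js with
  | nil => simp
  | cons J Js ih =>
    rw [List.map_cons, List.sum_cons]
    refine le_trans ?_ (Nat.add_le_add_left ih _)
    clear ih
    induction R with
    | nil => simp
    | cons r R ih =>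
      simp only [List.countP_cons, List.mem_cons, exists_eq_or_imp] at ih ⊢
      by_cases h1 : p J r <;> by_cases h2 : ∃ K ∈ Js, p K r <;>
        simp only [h1, h2, or_true, true_or, or_self, decide_true, decide_false, if_true,
          Bool.false_eq_true, if_false] <;> omega

/-! ### The partition of the output -/

section

variable {α : Type*} [LinearOrder α]

/-- The distinct entries of a list in increasing order. -/
def distinctValues (l : List α) : List α := l.toFinset.sort (· ≤ ·)

theorem mem_distinctValues {l : List α} {v : α} : v ∈ distinctValues l ↔ v ∈ l := by
  simp [distinctValues]

theorem nodup_distinctValues (l : List α) : (distinctValues l).Nodup :=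
  Finset.sort_nodup _ _

theorem pairwise_distinctValues (l : List α) : (distinctValues l).Pairwise (· ≤ ·) :=
  Finset.pairwise_sort _ _

theorem distinctValues_eq {l m : List α} (hd : m.Nodup) (hp : m.Pairwise (· ≤ ·))
    (hm : ∀ v, v ∈ m ↔ v ∈ l) : distinctValues l = m := by
  have : l.toFinset = m.toFinset := by
    ext v
    simp [hm]
  rw [distinctValues, this]
  exact (List.toFinset_sort (· ≤ ·) hd).2 hp

theorem card_filter_get {β : Type*} (l : List β) (p : β → Prop) [DecidablePred p] :
    (Finset.univ.filter fun i : Fin l.length => p (l.get i)).card = l.countP fun b => p b := by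
  induction l with
  | nil => rfl
  | cons b l ih =>
    have h := Fin.card_filter_univ_succ (n := l.length) (fun i => p ((b :: l).get i))
    refine h.trans ?_
    have e : ∀ i : Fin l.length, (b :: l).get i.succ = l.get i := fun i => rfl
    have e0 : (b :: l).get 0 = b := rfl
    simp only [e, e0, ih, List.countP_cons, decide_eq_true_eq]
    split_ifs <;> rfl

theorem owners_eq_iff {R : List (List α)} {a b : α} :
    owners R a = owners R b ↔ ∀ r ∈ R, a ∈ r ↔ b ∈ r := by
  simp only [owners, Finset.ext_iff, Finset.mem_filter, Finset.mem_univ, true_and]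
  constructor
  · intro h r hr
    obtain ⟨i, rfl⟩ := List.get_of_mem hr
    exact h i
  · exact fun h i => h _ (List.get_mem _ _)

theorem card_owners (R : List (List α)) (v : α) :
    (owners R v).card = R.countP fun r => v ∈ r :=
  card_filter_get R fun r => v ∈ r

/-- Two values that belong to the same member of the partition if they are adjacent. -/
def SameOwner (R : List (List α)) (a b : α) : Prop :=
  (∀ r ∈ R, a ∈ r ↔ b ∈ r) ∧ (R.countP fun r => a ∈ r) = 1

theorem outputPartition_eq_iff {R : List (List α)} {Js : List (List α)} :
    outputPartition R = Js ↔ distinctValues R.flatten = Js.flatten ∧ [] ∉ Js ∧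
      (∀ J ∈ Js, J.IsChain (SameOwner R)) ∧
      Js.IsChain fun J K => ∃ hJ hK, ¬ SameOwner R (J.getLast hJ) (K.head hK) := by
  unfold outputPartition
  rw [List.splitBy_eq_iff]
  simp only [owners_eq_iff, card_owners, decide_eq_true_eq, decide_eq_false_iff_not,
    SameOwner, distinctValues]
  exact Iff.rfl

theorem flatten_outputPartition (R : List (List α)) :
    (outputPartition R).flatten = distinctValues R.flatten :=
  (outputPartition_eq_iff.1 rfl).1.symm

theorem ne_nil_of_mem_outputPartition {R : List (List α)} {J : List α}
    (hJ : J ∈ outputPartition R) : J ≠ [] :=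
  fun h => (outputPartition_eq_iff.1 rfl).2.1 (h ▸ hJ)

theorem mem_flatten_of_mem_outputPartition {R : List (List α)} {J : List α}
    (hJ : J ∈ outputPartition R) {v : α} (hv : v ∈ J) : v ∈ R.flatten := by
  rw [← mem_distinctValues, ← flatten_outputPartition]
  exact List.mem_flatten.2 ⟨J, hJ, hv⟩

theorem SameOwner.trans {R : List (List α)} {a b c : α} (h : SameOwner R a b)
    (h' : SameOwner R b c) : SameOwner R a c :=
  ⟨fun r hr => (h.1 r hr).trans (h'.1 r hr), h.2⟩

theorem pairwise_of_mem_outputPartition {R : List (List α)} {J : List α}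
    (hJ : J ∈ outputPartition R) : J.Pairwise (SameOwner R) := by
  have : IsTrans α (SameOwner R) := ⟨fun _ _ _ => SameOwner.trans⟩
  exact List.isChain_iff_pairwise.1 ((outputPartition_eq_iff.1 rfl).2.2.1 J hJ)

theorem mem_iff_of_mem_outputPartition {R : List (List α)} {J : List α}
    (hJ : J ∈ outputPartition R) {u v : α} (hu : u ∈ J) (hv : v ∈ J) {r : List α}
    (hr : r ∈ R) : u ∈ r ↔ v ∈ r := by
  by_cases huv : u = v
  · rw [huv]
  · have hp : J.Pairwise fun a b => ∀ r ∈ R, a ∈ r ↔ b ∈ r :=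
      (pairwise_of_mem_outputPartition hJ).imp fun h => h.1
    have : Std.Symm fun a b : α => ∀ r ∈ R, a ∈ r ↔ b ∈ r :=
      ⟨fun a b h r hr => (h r hr).symm⟩
    exact hp.forall hu hv huv r hr

theorem length_memberBlockSizes (R : List (List α)) (J : List α) :
    (memberBlockSizes R J).length = R.countP fun r => ∃ v ∈ J, v ∈ r := by
  unfold memberBlockSizes
  rw [← List.countP_eq_length_filter, List.countP_map]
  refine List.countP_congr fun r _ => ?_
  simp only [Function.comp, decide_eq_true_eq, List.countP_pos_iff]
  exact ⟨fun ⟨v, h1, h2⟩ => ⟨v, h2, h1⟩, fun ⟨v, h1, h2⟩ => ⟨v, h2, h1⟩⟩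

theorem length_memberBlockSizes_eq {R : List (List α)} {J : List α}
    (hJ : J ∈ outputPartition R) {v : α} (hv : v ∈ J) :
    (memberBlockSizes R J).length = R.countP fun r => v ∈ r := by
  rw [length_memberBlockSizes]
  refine List.countP_congr fun r hr => ?_
  simp only [decide_eq_true_eq]
  exact ⟨fun ⟨u, hu, hur⟩ => (mem_iff_of_mem_outputPartition hJ hu hv hr).1 hur,
    fun h => ⟨v, hv, h⟩⟩

theorem length_memberBlockSizes_pos {R : List (List α)} {J : List α}
    (hJ : J ∈ outputPartition R) : 0 < (memberBlockSizes R J).length := by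
  obtain ⟨v, hv⟩ := List.exists_mem_of_ne_nil _ (ne_nil_of_mem_outputPartition hJ)
  rw [length_memberBlockSizes_eq hJ hv, List.countP_pos_iff]
  obtain ⟨r, hr, hvr⟩ := List.mem_flatten.1 (mem_flatten_of_mem_outputPartition hJ hv)
  exact ⟨r, hr, by simpa using hvr⟩

theorem length_memberBlockSizes_le (R : List (List α)) (J : List α) :
    (memberBlockSizes R J).length ≤ R.length := by
  rw [length_memberBlockSizes]
  exact List.countP_le_length

theorem sum_countP_mem {Js : List (List α)} (h : Js.flatten.Nodup) (r : List α) :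
    (Js.map fun J => r.countP fun v => v ∈ J).sum = r.countP fun v => v ∈ Js.flatten := by
  induction Js with
  | nil => simp
  | cons J Js ih =>
    rw [List.flatten_cons, List.nodup_append] at h
    rw [List.map_cons, List.sum_cons, ih h.2.1]
    clear ih
    induction r with
    | nil => rfl
    | cons a r ihr =>
      simp only [List.countP_cons, List.flatten_cons, List.mem_append] at ihr ⊢
      have : a ∈ J → a ∉ Js.flatten := fun h1 h2 => h.2.2 a h1 a h2 rfl
      by_cases h1 : a ∈ J <;> by_cases h2 : a ∈ Js.flatten <;>
        simp only [h1, h2, or_true, true_or, or_self, decide_true, decide_false, if_true,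
          Bool.false_eq_true, if_false] <;> first | omega | exact absurd h2 (this h1)

theorem sum_filter_pos (l : List ℕ) : (l.filter fun g => decide (0 < g)).sum = l.sum := by
  induction l with
  | nil => rfl
  | cons a l ih =>
    rcases Nat.eq_zero_or_pos a with rfl | h
    · simpa using ih
    · simp [h, ih]

theorem sum_map_sum_map {β γ : Type*} (l : List β) (m : List γ) (f : β → γ → ℕ) :
    (l.map fun b => (m.map fun c => f b c).sum).sum =
      (m.map fun c => (l.map fun b => f b c).sum).sum := by
  induction l with
  | nil => simp
  | cons b l ih => simp [ih, List.sum_map_add]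

/-- Each entry is counted in exactly one block. Besides the partition of the output, this is applied
in `runCode_mem` to the partition into single values. -/
theorem sum_flatMap_memberBlockSizes {R : List (List α)} {Js : List (List α)}
    (hJs : Js.flatten.Nodup) (hR : ∀ v ∈ R.flatten, v ∈ Js.flatten) :
    (Js.flatMap (memberBlockSizes R)).sum = R.flatten.length := by
  simp only [List.flatMap_def, List.sum_flatten, List.map_map, Function.comp_def,
    memberBlockSizes, sum_filter_pos, List.length_flatten]
  rw [sum_map_sum_map]
  congr 1
  refine List.map_congr_left fun r hr => ?_
  rw [sum_countP_mem hJs, List.countP_eq_length]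
  exact fun v hv => decide_eq_true (hR v (List.mem_flatten.2 ⟨r, hr, hv⟩))

theorem sum_blockSizes (R : List (List α)) :
    (subParams R).blockSizes.sum = (subParams R).size := by
  refine sum_flatMap_memberBlockSizes ?_ fun v hv => ?_ <;> rw [flatten_outputPartition]
  · exact nodup_distinctValues _
  · exact mem_distinctValues.2 hv

theorem pos_of_mem_flatMap_memberBlockSizes {R : List (List α)} {Js : List (List α)} {g : ℕ}
    (hg : g ∈ Js.flatMap (memberBlockSizes R)) : 0 < g := by
  simp only [List.mem_flatMap, memberBlockSizes, List.mem_filter] at hg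
  obtain ⟨-, -, -, h⟩ := hg
  simpa using h

theorem blockSizes_pos {R : List (List α)} {g : ℕ} (hg : g ∈ (subParams R).blockSizes) :
    0 < g :=
  pos_of_mem_flatMap_memberBlockSizes hg

theorem memberValues_pos {R : List (List α)} {m : ℕ} (hm : m ∈ (subParams R).memberValues) :
    0 < m := by
  simp only [subParams, List.mem_map] at hm
  obtain ⟨J, hJ, rfl⟩ := hm
  exact length_memberBlockSizes_pos hJ

theorem memberValues_le {R : List (List α)} {m : ℕ} (hm : m ∈ (subParams R).memberValues) :
    m ≤ (subParams R).runs := by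
  simp only [subParams, List.mem_map] at hm
  obtain ⟨J, hJ, rfl⟩ := hm
  exact length_memberBlockSizes_le R J

theorem sum_memberValues (R : List (List α)) :
    (subParams R).memberValues.sum = (subParams R).blockSizes.length := by
  simp [subParams, List.length_flatMap]

theorem length_le_sum {l : List ℕ} (h : ∀ a ∈ l, 0 < a) : l.length ≤ l.sum := by
  induction l with
  | nil => simp
  | cons a l ih =>
    have h1 := h a (by simp)
    have h2 := ih fun b hb => h b (by simp [hb])
    simp only [List.length_cons, List.sum_cons]
    omega

theorem runs_le_sum_memberValues {y : List α} {R : List (List α)}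
    (hR : IsRunDecomposition y R) :
    (subParams R).runs ≤ (subParams R).memberValues.sum := by
  simp only [subParams, length_memberBlockSizes]
  refine le_trans (le_of_eq ?_)
    (countP_exists_le R (outputPartition R) fun J r => ∃ v ∈ J, v ∈ r)
  refine (List.countP_eq_length.2 fun r hr => ?_).symm
  obtain ⟨v, hv⟩ := List.exists_mem_of_ne_nil _ (hR.2 r hr).1
  have : v ∈ (outputPartition R).flatten := by
    rw [flatten_outputPartition, mem_distinctValues]
    exact List.mem_flatten.2 ⟨r, hr, hv⟩
  obtain ⟨J, hJ, hvJ⟩ := List.mem_flatten.1 this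
  exact decide_eq_true ⟨J, hJ, v, hvJ, hv⟩

theorem length_blockSizes_le (R : List (List α)) :
    (subParams R).blockSizes.length ≤ (subParams R).size :=
  (length_le_sum fun _ => blockSizes_pos).trans (sum_blockSizes R).le

theorem sum_memberValues_le (R : List (List α)) :
    (subParams R).memberValues.sum ≤ (subParams R).size :=
  (sum_memberValues R).le.trans (length_blockSizes_le R)

theorem length_memberValues_le (R : List (List α)) :
    (subParams R).memberValues.length ≤ (subParams R).size :=
  (length_le_sum fun _ => memberValues_pos).trans (sum_memberValues_le R)

theorem runs_le_size {y : List α} {R : List (List α)} (hR : IsRunDecomposition y R) :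
    (subParams R).runs ≤ (subParams R).size :=
  (runs_le_sum_memberValues hR).trans (sum_memberValues_le R)

theorem sum_map_length_outputPartition_le (R : List (List α)) :
    ((outputPartition R).map List.length).sum ≤ R.flatten.length := by
  rw [← List.length_flatten, flatten_outputPartition, distinctValues, Finset.length_sort]
  exact List.toFinset_card_le _

/-! ### Strictly monotone transformations of the entries -/

variable {β : Type*} [LinearOrder β]

theorem distinctValues_map {f : α → β} (hf : StrictMono f) (l : List α) :
    distinctValues (l.map f) = (distinctValues l).map f := by
  refine distinctValues_eq ((nodup_distinctValues l).map hf.injective)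
    (List.pairwise_map.2 ((pairwise_distinctValues l).imp fun h => hf.monotone h))
    fun v => ?_
  simp [mem_distinctValues]

theorem sameOwner_map {f : α → β} (hf : StrictMono f) (R : List (List α)) (a b : α) :
    SameOwner (R.map (List.map f)) (f a) (f b) ↔ SameOwner R a b := by
  have : ∀ v r, f v ∈ List.map f r ↔ v ∈ r := fun v r => List.mem_map_of_injective hf.injective
  simp [SameOwner, List.countP_map, Function.comp_def, this]

theorem outputPartition_map {f : α → β} (hf : StrictMono f) (R : List (List α)) :
    outputPartition (R.map (List.map f)) = (outputPartition R).map (List.map f) := by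
  obtain ⟨h1, h2, h3, h4⟩ := outputPartition_eq_iff.1 (rfl : outputPartition R = _)
  refine outputPartition_eq_iff.2 ⟨?_, ?_, ?_, ?_⟩
  · rw [← List.map_flatten, distinctValues_map hf, h1, List.map_flatten]
  · simpa using h2
  · simp only [List.mem_map, forall_exists_index, and_imp, forall_apply_eq_imp_iff₂,
      List.isChain_map, sameOwner_map hf]
    exact h3
  · rw [List.isChain_map]
    refine h4.imp ?_
    rintro J K ⟨hJ, hK, h⟩
    refine ⟨by simpa using hJ, by simpa using hK, ?_⟩
    rwa [List.getLast_map, List.head_map, sameOwner_map hf]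

theorem memberBlockSizes_map {f : α → β} (hf : StrictMono f) (R : List (List α)) (J : List α) :
    memberBlockSizes (R.map (List.map f)) (J.map f) = memberBlockSizes R J := by
  simp [memberBlockSizes, List.countP_map, Function.comp_def, hf.injective.eq_iff]

/-- Needed to shift sub-instances above the preceding ones in `IsJointRealization.cons`. -/
theorem subParams_map {f : α → β} (hf : StrictMono f) (R : List (List α)) :
    subParams (R.map (List.map f)) = subParams R := by
  simp only [subParams, outputPartition_map hf, List.flatMap_map, List.map_map,
    Function.comp_def, memberBlockSizes_map hf, ← List.map_flatten, List.length_map]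

theorem IsRunDecomposition.map {f : α → β} (hf : StrictMono f) {y : List α}
    {R : List (List α)} (h : IsRunDecomposition y R) :
    IsRunDecomposition (y.map f) (R.map (List.map f)) := by
  refine ⟨by rw [← List.map_flatten, h.1], fun r hr => ?_⟩
  obtain ⟨s, hs, rfl⟩ := List.mem_map.1 hr
  exact ⟨by simpa using (h.2 s hs).1,
    List.pairwise_map.2 ((h.2 s hs).2.imp fun h => hf.monotone h)⟩

theorem Indecomposable.map {f : α → β} (hf : StrictMono f) {y : List α}
    (h : Indecomposable y) : Indecomposable (y.map f) := by
  intro l₁ l₂ he h1 h2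
  obtain ⟨m₁, m₂, rfl, rfl, rfl⟩ := List.map_eq_append_iff.1 he
  obtain ⟨a, ha, b, hb, hba⟩ := h m₁ m₂ rfl (by simpa using h1) (by simpa using h2)
  exact ⟨f a, List.mem_map_of_mem ha, f b, List.mem_map_of_mem hb, hf hba⟩

theorem IsPivotCutting.map {f : α → β} (hf : StrictMono f) {ys : List (List α)}
    (h : IsPivotCutting ys) : IsPivotCutting (ys.map (List.map f)) := by
  refine ⟨fun y hy => ?_, List.pairwise_map.2 (h.2.imp fun h => ?_)⟩
  · obtain ⟨z, hz, rfl⟩ := List.mem_map.1 hy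
    exact ⟨by simpa using (h.1 z hz).1, (h.1 z hz).2.map hf⟩
  · simp only [List.mem_map, forall_exists_index, and_imp, forall_apply_eq_imp_iff₂]
    exact fun a ha b hb => hf.monotone (h a ha b hb)

end

/-! ### Counting lists -/

/-- The lists of natural numbers for which the sum and the length add up to at most `M`. -/
def natLists : ℕ → Finset (List ℕ)
  | 0 => {[]}
  | M + 1 => insert [] ((natLists M).image (fun l => 0 :: l) ∪
      (natLists M).image fun l => (l.headD 0 + 1) :: l.tail)

theorem mem_natLists {M : ℕ} {l : List ℕ} (h : l.sum + l.length ≤ M) : l ∈ natLists M := by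
  induction M generalizing l with
  | zero =>
    have : l = [] := List.length_eq_zero_iff.1 (by omega)
    simp [natLists, this]
  | succ M ih =>
    simp only [natLists, Finset.mem_insert, Finset.mem_union, Finset.mem_image]
    match l with
    | [] => exact Or.inl rfl
    | 0 :: l =>
      simp only [List.sum_cons, List.length_cons] at h
      exact Or.inr (Or.inl ⟨l, ih (by omega), rfl⟩)
    | (a + 1) :: l =>
      simp only [List.sum_cons, List.length_cons] at h
      exact Or.inr (Or.inr ⟨a :: l, ih (by simp only [List.sum_cons, List.length_cons]; omega),
        rfl⟩)

/-- The cardinalities satisfy N ↦ at most 2N + 1; the summand 1 makes this a doubling. -/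
theorem card_natLists (M : ℕ) : (natLists M).card + 1 ≤ 2 ^ (M + 1) := by
  induction M with
  | zero => simp [natLists]
  | succ M ih =>
    have h1 := Finset.card_insert_le [] ((natLists M).image (fun l => 0 :: l) ∪
      (natLists M).image fun l => (l.headD 0 + 1) :: l.tail)
    have h2 := Finset.card_union_le ((natLists M).image (fun l => 0 :: l))
      ((natLists M).image fun l => (l.headD 0 + 1) :: l.tail)
    have h3 := Finset.card_image_le (s := natLists M) (f := fun l => 0 :: l)
    have h4 := Finset.card_image_le (s := natLists M)
      (f := fun l => (l.headD 0 + 1) :: l.tail)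
    rw [pow_succ]
    simp only [natLists]
    omega

theorem card_natLists_le (M : ℕ) : (natLists M).card ≤ 2 ^ (M + 1) :=
  (Nat.le_succ _).trans (card_natLists M)

open Classical in
/-- The lists whose entries are chosen from the given finite sets. -/
noncomputable def choices {β : Type*} : List (Finset β) → Finset (List β)
  | [] => {[]}
  | s :: ss => (s ×ˢ choices ss).image fun p => p.1 :: p.2

theorem mem_choices {β : Type*} {ss : List (Finset β)} {l : List β} :
    l ∈ choices ss ↔ List.Forall₂ (fun a s => a ∈ s) l ss := by
  induction ss generalizing l with
  | nil => simp [choices]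
  | cons s ss ih =>
    simp only [choices, Finset.mem_image, Finset.mem_product, Prod.exists, ih]
    constructor
    · rintro ⟨a, l, ⟨h1, h2⟩, rfl⟩
      exact .cons h1 h2
    · rintro (_ | ⟨h1, h2⟩)
      exact ⟨_, _, ⟨h1, h2⟩, rfl⟩

open Classical in
theorem card_choices {β : Type*} (ss : List (Finset β)) :
    (choices ss).card = (ss.map Finset.card).prod := by
  induction ss with
  | nil => simp [choices]
  | cons s ss ih =>
    rw [choices, Finset.card_image_of_injective, Finset.card_product, ih, List.map_cons,
      List.prod_cons]
    rintro ⟨a, l⟩ ⟨b, m⟩ h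
    simpa using h

theorem card_filter_range_getD {β : Type*} (l : List β) (d : β) (p : β → Prop)
    [DecidablePred p] :
    ((Finset.range l.length).filter fun i => p (l.getD i d)).card = l.countP fun b => p b := by
  rw [← card_filter_get, Finset.card_filter, Finset.card_filter,
    ← Fin.sum_univ_eq_sum_range fun i => if p (l.getD i d) then 1 else 0]
  refine Finset.sum_congr rfl fun i _ => ?_
  simp

theorem exists_mem_zip_left {α β : Type*} {l : List α} {l' : List β}
    (h : l.length = l'.length) {a : α}
    (ha : a ∈ l) : ∃ b ∈ l', (a, b) ∈ l.zip l' := by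
  obtain ⟨i, hi, rfl⟩ := List.getElem_of_mem ha
  exact ⟨l'[i], List.getElem_mem _, List.mem_iff_getElem.2 ⟨i, by simp; omega, by simp⟩⟩

theorem exists_mem_zip_right {α β : Type*} {l : List α} {l' : List β}
    (h : l.length = l'.length) {b : β}
    (hb : b ∈ l') : ∃ a ∈ l, (a, b) ∈ l.zip l' := by
  obtain ⟨i, hi, rfl⟩ := List.getElem_of_mem hb
  exact ⟨l[i], List.getElem_mem _, List.mem_iff_getElem.2 ⟨i, by simp; omega, by simp⟩⟩

/-! ### Lists whose entries are ordered in the same way -/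

/-- The two lists have the same length and their entries are ordered in the same way. -/
def OrderSimilar {α β : Type*} [LE α] [LE β] (l : List α) (l' : List β) : Prop :=
  l.length = l'.length ∧ ∀ p ∈ l.zip l', ∀ q ∈ l.zip l', p.1 ≤ q.1 ↔ p.2 ≤ q.2

section

variable {α β : Type*} [LinearOrder α] [LinearOrder β]

/-- Equality across the cut can only hold between a greatest entry of `y` and a least entry of `z`.
So the order of the concatenation is determined by the orders of the two parts and one bit. -/
theorem le_iff_of_forall_le {y z : List α} (h : ∀ a ∈ y, ∀ b ∈ z, a ≤ b) :
    ∀ a ∈ y, ∀ b ∈ z, b ≤ a ↔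
      (∀ c ∈ y, c ≤ a) ∧ (∀ c ∈ z, b ≤ c) ∧ ∃ a ∈ y, ∃ b ∈ z, b ≤ a := by
  intro a ha b hb
  constructor
  · exact fun hba => ⟨fun c hc => (h c hc b hb).trans hba,
      fun c hc => hba.trans (h a ha c hc), a, ha, b, hb, hba⟩
  · rintro ⟨h1, h2, a', ha', b', hb', h3⟩
    exact (h2 b' hb').trans (h3.trans (h1 a' ha'))

theorem OrderSimilar.append {y z : List α} {y' z' : List β} (hy : OrderSimilar y y')
    (hz : OrderSimilar z z') (h : ∀ a ∈ y, ∀ b ∈ z, a ≤ b) (h' : ∀ a ∈ y', ∀ b ∈ z', a ≤ b)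
    (hb : (∃ a ∈ y, ∃ b ∈ z, b ≤ a) ↔ ∃ a ∈ y', ∃ b ∈ z', b ≤ a) :
    OrderSimilar (y ++ z) (y' ++ z') := by
  refine ⟨by simp [hy.1, hz.1], ?_⟩
  rw [List.zip_append hy.1]
  intro p hp q hq
  rcases List.mem_append.1 hp with hp | hp <;> rcases List.mem_append.1 hq with hq | hq
  · exact hy.2 p hp q hq
  · have e1 := h _ (List.of_mem_zip hp).1 _ (List.of_mem_zip hq).1
    have e2 := h' _ (List.of_mem_zip hp).2 _ (List.of_mem_zip hq).2
    exact iff_of_true e1 e2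
  · rw [le_iff_of_forall_le h _ (List.of_mem_zip hq).1 _ (List.of_mem_zip hp).1,
      le_iff_of_forall_le h' _ (List.of_mem_zip hq).2 _ (List.of_mem_zip hp).2, hb]
    refine and_congr ⟨fun H c hc => ?_, fun H c hc => ?_⟩
      (and_congr ⟨fun H c hc => ?_, fun H c hc => ?_⟩ Iff.rfl)
    · obtain ⟨d, hd, hdc⟩ := exists_mem_zip_right hy.1 hc
      exact (hy.2 _ hdc _ hq).1 (H d hd)
    · obtain ⟨d, hd, hdc⟩ := exists_mem_zip_left hy.1 hc
      exact (hy.2 _ hdc _ hq).2 (H d hd)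
    · obtain ⟨d, hd, hdc⟩ := exists_mem_zip_right hz.1 hc
      exact (hz.2 _ hp _ hdc).1 (H d hd)
    · obtain ⟨d, hd, hdc⟩ := exists_mem_zip_left hz.1 hc
      exact (hz.2 _ hp _ hdc).2 (H d hd)
  · exact hz.2 p hp q hq

theorem OrderSimilar.of_append {y z : List α} {y' z' : List β} (hlen : y.length = y'.length)
    (h : OrderSimilar (y ++ z) (y' ++ z')) : OrderSimilar y y' ∧ OrderSimilar z z' := by
  obtain ⟨h1, h2⟩ := h
  rw [List.zip_append hlen] at h2
  exact ⟨⟨hlen, fun p hp q hq => h2 p (List.mem_append_left _ hp) q (List.mem_append_left _ hq)⟩,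
    by simpa [hlen] using h1,
    fun p hp q hq => h2 p (List.mem_append_right _ hp) q (List.mem_append_right _ hq)⟩

theorem OrderSimilar.of_map {α' β' : Type*} [LinearOrder α'] [LinearOrder β'] {f : α → α'}
    {g : β → β'} (hf : StrictMono f) (hg : StrictMono g) {l : List α} {l' : List β}
    (h : OrderSimilar (l.map f) (l'.map g)) : OrderSimilar l l' := by
  refine ⟨by simpa using h.1, fun p hp q hq => ?_⟩
  have key : ∀ p ∈ l.zip l', (f p.1, g p.2) ∈ (l.map f).zip (l'.map g) := fun p hp => by
    rw [List.zip_map]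
    exact List.mem_map.2 ⟨p, hp, rfl⟩
  have := h.2 _ (key p hp) _ (key q hq)
  rwa [hf.le_iff_le, hg.le_iff_le] at this

theorem OrderSimilar.refl (l : List α) : OrderSimilar l l := by
  refine ⟨rfl, fun p hp q hq => ?_⟩
  obtain ⟨i, hi, rfl⟩ := List.mem_iff_getElem.1 hp
  obtain ⟨j, hj, rfl⟩ := List.mem_iff_getElem.1 hq
  simp

theorem orderSimilar_ofFn {n : ℕ} {x : Fin n → α} {x' : Fin n → β} :
    OrderSimilar (List.ofFn x) (List.ofFn x') ↔ ∀ i j, x i ≤ x j ↔ x' i ≤ x' j := by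
  have hzip : ∀ p, p ∈ (List.ofFn x).zip (List.ofFn x') ↔ ∃ i, p = (x i, x' i) := by
    intro p
    rw [List.mem_iff_getElem]
    constructor
    · rintro ⟨i, hi, rfl⟩
      simp only [List.length_zip, List.length_ofFn, min_self] at hi
      exact ⟨⟨i, hi⟩, by simp⟩
    · rintro ⟨i, rfl⟩
      exact ⟨i, by simp, by simp⟩
  constructor
  · exact fun h i j => h.2 _ ((hzip _).2 ⟨i, rfl⟩) _ ((hzip _).2 ⟨j, rfl⟩)
  · refine fun h => ⟨by simp, fun p hp q hq => ?_⟩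
    obtain ⟨i, rfl⟩ := (hzip p).1 hp
    obtain ⟨j, rfl⟩ := (hzip q).1 hq
    exact h i j

/-- Similar lists over initial segments of the natural numbers are equal. -/
theorem OrderSimilar.eq_of_toFinset {l l' : List ℕ} {d d' : ℕ} (h : OrderSimilar l l')
    (hl : l.toFinset = Finset.range d) (hl' : l'.toFinset = Finset.range d') : l = l' := by
  have hm : ∀ a, a ∈ l ↔ a < d := fun a => by rw [← List.mem_toFinset, hl, Finset.mem_range]
  have hm' : ∀ a, a ∈ l' ↔ a < d' := fun a => by
    rw [← List.mem_toFinset, hl', Finset.mem_range]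
  -- If the components of a pair differ, the smaller one also occurs as a value of the other list,
  -- because the values form initial segments. At that occurrence the partner is smaller still,
  -- which contradicts the induction hypothesis.
  have key : ∀ v, ∀ p ∈ l.zip l', p.1 = v ∨ p.2 = v → p.1 = p.2 := by
    intro v
    induction v using Nat.strong_induction_on with
    | _ v ih =>
    intro p hp hv
    by_contra hne
    rcases lt_or_gt_of_ne hne with hlt | hlt
    · have h1 : p.1 < d' := hlt.trans ((hm' _).1 (List.of_mem_zip hp).2)
      obtain ⟨a, ha, hap⟩ := exists_mem_zip_right h.1 ((hm' _).2 h1)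
      rcases hv with hv | hv
      · have h2 := (h.2 _ hp _ hap).not.2 (by simpa using hlt)
        have h3 := ih a (by simp only at h2; omega) _ hap (Or.inl rfl)
        simp only at h2 h3
        omega
      · have h3 := ih p.1 (by omega) _ hap (Or.inr rfl)
        have h2 := (h.2 _ hp _ hap).not.2 (by simpa using hlt)
        simp only at h2 h3
        omega
    · have h1 : p.2 < d := hlt.trans ((hm _).1 (List.of_mem_zip hp).1)
      obtain ⟨a, ha, hap⟩ := exists_mem_zip_left h.1 ((hm _).2 h1)
      rcases hv with hv | hv
      · have h3 := ih p.2 (by omega) _ hap (Or.inl rfl)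
        have h2 := (h.2 _ hp _ hap).not.1 (by simpa using hlt)
        simp only at h2 h3
        omega
      · have h2 := (h.2 _ hp _ hap).not.1 (by simpa using hlt)
        have h3 := ih a (by simp only at h2; omega) _ hap (Or.inr rfl)
        simp only at h2 h3
        omega
  refine List.ext_getElem h.1 fun i h1 h2 => ?_
  exact key _ (l[i], l'[i]) (List.mem_iff_getElem.2 ⟨i, by simp; omega, by simp⟩) (Or.inl rfl)

/-- For each list, whether its greatest entry is repeated in the lists that follow. -/
def boundaryBits : List (List α) → List Bool
  | [] => []
  | y :: ys => decide (∃ a ∈ y, ∃ b ∈ ys.flatten, b ≤ a) :: boundaryBits ys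

theorem length_boundaryBits (ys : List (List α)) : (boundaryBits ys).length = ys.length := by
  induction ys with
  | nil => rfl
  | cons y ys ih => simp [boundaryBits, ih]

theorem orderSimilar_flatten {ys : List (List α)} {ys' : List (List β)}
    (hys : ys.Pairwise fun y z => ∀ a ∈ y, ∀ b ∈ z, a ≤ b)
    (hys' : ys'.Pairwise fun y z => ∀ a ∈ y, ∀ b ∈ z, a ≤ b)
    (h : List.Forall₂ OrderSimilar ys ys') (hb : boundaryBits ys = boundaryBits ys') :
    OrderSimilar ys.flatten ys'.flatten := by
  induction h with
  | nil => exact ⟨rfl, by simp⟩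
  | cons h1 h2 ih =>
    simp only [boundaryBits, List.cons.injEq, decide_eq_decide] at hb
    rw [List.pairwise_cons] at hys hys'
    refine h1.append (ih hys.2 hys'.2 hb.2) ?_ ?_ hb.1
    · intro a ha b hb
      obtain ⟨l, hl, hb⟩ := List.mem_flatten.1 hb
      exact hys.1 l hl a ha b hb
    · intro a ha b hb
      obtain ⟨l, hl, hb⟩ := List.mem_flatten.1 hb
      exact hys'.1 l hl a ha b hb

end

/-! ### Encoding a sub-instance that is given by its runs -/

section

variable {α β : Type*} [LinearOrder α] [LinearOrder β]

/-- The indices of the runs that contain a member of `J`. -/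
def meetingRuns (R : List (List α)) (J : List α) : Finset ℕ :=
  (Finset.range R.length).filter fun i => ∃ v ∈ J, v ∈ R.getD i []

theorem card_meetingRuns (R : List (List α)) (J : List α) :
    (meetingRuns R J).card = (memberBlockSizes R J).length := by
  rw [length_memberBlockSizes]
  exact card_filter_range_getD R [] fun r => ∃ v ∈ J, v ∈ r

theorem meetingRuns_singleton {R : List (List α)} {J : List α} (hJ : J ∈ outputPartition R)
    {v : α} (hv : v ∈ J) : meetingRuns R [v] = meetingRuns R J := by
  refine Finset.filter_congr fun i hi => ?_
  rw [Finset.mem_range] at hi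
  have hr : R.getD i [] ∈ R := by
    rw [List.getD_eq_getElem _ _ hi]
    exact List.getElem_mem _
  simp only [List.mem_singleton, exists_eq_left]
  exact ⟨fun h => ⟨v, hv, h⟩,
    fun ⟨u, hu, h⟩ => (mem_iff_of_mem_outputPartition hJ hu hv hr).1 h⟩

/-- All values of a member lie in the same runs, so the sets for the members, repeated according to
the member sizes, give the sets for the single values. -/
theorem map_meetingRuns_singleton (R : List (List α)) :
    (distinctValues R.flatten).map (fun v => meetingRuns R [v]) =
      (List.zipWith List.replicate ((outputPartition R).map List.length)
        ((outputPartition R).map (meetingRuns R))).flatten := by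
  rw [← flatten_outputPartition, List.map_flatten, List.zipWith_map, List.zipWith_self]
  congr 1
  refine List.map_congr_left fun J hJ => ?_
  rw [List.eq_replicate_iff]
  refine ⟨by simp, fun S hS => ?_⟩
  obtain ⟨v, hv, rfl⟩ := List.mem_map.1 hS
  exact meetingRuns_singleton hJ hv

/-- The runs that meet the members of the partition, the sizes of the members, and the numbers of
occurrences of the values in the runs that contain them. -/
def runCode (R : List (List α)) : List (Finset ℕ) × List ℕ × List ℕ :=
  ((outputPartition R).map (meetingRuns R), (outputPartition R).map List.length,
    ((distinctValues R.flatten).map fun v => memberBlockSizes R [v]).flatten)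

/-- The codes for the given parameters. -/
noncomputable def runCodes (p : SubParams) : Finset (List (Finset ℕ) × List ℕ × List ℕ) :=
  choices (p.memberValues.map fun m => (Finset.range p.runs).powersetCard m) ×ˢ
    natLists (2 * p.size) ×ˢ natLists (2 * p.size)

/-- The number of ways to choose the runs that meet the members of the partition. -/
def SubParams.runChoices (p : SubParams) : ℕ :=
  (p.memberValues.map fun m => p.runs.choose m).prod

theorem card_runCodes (p : SubParams) :
    (runCodes p).card ≤ 4 * 16 ^ p.size * p.runChoices := by
  have h := card_natLists_le (2 * p.size)
  have e : (2 : ℕ) ^ (2 * p.size + 1) = 2 * 4 ^ p.size := by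
    rw [pow_succ, pow_mul]
    ring
  rw [e] at h
  rw [runCodes, Finset.card_product, Finset.card_product, card_choices, List.map_map]
  simp only [Function.comp_def, Finset.card_powersetCard, Finset.card_range]
  calc _ ≤ p.runChoices * ((2 * 4 ^ p.size) * (2 * 4 ^ p.size)) :=
        Nat.mul_le_mul_left _ (Nat.mul_le_mul h h)
    _ = _ := by
        rw [show (16 : ℕ) = 4 * 4 by norm_num, mul_pow]
        ring

theorem runCode_mem (R : List (List α)) : runCode R ∈ runCodes (subParams R) := by
  refine Finset.mem_product.2 ⟨mem_choices.2 ?_, Finset.mem_product.2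
    ⟨mem_natLists ?_, mem_natLists ?_⟩⟩
  · simp only [subParams, runCode, List.map_map, Function.comp_def,
      List.forall₂_map_left_iff, List.forall₂_map_right_iff, List.forall₂_same]
    exact fun J _ => Finset.mem_powersetCard.2 ⟨Finset.filter_subset _ _, card_meetingRuns R J⟩
  · have h1 := sum_map_length_outputPartition_le R
    have h2 := length_memberValues_le R
    simp only [subParams, List.length_map] at h2
    simp only [runCode, subParams, List.length_map]
    omega
  · have e : ((distinctValues R.flatten).map fun v => memberBlockSizes R [v]).flatten =
        ((distinctValues R.flatten).map fun v => [v]).flatMap (memberBlockSizes R) := by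
      rw [List.flatMap_map, List.flatMap_def]
    have e' : ((distinctValues R.flatten).map fun v => [v]).flatten =
        distinctValues R.flatten := by
      rw [← List.flatMap_def]
      exact List.flatMap_singleton' _
    have h1 := sum_flatMap_memberBlockSizes (R := R)
      (Js := (distinctValues R.flatten).map fun v => [v])
      (by rw [e']; exact nodup_distinctValues _)
      (fun v hv => by rw [e']; exact mem_distinctValues.2 hv)
    have h2 := length_le_sum fun g (hg : g ∈ ((distinctValues R.flatten).map fun v =>
      [v]).flatMap (memberBlockSizes R)) => pos_of_mem_flatMap_memberBlockSizes hg
    simp only [runCode, subParams, e]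
    omega

/-- A list of natural numbers is determined by its positive entries and their positions. -/
theorem eq_of_filter_pos_eq {l l' : List ℕ} (hlen : l.length = l'.length)
    (hpos : ∀ i, 0 < l.getD i 0 ↔ 0 < l'.getD i 0)
    (hf : (l.filter fun g => decide (0 < g)) = l'.filter fun g => decide (0 < g)) : l = l' := by
  induction l generalizing l' with
  | nil => exact (List.length_eq_zero_iff.1 hlen.symm).symm
  | cons a l ih =>
    match l', hlen with
    | b :: l', hlen =>
      have h0 := hpos 0
      have hs : ∀ i, 0 < l.getD i 0 ↔ 0 < l'.getD i 0 := fun i => hpos (i + 1)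
      have ih := @ih l'
      simp only [List.getD_cons_zero] at h0
      have hlen' : l.length = l'.length := Nat.succ_injective hlen
      rcases Nat.eq_zero_or_pos a with rfl | ha
      · have hb : b = 0 := by simpa using h0
        subst hb
        rw [ih hlen' hs (by simpa using hf)]
      · have hb := h0.1 ha
        rw [List.filter_cons_of_pos (by simpa using ha),
          List.filter_cons_of_pos (by simpa using hb), List.cons.injEq] at hf
        rw [hf.1, ih hlen' hs hf.2]

theorem memberBlockSizes_singleton (R : List (List α)) (v : α) :
    memberBlockSizes R [v] = (R.map fun r => r.count v).filter fun g => decide (0 < g) := by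
  simp [memberBlockSizes, List.count_eq_countP, beq_eq_decide]

theorem count_map_idxOf {l r : List α} (hd : l.Nodup) (hr : ∀ v ∈ r, v ∈ l) (k : ℕ) :
    (r.map fun v => l.idxOf v).count k = (l[k]?.map fun v => r.count v).getD 0 := by
  rw [List.count_eq_countP, List.countP_map]
  by_cases hk : k < l.length
  · simp only [List.getElem?_eq_getElem hk, Option.map_some, Option.getD_some,
      List.count_eq_countP]
    refine List.countP_congr fun v hv => ?_
    simp only [Function.comp, beq_iff_eq]
    constructor
    · rintro rfl
      simp
    · rintro rfl
      exact hd.idxOf_getElem _ _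
  · rw [List.getElem?_eq_none (not_lt.1 hk), Option.map_none, Option.getD_none,
      List.countP_eq_zero]
    intro v hv
    simp only [Function.comp, beq_iff_eq]
    have := List.idxOf_lt_length_of_mem (hr v hv)
    omega

theorem idxOf_le_idxOf_iff {l : List α} (hp : l.Pairwise (· ≤ ·)) {u v : α}
    (hu : u ∈ l) (hv : v ∈ l) : l.idxOf u ≤ l.idxOf v ↔ u ≤ v := by
  have key : ∀ {u v}, u ∈ l → v ∈ l → l.idxOf u < l.idxOf v → u ≤ v := fun {u v} hu hv h => by
    have := List.pairwise_iff_getElem.1 hp _ _ (List.idxOf_lt_length_of_mem hu)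
      (List.idxOf_lt_length_of_mem hv) h
    simpa using this
  constructor
  · intro h
    rcases h.lt_or_eq with h | h
    · exact key hu hv h
    · exact ((List.idxOf_inj hu).1 h).le
  · intro h
    by_contra! h'
    have h1 := le_antisymm h (key hv hu h')
    simp [h1] at h'

/-- The code determines, for the k-th smallest value, the runs that contain it and its multiplicity
in each. This is the multiset of ranks in every run, and a sorted run is determined by its multiset.
-/
theorem orderSimilar_of_runCode_eq {R : List (List α)} {R' : List (List β)}
    (hR : ∀ r ∈ R, r.Pairwise (· ≤ ·)) (hR' : ∀ r ∈ R', r.Pairwise (· ≤ ·))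
    (hlen : R.length = R'.length) (h : runCode R = runCode R') :
    OrderSimilar R.flatten R'.flatten := by
  simp only [runCode, Prod.mk.injEq] at h
  obtain ⟨h1, h2, h3⟩ := h
  set vs := distinctValues R.flatten with hvs
  set vs' := distinctValues R'.flatten with hvs'
  have hm : vs.map (fun v => meetingRuns R [v]) = vs'.map fun v => meetingRuns R' [v] := by
    rw [map_meetingRuns_singleton, map_meetingRuns_singleton, h1, h2]
  have hvlen : vs.length = vs'.length := by simpa using congrArg List.length hm
  have hb : (vs.map fun v => memberBlockSizes R [v]) =
      vs'.map fun v => memberBlockSizes R' [v] := by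
    -- The flat list of multiplicities can be cut back into pieces because their lengths are the
    -- cardinalities of the sets of runs.
    refine List.eq_iff_flatten_eq.2 ⟨h3, ?_⟩
    have := congrArg (List.map Finset.card) hm
    simpa [Function.comp_def, card_meetingRuns] using this
  have hcount : ∀ k (hk : k < vs.length) (hk' : k < vs'.length),
      R.map (fun r => r.count vs[k]) = R'.map fun r => r.count vs'[k] := by
    intro k hk hk'
    have e1 : meetingRuns R [vs[k]] = meetingRuns R' [vs'[k]] := by
      have := List.getElem_of_eq hm (by simpa using hk)
      simpa using this
    have e2 : memberBlockSizes R [vs[k]] = memberBlockSizes R' [vs'[k]] := by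
      have := List.getElem_of_eq hb (by simpa using hk)
      simpa using this
    refine eq_of_filter_pos_eq (by simpa using hlen) (fun i => ?_) (by 
      rw [← memberBlockSizes_singleton, ← memberBlockSizes_singleton, e2])
    have := Finset.ext_iff.1 e1 i
    by_cases hi : i < R.length
    · have hi' : i < R'.length := hlen ▸ hi
      simpa [meetingRuns, hi, hi'] using this
    · have hi' : ¬ i < R'.length := hlen ▸ hi
      simp [List.getElem?_eq_none (not_lt.1 hi), List.getElem?_eq_none (not_lt.1 hi')]
  have hmem : ∀ r ∈ R, ∀ v ∈ r, v ∈ vs := fun r hr v hv =>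
    mem_distinctValues.2 (List.mem_flatten.2 ⟨r, hr, hv⟩)
  have hmem' : ∀ r ∈ R', ∀ v ∈ r, v ∈ vs' := fun r hr v hv =>
    mem_distinctValues.2 (List.mem_flatten.2 ⟨r, hr, hv⟩)
  have hidx : R.map (List.map fun v => vs.idxOf v) = R'.map (List.map fun v => vs'.idxOf v) := by
    refine List.ext_getElem (by simpa using hlen) fun i hi hi' => ?_
    simp only [List.length_map] at hi hi'
    simp only [List.getElem_map]
    have hri := List.getElem_mem hi
    have hri' := List.getElem_mem hi'
    refine (List.perm_iff_count.2 fun k => ?_).eq_of_pairwise' (r := (· ≤ ·)) ?_ ?_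
    · rw [count_map_idxOf (nodup_distinctValues _) (hmem _ hri),
        count_map_idxOf (nodup_distinctValues _) (hmem' _ hri')]
      by_cases hk : k < vs.length
      · have hk' : k < vs'.length := hvlen ▸ hk
        have := List.getElem_of_eq (hcount k hk hk') (by simpa using hi)
        rw [List.getElem?_eq_getElem hk, List.getElem?_eq_getElem hk']
        simpa using this
      · have hk' : ¬ k < vs'.length := hvlen ▸ hk
        rw [List.getElem?_eq_none (not_lt.1 hk), List.getElem?_eq_none (not_lt.1 hk')]
        rfl
    · refine List.pairwise_map.2 ((hR _ hri).imp_of_mem fun ha hb hab => ?_)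
      exact (idxOf_le_idxOf_iff (pairwise_distinctValues _)
        (hmem _ hri _ ha) (hmem _ hri _ hb)).2 hab
    · refine List.pairwise_map.2 ((hR' _ hri').imp_of_mem fun ha hb hab => ?_)
      exact (idxOf_le_idxOf_iff (pairwise_distinctValues _)
        (hmem' _ hri' _ ha) (hmem' _ hri' _ hb)).2 hab
  have hflat := congrArg List.flatten hidx
  rw [← List.map_flatten, ← List.map_flatten] at hflat
  have hl := congrArg List.length hflat
  rw [List.length_map, List.length_map] at hl
  refine ⟨hl, fun p hp q hq => ?_⟩
  have hpq : ∀ p ∈ R.flatten.zip R'.flatten, vs.idxOf p.1 = vs'.idxOf p.2 := by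
    intro p hp
    obtain ⟨i, hi, rfl⟩ := List.mem_iff_getElem.1 hp
    simp only [List.length_zip, lt_min_iff] at hi
    have := List.getElem_of_eq hflat (i := i) (by rw [List.length_map]; exact hi.1)
    rw [List.getElem_map, List.getElem_map] at this
    simpa only [List.getElem_zip] using this
  have hv : ∀ p ∈ R.flatten.zip R'.flatten, p.1 ∈ vs ∧ p.2 ∈ vs' := fun p hp =>
    ⟨mem_distinctValues.2 (List.of_mem_zip hp).1, mem_distinctValues.2 (List.of_mem_zip hp).2⟩
  rw [← idxOf_le_idxOf_iff (pairwise_distinctValues _) (hv p hp).1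
    (hv q hq).1, ← idxOf_le_idxOf_iff (pairwise_distinctValues _)
    (hv p hp).2 (hv q hq).2]
  exact (hpq p hp) ▸ (hpq q hq) ▸ Iff.rfl

end

/-! ### Bounds on the parameters -/

/-- Bounds that hold for the parameters of sub-instances. -/
structure SubParams.IsBounded (p : SubParams) : Prop where
  runs_le : p.runs ≤ p.size
  sum_blockSizes : p.blockSizes.sum = p.size
  length_blockSizes : p.blockSizes.length ≤ p.size
  sum_memberValues : p.memberValues.sum ≤ p.size
  length_memberValues : p.memberValues.length ≤ p.size
  memberValues_le : ∀ m ∈ p.memberValues, m ≤ p.runs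

section

variable {α : Type*} [LinearOrder α]

theorem IsRunDecomposition.isBounded {y : List α} {R : List (List α)}
    (h : IsRunDecomposition y R) : (subParams R).IsBounded where
  runs_le := runs_le_size h
  sum_blockSizes := _root_.sum_blockSizes R
  length_blockSizes := length_blockSizes_le R
  sum_memberValues := sum_memberValues_le R
  length_memberValues := length_memberValues_le R
  memberValues_le := fun _ => _root_.memberValues_le

theorem map_flatten_eq_of_isRunDecomposition {L : List (List α)} {D : List (List (List α))}
    (h : List.Forall₂ IsRunDecomposition L D) : D.map List.flatten = L := by
  induction h with
  | nil => rfl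
  | cons h1 _ ih => rw [List.map_cons, ih, h1.1]

theorem isBounded_of_mem {L : List (List α)} {D : List (List (List α))}
    (h : List.Forall₂ IsRunDecomposition L D) {p : SubParams} (hp : p ∈ D.map subParams) :
    p.IsBounded := by
  induction h with
  | nil => simp at hp
  | cons h1 _ ih =>
    rcases List.mem_cons.1 hp with rfl | hp
    · exact h1.isBounded
    · exact ih hp

theorem exists_subInstances_eq {n : ℕ} (hn : n ≠ 0) (x : Fin n → α) :
    ∃ ys, IsPivotCutting ys ∧ List.ofFn x = ys.flatten ∧ subInstances x = [] :: ys := by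
  obtain ⟨ys, h1, h2⟩ := exists_isPivotCutting (List.ofFn x)
  exact ⟨ys, h1, h2.symm, subInstances_eq hn x h1 h2.symm⟩

theorem HasParams.bounds {n : ℕ} (hn : n ≠ 0) {x : Fin n → α} {P : List SubParams}
    (h : HasParams x P) :
    (∀ p ∈ P, p.IsBounded) ∧ (P.map SubParams.size).sum = n ∧ P.length ≤ n + 1 := by
  obtain ⟨D, hD, rfl⟩ := h
  refine ⟨fun p => isBounded_of_mem hD, ?_⟩
  obtain ⟨ys, h1, h2, h3⟩ := exists_subInstances_eq hn x
  have h4 := map_flatten_eq_of_isRunDecomposition hD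
  have h5 : (D.map fun R => R.flatten.length) = (subInstances x).map List.length := by
    rw [← h4, List.map_map]
    rfl
  have h6 : ys.flatten.length = n := by rw [← h2, List.length_ofFn]
  refine ⟨?_, ?_⟩
  · rw [List.map_map]
    change (D.map fun R => R.flatten.length).sum = n
    rw [h5, h3, List.map_cons, List.sum_cons, ← List.length_flatten, h6]
    simp
  · have h7 := congrArg List.length h4
    rw [List.length_map, h3, List.length_cons] at h7
    rw [List.length_map, h7, Nat.add_le_add_iff_right, ← h6, List.length_flatten,
      ← List.length_map (f := List.length)]
    refine length_le_sum fun a ha => ?_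
    obtain ⟨y, hy, rfl⟩ := List.mem_map.1 ha
    exact List.length_pos_iff.2 (h1.1 y hy).1

theorem hasParams_exists {n : ℕ} (x : Fin n → α) : ∃ P, HasParams x P := by
  refine ⟨_, (subInstances x).map fun y => y.splitBy fun a b => decide (a ≤ b), ?_, rfl⟩
  rw [List.forall₂_map_right_iff, List.forall₂_same]
  exact fun y _ => isRunDecomposition_maximalRuns y

end

/-- The number of ways to choose the runs that meet the members of the partitions. -/
def totalChoices (P : List SubParams) : ℕ := (P.map SubParams.runChoices).prod

theorem SubParams.IsBounded.runChoices_pos {p : SubParams} (h : p.IsBounded) :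
    0 < p.runChoices := by
  refine List.prod_pos fun a ha => ?_
  obtain ⟨m, hm, rfl⟩ := List.mem_map.1 ha
  exact Nat.choose_pos (h.memberValues_le m hm)

theorem totalChoices_pos {P : List SubParams} (h : ∀ p ∈ P, p.IsBounded) :
    0 < totalChoices P := by
  refine List.prod_pos fun a ha => ?_
  obtain ⟨p, hp, rfl⟩ := List.mem_map.1 ha
  exact (h p hp).runChoices_pos

theorem logb_prod_map {β : Type*} (l : List β) (f : β → ℕ) (h : ∀ b ∈ l, 0 < f b) :
    Real.logb 2 ((l.map f).prod : ℕ) = (l.map fun b => Real.logb 2 (f b : ℝ)).sum := by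
  induction l with
  | nil => simp
  | cons b l ih =>
    have h1 : (f b : ℝ) ≠ 0 := by
      have := h b (by simp)
      positivity
    have h2 : (((l.map f).prod : ℕ) : ℝ) ≠ 0 := by
      have : 0 < (l.map f).prod := List.prod_pos fun a ha => by
        obtain ⟨c, hc, rfl⟩ := List.mem_map.1 ha
        exact h c (by simp [hc])
      exact_mod_cast this.ne'
    rw [List.map_cons, List.prod_cons, List.map_cons, List.sum_cons, ← ih fun c hc =>
      h c (by simp [hc])]
    rw [Nat.cast_mul, Real.logb_mul h1 h2]

/-- The left side is the form that the block sizes take inside `comparisonBound`: the whole list is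
cast to the reals by a monadic bind before the logarithm is mapped over it. -/
theorem sum_map_natCast (l : List ℕ) (f : ℝ → ℝ) :
    (List.map f (do let a ← l; pure (a : ℝ))).sum = (l.map fun a : ℕ => f a).sum := by
  induction l with
  | nil => rfl
  | cons a l ih => simpa using ih

theorem comparisonBound_eq (n : ℕ) {P : List SubParams} (h : ∀ p ∈ P, p.IsBounded) :
    comparisonBound n P =
      n + (P.map fun p => (p.blockSizes.map fun g : ℕ => Real.logb 2 (g : ℝ)).sum).sum +
        Real.logb 2 (totalChoices P) := by
  rw [totalChoices, logb_prod_map _ _ fun p hp => (h p hp).runChoices_pos, comparisonBound,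
    List.sum_map_add, add_assoc]
  congr 3
  · refine List.map_congr_left fun p hp => ?_
    rw [sum_map_natCast]
  refine List.map_congr_left fun p hp => ?_
  rw [SubParams.runChoices, logb_prod_map]
  exact fun m hm => Nat.choose_pos ((h p hp).memberValues_le m hm)

theorem le_comparisonBound (n : ℕ) {P : List SubParams} (h : ∀ p ∈ P, p.IsBounded) :
    n + Real.logb 2 (totalChoices P) ≤ comparisonBound n P := by
  rw [comparisonBound_eq n h]
  have : 0 ≤ (P.map fun p => (p.blockSizes.map fun g : ℕ => Real.logb 2 (g : ℝ)).sum).sum := by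
    refine List.sum_nonneg fun a ha => ?_
    obtain ⟨p, -, rfl⟩ := List.mem_map.1 ha
    refine List.sum_nonneg fun a ha => ?_
    obtain ⟨g, -, rfl⟩ := List.mem_map.1 ha
    exact div_nonneg (Real.log_natCast_nonneg g) (Real.log_nonneg one_le_two)
  linarith

theorem comparisonBound_le {n : ℕ} {P : List SubParams} (h : ∀ p ∈ P, p.IsBounded)
    (hn : (P.map SubParams.size).sum = n) :
    comparisonBound n P ≤ 2 * n + Real.logb 2 (totalChoices P) := by
  rw [comparisonBound_eq n h]
  have h1 : (P.map fun p => (p.blockSizes.map fun g : ℕ => Real.logb 2 (g : ℝ)).sum).sum ≤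
      (P.map fun p => (p.size : ℝ)).sum := by
    refine List.sum_le_sum fun p hp => ?_
    have h2 : (p.blockSizes.map fun g : ℕ => Real.logb 2 (g : ℝ)).sum ≤
        (p.blockSizes.map fun g : ℕ => (g : ℝ)).sum := by
      refine List.sum_le_sum fun g _ => ?_
      rcases Nat.eq_zero_or_pos g with rfl | hg
      · simp
      · rw [Real.logb_le_iff_le_rpow one_lt_two (by exact_mod_cast hg), Real.rpow_natCast]
        exact_mod_cast Nat.lt_two_pow_self.le
    rw [← (h p hp).sum_blockSizes]
    push_cast
    exact h2
  have h3 : (P.map fun p => (p.size : ℝ)).sum = n := by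
    rw [← hn]
    push_cast
    simp [Function.comp_def]
  linarith

/-! ### Counting the orders with given parameters -/

/-- Every entry is replaced by the number of smaller entries. -/
def rankArray {α : Type*} [LinearOrder α] {n : ℕ} (x : Fin n → α) (i : Fin n) : Fin (n + 1) :=
  ⟨(Finset.univ.filter fun j => x j < x i).card,
    Nat.lt_succ_of_le ((Finset.card_le_univ _).trans (Fintype.card_fin n).le)⟩

theorem rankArray_le_iff {α : Type*} [LinearOrder α] {n : ℕ} (x : Fin n → α) (i j : Fin n) :
    x i ≤ x j ↔ rankArray x i ≤ rankArray x j := by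
  rw [rankArray, rankArray, Fin.mk_le_mk]
  constructor
  · intro h
    refine Finset.card_le_card fun k => ?_
    simp only [Finset.mem_filter, Finset.mem_univ, true_and]
    exact fun hk => hk.trans_le h
  · intro h
    by_contra! hji
    refine h.not_gt (Finset.card_lt_card (Finset.ssubset_iff_of_subset (fun k => ?_) |>.2
      ⟨j, by simpa using hji, by simp⟩))
    simp only [Finset.mem_filter, Finset.mem_univ, true_and]
    exact fun hk => hk.trans hji

theorem rankArray_eq {α β : Type*} [LinearOrder α] [LinearOrder β] {n : ℕ} {x : Fin n → α}
    {x' : Fin n → β} (h : ∀ i j, x i ≤ x j ↔ x' i ≤ x' j) : rankArray x = rankArray x' := by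
  funext i
  have : ∀ j, x j < x i ↔ x' j < x' i := fun j => by rw [← not_le, ← not_le, h]
  simp only [rankArray, this]

universe u

/-- `w` is the array of ranks of an array with the given parameters. -/
def RankHasParams {n : ℕ} (w : Fin n → Fin (n + 1)) (P : List SubParams) : Prop :=
  ∃ (α : Type u) (_ : LinearOrder α) (x : Fin n → α), rankArray x = w ∧ HasParams x P

-- The codes consist of a run code and a boundary bit for each of the at most n + 1 sub-instances,
-- and a code determines the ranks. The count is 4^(n+1) · 16^n · Q · 2^(n+1) = 8 · 128^n · Q.
open Classical in
theorem card_rankHasParams_le {n : ℕ} (hn : n ≠ 0) (P : List SubParams) :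
    (Finset.univ.filter fun w : Fin n → Fin (n + 1) => RankHasParams.{u} w P).card ≤
      8 * 128 ^ n * totalChoices P := by
  rcases (Finset.univ.filter fun w : Fin n → Fin (n + 1) =>
    RankHasParams.{u} w P).eq_empty_or_nonempty with he | ⟨w, hw⟩
  · simp [he]
  obtain ⟨-, α, _, x, -, hx⟩ := Finset.mem_filter.1 hw
  obtain ⟨-, hsum, hlen⟩ := hx.bounds hn
  clear hw hx
  have hcard : (choices (P.map runCodes) ×ˢ
      choices (List.replicate P.length (Finset.univ : Finset Bool))).card ≤
      8 * 128 ^ n * totalChoices P := by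
    rw [Finset.card_product, card_choices, card_choices, List.map_map]
    have h1 : (P.map (Finset.card ∘ runCodes)).prod ≤
        (P.map fun p => 4 * 16 ^ p.size * p.runChoices).prod :=
      List.prod_le_prod' fun p _ => card_runCodes p
    have h2 : ∀ P : List SubParams, (P.map fun p => 4 * 16 ^ p.size * p.runChoices).prod =
        4 ^ P.length * 16 ^ (P.map SubParams.size).sum * totalChoices P := by
      intro P
      induction P with
      | nil => simp [totalChoices]
      | cons p P ih =>
        simp only [totalChoices, List.map_cons, List.prod_cons, List.length_cons,
          List.sum_cons] at ih ⊢
        rw [ih, pow_succ, pow_add]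
        ring
    rw [h2, hsum] at h1
    have h3 : 4 ^ P.length ≤ 4 ^ (n + 1) := Nat.pow_le_pow_right (by norm_num) hlen
    have h4 : 2 ^ P.length ≤ 2 ^ (n + 1) := Nat.pow_le_pow_right (by norm_num) hlen
    simp only [List.map_replicate, List.prod_replicate, Finset.card_univ, Fintype.card_bool]
    calc _ ≤ (4 ^ (n + 1) * 16 ^ n * totalChoices P) * 2 ^ (n + 1) :=
          Nat.mul_le_mul (h1.trans (Nat.mul_le_mul_right _ (Nat.mul_le_mul_right _ h3))) h4
      _ = _ := by
        rw [show (128 : ℕ) = 4 * 16 * 2 by norm_num, mul_pow, mul_pow]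
        ring
  refine le_trans (Finset.card_le_card_of_forall_subsingleton
    (fun w c => ∃ (α : Type u) (_ : LinearOrder α) (x : Fin n → α) (D : List (List (List α))),
      rankArray x = w ∧ List.Forall₂ IsRunDecomposition (subInstances x) D ∧
      D.map subParams = P ∧ (D.map runCode, boundaryBits (subInstances x)) = c) ?_ ?_) hcard
  · intro w hw
    obtain ⟨-, α, _, x, hxw, D, hD, hDP⟩ := Finset.mem_filter.1 hw
    refine ⟨_, ?_, α, _, x, D, hxw, hD, hDP, rfl⟩
    refine Finset.mem_product.2 ⟨mem_choices.2 ?_, mem_choices.2 ?_⟩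
    · simp only [← hDP, List.map_map, List.forall₂_map_left_iff, List.forall₂_map_right_iff,
        List.forall₂_same]
      exact fun R _ => runCode_mem R
    · have : P.length = (boundaryBits (subInstances x)).length := by
        rw [length_boundaryBits, ← hDP, List.length_map, ← hD.length_eq]
      rw [this]
      simp only
      generalize boundaryBits (subInstances x) = l
      induction l with
      | nil => exact .nil
      | cons a l ih => exact .cons (Finset.mem_univ a) ih
  · rintro ⟨c, b⟩ -
    rintro w ⟨-, α, _, x, D, rfl, hD, hDP, hc⟩ w' ⟨-, α', _, x', D', rfl, hD', hDP', hc'⟩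
    rw [Prod.mk.injEq] at hc hc'
    refine rankArray_eq (orderSimilar_ofFn.1 ?_)
    obtain ⟨ys, hys, h1, h2⟩ := exists_subInstances_eq hn x
    obtain ⟨ys', hys', h1', h2'⟩ := exists_subInstances_eq hn x'
    have key : ∀ {γ : Type u} [LinearOrder γ] {x : Fin n → γ} {ys : List (List γ)},
        IsPivotCutting ys → List.ofFn x = ys.flatten → subInstances x = [] :: ys →
        (subInstances x).Pairwise (fun y z => ∀ a ∈ y, ∀ b ∈ z, a ≤ b) ∧
        List.ofFn x = (subInstances x).flatten := by
      intro γ _ x ys h1 h2 h3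
      rw [h3, List.flatten_cons, List.nil_append]
      exact ⟨List.pairwise_cons.2 ⟨by simp, h1.2⟩, h2⟩
    obtain ⟨h3, h4⟩ := key hys h1 h2
    obtain ⟨h3', h4'⟩ := key hys' h1' h2'
    rw [h4, h4']
    refine orderSimilar_flatten h3 h3' ?_ (hc.2.trans hc'.2.symm)
    have e1 := hc.1.trans hc'.1.symm
    have e2 := hDP.trans hDP'.symm
    clear hc hc' hDP hDP' h1 h2 h1' h2' h3 h4 h3' h4' hsum hlen hcard
    generalize subInstances x = L at hD
    generalize subInstances x' = L' at hD'
    induction hD generalizing L' D' with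
    | nil =>
      cases hD' with
      | nil => exact .nil
      | cons _ _ => simp at e1
    | cons r1 _ ih =>
      cases hD' with
      | nil => simp at e1
      | cons r1' r2' =>
        simp only [List.map_cons, List.cons.injEq] at e1 e2
        refine .cons ?_ (by
          apply ih <;> first | exact r2' | exact e1.2 | exact e2.2)
        have := orderSimilar_of_runCode_eq (fun r hr => (r1.2 r hr).2)
          (fun r hr => (r1'.2 r hr).2) (congrArg SubParams.runs e2.1) e1.1
        rwa [r1.1, r1'.1] at this

/-- The parameters, rewritten as lists of natural numbers. -/
def paramsCode (P : List SubParams) :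
    List ℕ × List ℕ × List ℕ × List ℕ × List ℕ × List ℕ :=
  (P.map SubParams.size, P.map SubParams.runs, P.map fun p => p.blockSizes.length,
    P.map fun p => p.memberValues.length, (P.map SubParams.blockSizes).flatten,
    (P.map SubParams.memberValues).flatten)

theorem paramsCode_injective : Function.Injective paramsCode := by
  intro P P' h
  simp only [paramsCode, Prod.mk.injEq] at h
  obtain ⟨h1, h2, h3, h4, h5, h6⟩ := h
  have e1 : P.map SubParams.blockSizes = P'.map SubParams.blockSizes :=
    List.eq_iff_flatten_eq.2 ⟨h5, by simpa [Function.comp_def] using h3⟩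
  have e2 : P.map SubParams.memberValues = P'.map SubParams.memberValues :=
    List.eq_iff_flatten_eq.2 ⟨h6, by simpa [Function.comp_def] using h4⟩
  clear h3 h4 h5 h6
  induction P generalizing P' with
  | nil => exact (List.map_eq_nil_iff.1 h1.symm).symm
  | cons p P ih =>
    cases P' with
    | nil => simp at h1
    | cons p' P' =>
      simp only [List.map_cons, List.cons.injEq] at h1 h2 e1 e2
      rw [ih h1.2 h2.2 e1.2 e2.2]
      congr 1
      cases p
      cases p'
      simp_all

theorem paramsCode_mem {n : ℕ} {P : List SubParams} (h : ∀ p ∈ P, p.IsBounded)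
    (hsum : (P.map SubParams.size).sum = n) (hlen : P.length ≤ n + 1) :
    paramsCode P ∈ natLists (2 * n + 1) ×ˢ natLists (2 * n + 1) ×ˢ natLists (2 * n + 1) ×ˢ
      natLists (2 * n + 1) ×ˢ natLists (2 * n + 1) ×ˢ natLists (2 * n + 1) := by
  have key : ∀ f : SubParams → ℕ, (∀ p ∈ P, f p ≤ p.size) → (P.map f).sum ≤ n := fun f hf =>
    hsum ▸ List.sum_le_sum hf
  have k1 := key SubParams.runs fun p hp => (h p hp).runs_le
  have k2 := key (fun p => p.blockSizes.length) fun p hp => (h p hp).length_blockSizes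
  have k3 := key (fun p => p.memberValues.length) fun p hp => (h p hp).length_memberValues
  have k4 := key (fun p => p.blockSizes.sum) fun p hp => (h p hp).sum_blockSizes.le
  have k5 := key (fun p => p.memberValues.sum) fun p hp => (h p hp).sum_memberValues
  simp only [paramsCode, Finset.mem_product]
  refine ⟨mem_natLists ?_, mem_natLists ?_, mem_natLists ?_, mem_natLists ?_, mem_natLists ?_,
    mem_natLists ?_⟩
  · rw [List.length_map]
    omega
  · rw [List.length_map]
    omega
  · rw [List.length_map]
    omega
  · rw [List.length_map]
    omega
  · rw [List.sum_flatten, List.length_flatten, List.map_map, List.map_map]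
    simp only [Function.comp_def]
    omega
  · rw [List.sum_flatten, List.length_flatten, List.map_map, List.map_map]
    simp only [Function.comp_def]
    omega

/-- There are few parameters of arrays of length `n`. -/
theorem exists_params_finset {n : ℕ} (hn : n ≠ 0) :
    ∃ S : Finset (List SubParams), S.card ≤ 2 ^ (12 * n + 12) ∧
      (∀ P ∈ S, ∀ p ∈ P, p.IsBounded) ∧
      ∀ (α : Type u) [LinearOrder α] (x : Fin n → α) (P : List SubParams),
        HasParams x P → P ∈ S := by
  set N := natLists (2 * n + 1)
  set S : Set (List SubParams) := {P | (∀ p ∈ P, p.IsBounded) ∧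
    (P.map SubParams.size).sum = n ∧ P.length ≤ n + 1} with hS
  have hmaps : ∀ P ∈ S, paramsCode P ∈ N ×ˢ N ×ˢ N ×ˢ N ×ˢ N ×ˢ N := fun P hP =>
    paramsCode_mem hP.1 hP.2.1 hP.2.2
  have hfin : S.Finite := Set.Finite.of_finite_image
    ((Finset.finite_toSet (N ×ˢ N ×ˢ N ×ˢ N ×ˢ N ×ˢ N)).subset (by
      rintro _ ⟨P, hP, rfl⟩
      exact hmaps P hP)) paramsCode_injective.injOn
  refine ⟨hfin.toFinset, ?_, fun P hP => (hfin.mem_toFinset.1 hP).1, fun α _ x P hP =>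
    hfin.mem_toFinset.2 (hP.bounds hn)⟩
  refine (Finset.card_le_card_of_injOn paramsCode
    (fun P hP => hmaps P (hfin.mem_toFinset.1 hP)) paramsCode_injective.injOn).trans ?_
  have h := card_natLists_le (2 * n + 1)
  simp only [Finset.card_product]
  -- Six lists, each with sum at most n and length at most n + 1, allow 2^(2n+2) possibilities each.
  calc _ ≤ 2 ^ (2 * n + 1 + 1) * (2 ^ (2 * n + 1 + 1) * (2 ^ (2 * n + 1 + 1) *
        (2 ^ (2 * n + 1 + 1) * (2 ^ (2 * n + 1 + 1) * 2 ^ (2 * n + 1 + 1))))) := by gcongr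
    _ = _ := by
      rw [← pow_add, ← pow_add, ← pow_add, ← pow_add, ← pow_add]
      congr 1
      ring

/-! ### The upper bound -/

-- With total weight at most 2^(34n) and weight at least 1/Q, the cost is at most 2n + 2(34n + log
-- Q) ≤ 70(n + log Q).
open Classical in
theorem exists_tree (n : ℕ) : ∃ T : CompTree n, ∀ (α : Type u) [LinearOrder α],
    T.Sorts α ∧ ∀ (x : Fin n → α) (P : List SubParams), HasParams x P →
      (T.cost x : ℝ) ≤ 70 * comparisonBound n P := by
  rcases Nat.eq_zero_or_pos n with rfl | hn
  · refine ⟨.output 1, fun α _ => ⟨fun x i => i.elim0, fun x P hP => ?_⟩⟩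
    obtain ⟨D, hD, rfl⟩ := hP
    have := le_comparisonBound 0 fun p => isBounded_of_mem hD
    have h1 : 0 ≤ Real.logb 2 (totalChoices (D.map subParams)) :=
      div_nonneg (Real.log_natCast_nonneg _) (Real.log_nonneg one_le_two)
    simp only [CompTree.cost]
    push_cast at this ⊢
    linarith
  have hn' := hn.ne'
  obtain ⟨S, hScard, hSb, hS⟩ := exists_params_finset.{u} hn'
  -- An order type can have several parameters, as runs need not be maximal. Its weight is at least
  -- 1/Q(P) for each of them, so a single tree meets all the bounds at once.
  set W : (Fin n → Fin (n + 1)) → ℝ := fun w =>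
    ∑ P ∈ S.filter fun P => RankHasParams.{u} w P, (1 : ℝ) / totalChoices P with hW
  have hpos : ∀ P ∈ S, (0 : ℝ) < totalChoices P := fun P hP =>
    Nat.cast_pos.2 (totalChoices_pos (hSb P hP))
  have hWle : ∀ w, ∀ P ∈ S, RankHasParams.{u} w P → 1 / (totalChoices P : ℝ) ≤ W w :=
    fun w P hP hw => Finset.single_le_sum (f := fun P => (1 : ℝ) / totalChoices P)
      (fun P _ => by positivity) (Finset.mem_filter.2 ⟨hP, hw⟩)
  have htot : ∑ w, W w ≤ 2 ^ (34 * n) := by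
    have h1 : ∑ w, W w = ∑ P ∈ S, ∑ w ∈ Finset.univ.filter fun w : Fin n → Fin (n + 1) =>
        RankHasParams.{u} w P, (1 : ℝ) / totalChoices P := by
      simp only [hW, Finset.sum_filter]
      exact Finset.sum_comm
    rw [h1]
    calc _ ≤ ∑ P ∈ S, (8 * 128 ^ n : ℝ) := by
          refine Finset.sum_le_sum fun P hP => ?_
          rw [Finset.sum_const, nsmul_eq_mul, mul_one_div, div_le_iff₀ (hpos P hP)]
          exact_mod_cast card_rankHasParams_le.{u} hn' P
      _ = S.card * (8 * 128 ^ n : ℝ) := by rw [Finset.sum_const, nsmul_eq_mul]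
      _ ≤ 2 ^ (12 * n + 12) * (8 * 128 ^ n : ℝ) := by
          gcongr
          exact_mod_cast hScard
      _ = 2 ^ (19 * n + 15) := by
          rw [show (8 : ℝ) = 2 ^ 3 by norm_num, show (128 : ℝ) = 2 ^ 7 by norm_num, ← pow_mul,
            ← pow_add, ← pow_add]
          congr 1
          ring
      -- 19n + 15 ≤ 34n because n ≥ 1.
      _ ≤ _ := pow_le_pow_right₀ one_le_two (by omega)
  obtain ⟨T, hT⟩ := CompTree.solvable_of_weights (W := W) (Finset.univ.filter fun w => 0 < W w)
    fun w hw => (Finset.mem_filter.1 hw).2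
  refine ⟨T, fun α _ => ?_⟩
  have hmem : ∀ (x : Fin n → α) (P : List SubParams), HasParams x P →
      RankHasParams.{u} (rankArray x) P := fun x P hP => ⟨α, _, x, rfl, hP⟩
  have hWpos : ∀ x : Fin n → α, 0 < W (rankArray x) := by
    intro x
    obtain ⟨P, hP⟩ := hasParams_exists x
    have hPS := hS α x P hP
    exact (one_div_pos.2 (hpos P hPS)).trans_le (hWle _ P hPS (hmem x P hP))
  refine ⟨fun x => ?_, fun x P hP => ?_⟩
  · obtain ⟨hr, -⟩ := CompTree.result_cost_congr (rankArray_le_iff x) T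
    rw [hr]
    have := (hT (rankArray x) (by simp [hWpos x])).1
    exact fun a b hab => (rankArray_le_iff x _ _).2 (this hab)
  · obtain ⟨-, hc⟩ := CompTree.result_cost_congr (rankArray_le_iff x) T
    rw [hc]
    have h1 := (hT (rankArray x) (by simp [hWpos x])).2
    have hPS := hS α x P hP
    have hQ := hpos P hPS
    have h2 := le_comparisonBound n (hSb P hPS)
    have hsum : ∑ u ∈ Finset.univ.filter (fun w => 0 < W w), W u ≤ 2 ^ (34 * n) :=
      (Finset.sum_le_univ_sum_of_nonneg fun w =>
        Finset.sum_nonneg fun P _ => by positivity).trans htot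
    have hsum0 : 0 < ∑ u ∈ Finset.univ.filter (fun w => 0 < W w), W u :=
      Finset.sum_pos (fun w hw => (Finset.mem_filter.1 hw).2)
        ⟨rankArray x, by simp [hWpos x]⟩
    have h3 : Real.logb 2 ((∑ u ∈ Finset.univ.filter (fun w => 0 < W w), W u) /
        W (rankArray x)) ≤ 34 * n + Real.logb 2 (totalChoices P) := by
      have e : (34 * n : ℝ) = Real.logb 2 (2 ^ (34 * n)) := by
        rw [Real.logb_pow, Real.logb_self_eq_one one_lt_two]
        push_cast
        ring
      rw [e, ← Real.logb_mul (by positivity) hQ.ne']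
      refine Real.logb_le_logb_of_le one_lt_two (div_pos hsum0 (hWpos x)) ?_
      rw [div_le_iff₀ (hWpos x)]
      have h4 := hWle _ P hPS (hmem x P hP)
      rw [div_le_iff₀ hQ] at h4
      calc _ ≤ (2 : ℝ) ^ (34 * n) * 1 := by rw [mul_one]; exact hsum
        _ ≤ 2 ^ (34 * n) * (W (rankArray x) * totalChoices P) := by gcongr
        _ = _ := by ring
    have h5 : 0 ≤ Real.logb 2 (totalChoices P) :=
      div_nonneg (Real.log_natCast_nonneg _) (Real.log_nonneg one_le_two)
    linarith

/-! ### Counting the ways to distribute values to runs -/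

/-- The two sets are not the same singleton. -/
def Separated (A B : Finset ℕ) : Prop := ¬ (A = B ∧ A.card = 1)

/-- A sequence of sets of runs, of prescribed cardinalities, that covers `U` and may be placed
between `P` and `Q`. -/
structure IsOwnerSeq (ρ : ℕ) (P U Q : Finset ℕ) (ms : List ℕ) (l : List (Finset ℕ)) : Prop where
  map_card : l.map Finset.card = ms
  subset : ∀ S ∈ l, S ⊆ Finset.range ρ
  cover : ∀ u ∈ U, ∃ S ∈ l, u ∈ S
  chain : (P :: (l ++ [Q])).IsChain Separated

theorem IsOwnerSeq.cons {ρ m : ℕ} {P U Q S : Finset ℕ} {ms : List ℕ} {l : List (Finset ℕ)}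
    (h : IsOwnerSeq ρ S (U \ S) Q ms l) (hS : S ⊆ Finset.range ρ) (hm : S.card = m)
    (hP : Separated P S) : IsOwnerSeq ρ P U Q (m :: ms) (S :: l) where
  map_card := by rw [List.map_cons, h.map_card, hm]
  subset := by simpa using ⟨hS, h.subset⟩
  cover u hu := by
    by_cases huS : u ∈ S
    · exact ⟨S, by simp, huS⟩
    · obtain ⟨T, hT, huT⟩ := h.cover u (Finset.mem_sdiff.2 ⟨hu, huS⟩)
      exact ⟨T, by simp [hT], huT⟩
  chain := List.isChain_cons_cons.2 ⟨hP, h.chain⟩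

-- The product step of the count: families with distinct heads are disjoint. The factor `d` carries
-- the loss accumulated in the tails.
open Classical in
theorem exists_finset_cons {β : Type*} (A : Finset β) (V : β → List β → Prop) (c d : ℕ)
    (h : ∀ a ∈ A, ∃ F : Finset (List β), (∀ l ∈ F, V a l) ∧ c ≤ F.card * d) :
    ∃ F : Finset (List β), (∀ l ∈ F, ∃ a ∈ A, ∃ l', l = a :: l' ∧ V a l') ∧
      A.card * c ≤ F.card * d := by
  choose! G hG hGc using h
  refine ⟨A.biUnion fun a => (G a).image (a :: ·), fun l hl => ?_, ?_⟩
  · obtain ⟨a, ha, hl⟩ := Finset.mem_biUnion.1 hl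
    obtain ⟨l', hl', rfl⟩ := Finset.mem_image.1 hl
    exact ⟨a, ha, l', rfl, hG a ha l' hl'⟩
  · rw [Finset.card_biUnion, Finset.sum_mul]
    · refine le_trans (by simp) (Finset.sum_le_sum (f := fun _ => c) fun a ha => ?_)
      rw [Finset.card_image_of_injective _ (List.cons_injective)]
      exact hGc a ha
    · intro a _ b _ hab
      refine Finset.disjoint_left.2 fun l hl hl' => hab ?_
      obtain ⟨_, _, rfl⟩ := Finset.mem_image.1 hl
      obtain ⟨_, _, h⟩ := Finset.mem_image.1 hl'
      exact (List.cons.inj h).1.symm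

/-- Only singletons can violate separation. Excluding both `P` and `Q` as singletons keeps every
chosen set separated from `Q`, whatever follows, and leaves at least ρ - 2 ≥ ρ/3 choices as ρ ≥ 3;
hence a factor 3 per member. -/
theorem exists_ownerSeqs_of_empty {ρ : ℕ} (hρ : 3 ≤ ρ) (Q : Finset ℕ) (ms : List ℕ)
    (P : Finset ℕ) (hPQ : Separated P Q) :
    ∃ F : Finset (List (Finset ℕ)), (∀ l ∈ F, IsOwnerSeq ρ P ∅ Q ms l) ∧
      (ms.map ρ.choose).prod ≤ F.card * 3 ^ ms.length := by
  induction ms generalizing P with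
  | nil =>
    refine ⟨{[]}, fun l hl => ?_, by simp⟩
    rw [Finset.mem_singleton.1 hl]
    exact ⟨rfl, by simp, by simp, by simpa using hPQ⟩
  | cons m ms ih =>
    set A := ((Finset.range ρ).powersetCard m).filter fun S => m = 1 → S ≠ P ∧ S ≠ Q with hA
    have hAc : ρ.choose m ≤ 3 * A.card := by
      by_cases hm : m = 1
      · have h1 : (((Finset.range ρ).powersetCard m).erase P).erase Q ⊆ A := by
          intro S hS
          simp only [Finset.mem_erase] at hS
          simp only [hA, Finset.mem_filter]
          exact ⟨hS.2.2, fun _ => ⟨hS.2.1, hS.1⟩⟩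
        have h2 := Finset.card_le_card h1
        have h3 := Finset.pred_card_le_card_erase (s := (Finset.range ρ).powersetCard m)
          (a := P)
        have h4 := Finset.pred_card_le_card_erase
          (s := ((Finset.range ρ).powersetCard m).erase P) (a := Q)
        rw [Finset.card_powersetCard, Finset.card_range] at h3
        subst hm
        rw [Nat.choose_one_right] at h3 ⊢
        omega
      · have : A = (Finset.range ρ).powersetCard m :=
          Finset.filter_true_of_mem fun S _ h => absurd h hm
        rw [this, Finset.card_powersetCard, Finset.card_range]
        omega
    have hsep : ∀ S ∈ A, Separated P S ∧ Separated S Q := by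
      intro S hS
      simp only [hA, Finset.mem_filter, Finset.mem_powersetCard] at hS
      refine ⟨fun ⟨h1, h2⟩ => ?_, fun ⟨h1, h2⟩ => ?_⟩
      · exact (hS.2 (by rw [← hS.1.2, ← h1, h2])).1 h1.symm
      · exact (hS.2 (by rw [← hS.1.2, h2])).2 h1
    obtain ⟨F, hF, hFc⟩ := exists_finset_cons A (fun S l => IsOwnerSeq ρ S ∅ Q ms l)
      (ms.map ρ.choose).prod (3 ^ ms.length) fun S hS => ih S (hsep S hS).2
    refine ⟨F, fun l hl => ?_, ?_⟩
    · obtain ⟨S, hS, l, rfl, h⟩ := hF l hl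
      have hS' := Finset.mem_powersetCard.1 (Finset.mem_filter.1 hS).1
      exact IsOwnerSeq.cons (by simpa using h) hS'.1 hS'.2 (hsep S hS).1
    · rw [List.map_cons, List.prod_cons, List.length_cons, pow_succ]
      calc _ ≤ 3 * A.card * (ms.map ρ.choose).prod := Nat.mul_le_mul_right _ hAc
        _ = 3 * (A.card * (ms.map ρ.choose).prod) := by ring
        _ ≤ 3 * (F.card * 3 ^ ms.length) := Nat.mul_le_mul_left _ hFc
        _ = _ := by ring

/-- Compares the choices of an m-set among all ρ runs with those among k uncovered ones, in a form
that telescopes as k drops to k - m. -/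
theorem choose_mul_factorial_le {ρ k m : ℕ} (hm : m ≤ k) :
    ρ.choose m * k.factorial ≤ ρ ^ m * (k.choose m * (k - m).factorial) := by
  rw [← Nat.choose_mul_factorial_mul_factorial hm]
  calc ρ.choose m * (k.choose m * m.factorial * (k - m).factorial)
      = (m.factorial * ρ.choose m) * (k.choose m * (k - m).factorial) := by ring
    _ ≤ _ := by
      rw [← Nat.descFactorial_eq_factorial_mul_choose]
      exact Nat.mul_le_mul_right _ (Nat.descFactorial_le_pow ρ m)

/-- `U` is the set of runs still to be covered. While m ≤ |U|, sets are chosen inside `U`; being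
nonempty and disjoint from `P` and `Q`, they are separated from both. The loss telescopes to ρ^|U| /
|U|!. Once `U` is exhausted, the choice is free as in `exists_ownerSeqs_of_empty`. -/
theorem exists_ownerSeqs {ρ : ℕ} (hρ : 3 ≤ ρ) (Q : Finset ℕ) (ms : List ℕ)
    (hms : ∀ m ∈ ms, 0 < m ∧ m ≤ ρ) (P U : Finset ℕ) (hU : U ⊆ Finset.range ρ)
    (hPQ : Separated P Q) (hPU : Disjoint P U) (hQU : Disjoint Q U) (hcard : U.card ≤ ms.sum) :
    ∃ F : Finset (List (Finset ℕ)), (∀ l ∈ F, IsOwnerSeq ρ P U Q ms l) ∧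
      (ms.map ρ.choose).prod * U.card.factorial ≤
        F.card * (ρ ^ U.card * 3 ^ ms.length * 2 ^ ρ) := by
  have hUρ : U.card ≤ ρ := by simpa using Finset.card_le_card hU
  rcases U.eq_empty_or_nonempty with rfl | hne
  · obtain ⟨F, h1, h2⟩ := exists_ownerSeqs_of_empty hρ Q ms P hPQ
    refine ⟨F, h1, ?_⟩
    simp only [Finset.card_empty, Nat.factorial_zero, mul_one, pow_zero, one_mul]
    rw [← mul_assoc]
    exact h2.trans (Nat.le_mul_of_pos_right _ (by positivity))
  induction ms generalizing P U with
  | nil =>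
    have := Finset.card_pos.2 hne
    rw [List.sum_nil] at hcard
    omega
  | cons m ms ih =>
    obtain ⟨hm0, hmρ⟩ := hms m (by simp)
    have hms' : ∀ m ∈ ms, 0 < m ∧ m ≤ ρ := fun m hm => hms m (by simp [hm])
    rw [List.sum_cons] at hcard
    have hpos := Finset.card_pos.2 hne
    rcases le_or_gt m U.card with hmk | hmk
    · have hsep : ∀ S ∈ U.powersetCard m, ∀ T, Disjoint T U → T ≠ S := by
        rintro S hS T hT rfl
        obtain ⟨h1, h2⟩ := Finset.mem_powersetCard.1 hS
        rw [(Finset.disjoint_of_subset_right h1 hT).eq_bot_of_self, Finset.bot_eq_empty,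
          Finset.card_empty] at h2
        omega
      obtain ⟨F, hF, hFc⟩ := exists_finset_cons (U.powersetCard m)
        (fun S l => IsOwnerSeq ρ S (U \ S) Q ms l)
        ((ms.map ρ.choose).prod * (U.card - m).factorial)
        (ρ ^ (U.card - m) * 3 ^ ms.length * 2 ^ ρ) (fun S hS => by
          obtain ⟨h1, h2⟩ := Finset.mem_powersetCard.1 hS
          have e : (U \ S).card = U.card - m := by rw [Finset.card_sdiff_of_subset h1, h2]
          have hSQ : Separated S Q := fun h => hsep S hS Q hQU h.1.symm
          rcases (U \ S).eq_empty_or_nonempty with he | hne'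
          · rw [he, Finset.card_empty] at e
            obtain ⟨F, h1, h2⟩ := exists_ownerSeqs_of_empty hρ Q ms S hSQ
            refine ⟨F, by rwa [he], ?_⟩
            rw [← e]
            simp only [Nat.factorial_zero, mul_one, pow_zero, one_mul]
            rw [← mul_assoc]
            exact h2.trans (Nat.le_mul_of_pos_right _ (by positivity))
          · rw [← e]
            exact ih hms' S (U \ S) (Finset.sdiff_subset.trans hU) hSQ Finset.disjoint_sdiff
              (hQU.mono_right Finset.sdiff_subset) (by omega) (by omega) hne')
      refine ⟨F, fun l hl => ?_, ?_⟩
      · obtain ⟨S, hS, l, rfl, h⟩ := hF l hl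
        obtain ⟨h1, h2⟩ := Finset.mem_powersetCard.1 hS
        exact h.cons (h1.trans hU) h2 fun h => hsep S hS P hPU h.1
      · rw [Finset.card_powersetCard] at hFc
        rw [List.map_cons, List.prod_cons, List.length_cons]
        calc _ = (ρ.choose m * U.card.factorial) * (ms.map ρ.choose).prod := by ring
          _ ≤ (ρ ^ m * (U.card.choose m * (U.card - m).factorial)) * (ms.map ρ.choose).prod :=
            Nat.mul_le_mul_right _ (choose_mul_factorial_le hmk)
          _ = ρ ^ m * (U.card.choose m * ((ms.map ρ.choose).prod * (U.card - m).factorial)) := by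
            ring
          _ ≤ ρ ^ m * (F.card * (ρ ^ (U.card - m) * 3 ^ ms.length * 2 ^ ρ)) :=
            Nat.mul_le_mul_left _ hFc
          _ = F.card * ((ρ ^ m * ρ ^ (U.card - m)) * 3 ^ ms.length * 2 ^ ρ) := by ring
          _ = F.card * (ρ ^ U.card * 3 ^ ms.length * 2 ^ ρ) := by
            rw [← pow_add, Nat.add_sub_cancel' hmk]
          _ ≤ _ := by
            gcongr
            · norm_num
            · omega
    -- A single set swallows the rest of `U`. It has m > |U| ≥ 1 elements, so separation is
    -- automatic. The lost factor, at most 2^ρ, arises only once because nothing remains to be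
    -- covered.
    · obtain ⟨S, hUS, hSρ, hSm⟩ := Finset.exists_subsuperset_card_eq hU hmk.le
        (by simpa using hmρ)
      have hS1 : ∀ T : Finset ℕ, Separated T S ∧ Separated S T := fun T =>
        ⟨fun h => by rw [h.1] at h; omega, fun h => by omega⟩
      obtain ⟨F, hF, hFc⟩ := exists_finset_cons {S}
        (fun S l => IsOwnerSeq ρ S ∅ Q ms l) (ms.map ρ.choose).prod (3 ^ ms.length)
        (fun T hT => by
          rw [Finset.mem_singleton.1 hT]
          exact exists_ownerSeqs_of_empty hρ Q ms S (hS1 Q).2)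
      refine ⟨F, fun l hl => ?_, ?_⟩
      · obtain ⟨T, hT, l, rfl, h⟩ := hF l hl
        obtain rfl := Finset.mem_singleton.1 hT
        exact IsOwnerSeq.cons (by rwa [Finset.sdiff_eq_empty_iff_subset.2 hUS]) hSρ hSm
          (hS1 P).1
      · rw [Finset.card_singleton, one_mul] at hFc
        rw [List.map_cons, List.prod_cons, List.length_cons]
        have h1 : U.card.factorial ≤ ρ ^ U.card :=
          (Nat.factorial_le_pow _).trans (Nat.pow_le_pow_left hUρ _)
        calc _ ≤ 2 ^ ρ * (F.card * 3 ^ ms.length) * ρ ^ U.card :=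
            Nat.mul_le_mul (Nat.mul_le_mul (Nat.choose_le_two_pow _ _) hFc) h1
          _ = F.card * (ρ ^ U.card * 3 ^ ms.length * 2 ^ ρ) := by ring
          _ ≤ _ := by
            gcongr
            · norm_num
            · omega

/-- ρ^k / k! is a term of the exponential series of e^ρ, and e < 4. -/
theorem pow_le_four_pow_mul_factorial (ρ k : ℕ) : ρ ^ k ≤ 4 ^ ρ * k.factorial := by
  have h1 := Real.pow_div_factorial_le_exp (ρ : ℝ) (Nat.cast_nonneg ρ) k
  have h2 : Real.exp (ρ : ℝ) ≤ 4 ^ ρ := by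
    rw [← Real.exp_one_pow]
    exact pow_le_pow_left₀ (Real.exp_pos 1).le (by linarith [Real.exp_one_lt_d9]) _
  rw [div_le_iff₀ (by positivity)] at h1
  have h3 : (ρ : ℝ) ^ k ≤ 4 ^ ρ * k.factorial :=
    h1.trans (mul_le_mul_of_nonneg_right h2 (by positivity))
  exact_mod_cast h3

/-- The sets of runs that contain the successive values of an indecomposable list. -/
structure IsIndecomposableSeq (ρ : ℕ) (ms : List ℕ) (l : List (Finset ℕ)) : Prop where
  map_card : l.map Finset.card = ms
  subset : ∀ S ∈ l, S ⊆ Finset.range ρ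
  cover : ∀ u < ρ, ∃ S ∈ l, u ∈ S
  chain : l.IsChain Separated
  head : ∃ S ∈ l.head?, 0 ∉ S ∧ ρ - 1 ∈ S
  last : ∃ S ∈ l.getLast?, 0 ∈ S ∧ ρ - 1 ∉ S

/-- The first set is fixed as the top `a` runs and the last as the bottom `b` runs, which places
runs `0` and `ρ - 1` as required; the runs between are left to cover. Fixing both loses 2^ρ twice,
and with 4^ρ · 2^ρ from the covering this makes 32^ρ. -/
theorem exists_indecomposableSeqs {ρ : ℕ} (hρ : 3 ≤ ρ) {a b : ℕ} {ms : List ℕ} (ha0 : 0 < a)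
    (ha : a < ρ) (hb0 : 0 < b) (hb : b < ρ) (hms : ∀ m ∈ ms, 0 < m ∧ m ≤ ρ)
    (hsum : ρ ≤ a + ms.sum + b) :
    ∃ F : Finset (List (Finset ℕ)),
      (∀ l ∈ F, IsIndecomposableSeq ρ (a :: (ms ++ [b])) l) ∧
      ((a :: (ms ++ [b])).map ρ.choose).prod ≤ F.card * (32 ^ ρ * 3 ^ ms.length) := by
  set P := Finset.Ico (ρ - a) ρ with hP
  set Q := Finset.range b with hQ
  set U := Finset.Ico b (ρ - a) with hU
  have hmP : ∀ x, x ∈ P ↔ ρ - a ≤ x ∧ x < ρ := fun x => by simp [hP]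
  have hmU : ∀ x, x ∈ U ↔ b ≤ x ∧ x < ρ - a := fun x => by simp [hU]
  have hmQ : ∀ x, x ∈ Q ↔ x < b := fun x => by simp [hQ]
  obtain ⟨F, hF, hFc⟩ := exists_ownerSeqs hρ Q ms hms P U
    (fun x hx => by
      have := (hmU x).1 hx
      rw [Finset.mem_range]
      omega)
    (fun h => by
      have h1 : ρ - 1 ∈ P := (hmP _).2 (by omega)
      rw [h.1, hmQ] at h1
      omega)
    (Finset.disjoint_left.2 fun x h1 h2 => by
      rw [hmP] at h1
      rw [hmU] at h2
      omega)
    (Finset.disjoint_left.2 fun x h1 h2 => by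
      rw [hmQ] at h1
      rw [hmU] at h2
      omega)
    (by
      rw [hU, Nat.card_Ico]
      omega)
  refine ⟨F.image fun l => P :: (l ++ [Q]), fun l hl => ?_, ?_⟩
  · obtain ⟨l, hlF, rfl⟩ := Finset.mem_image.1 hl
    obtain ⟨h1, h2, h3, h4⟩ := hF l hlF
    refine ⟨?_, ?_, ?_, h4, ⟨P, by simp, ?_⟩, ⟨Q, by simp [List.getLast?_cons], ?_⟩⟩
    · simp only [List.map_cons, List.map_append, h1, List.map_nil, hP, hQ, Nat.card_Ico,
        Finset.card_range]
      rw [Nat.sub_sub_self ha.le]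
    · intro S hS x hx
      rw [List.mem_cons, List.mem_append, List.mem_singleton] at hS
      rcases hS with rfl | hS | rfl
      · exact Finset.mem_range.2 ((hmP x).1 hx).2
      · exact h2 S hS hx
      · exact Finset.mem_range.2 (((hmQ x).1 hx).trans hb)
    · intro u hu
      by_cases hu1 : u ∈ P
      · exact ⟨P, by simp, hu1⟩
      by_cases hu2 : u ∈ Q
      · exact ⟨Q, by simp, hu2⟩
      · obtain ⟨S, hS, huS⟩ := h3 u (by
          rw [hmP] at hu1
          rw [hmQ] at hu2
          rw [hmU]
          omega)
        exact ⟨S, by simp [hS], huS⟩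
    · rw [hmP, hmP]
      omega
    · rw [hmQ, hmQ]
      omega
  · rw [Finset.card_image_of_injective _ fun l l' h => by simpa using h]
    simp only [List.map_cons, List.map_append, List.map_nil, List.prod_cons, List.prod_append,
      List.prod_nil, mul_one]
    have h1 := Nat.choose_le_two_pow ρ a
    have h2 := Nat.choose_le_two_pow ρ b
    have h3 := pow_le_four_pow_mul_factorial ρ U.card
    have h4 : (ms.map ρ.choose).prod ≤ F.card * (4 ^ ρ * 3 ^ ms.length * 2 ^ ρ) := by
      refine Nat.le_of_mul_le_mul_right (hFc.trans ?_) U.card.factorial_pos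
      calc _ ≤ F.card * (4 ^ ρ * U.card.factorial * 3 ^ ms.length * 2 ^ ρ) := by gcongr
        _ = _ := by ring
    calc _ ≤ 2 ^ ρ * (F.card * (4 ^ ρ * 3 ^ ms.length * 2 ^ ρ) * 2 ^ ρ) := by gcongr
      _ = F.card * ((2 ^ ρ * 4 ^ ρ * 2 ^ ρ * 2 ^ ρ) * 3 ^ ms.length) := by ring
      _ = _ := by
        rw [← mul_pow, ← mul_pow, ← mul_pow]
        norm_num

/-! ### Runs with prescribed blocks -/

/-- The entries of `g` are assigned to the members of `S` in increasing order. -/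
def spread (S : Finset ℕ) (g : List ℕ) (i : ℕ) : ℕ :=
  if i ∈ S then g.getD (S.filter fun s => s < i).card 0 else 0

theorem card_filter_lt_lt {S : Finset ℕ} {i : ℕ} (hi : i ∈ S) :
    (S.filter fun s => s < i).card < S.card :=
  Finset.card_lt_card (Finset.filter_ssubset.2 ⟨i, hi, lt_irrefl i⟩)

theorem spread_pos_iff {S : Finset ℕ} {g : List ℕ} (hcard : S.card = g.length)
    (hg : ∀ a ∈ g, 0 < a) (i : ℕ) : 0 < spread S g i ↔ i ∈ S := by
  unfold spread
  split_ifs with hi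
  · have h := hcard ▸ card_filter_lt_lt hi
    rw [List.getD_eq_getElem _ _ h]
    exact iff_of_true (hg _ (List.getElem_mem h)) hi
  · simp [hi]

theorem filter_map_spread {S : Finset ℕ} {g : List ℕ} {ρ : ℕ} (hS : S ⊆ Finset.range ρ)
    (hcard : S.card = g.length) (hg : ∀ a ∈ g, 0 < a) :
    (((List.range ρ).map (spread S g)).filter fun a => decide (0 < a)) = g := by
  have key : ∀ k, (((List.range k).map (spread S g)).filter fun a => decide (0 < a)) =
      g.take (S.filter fun s => s < k).card := by
    intro k
    induction k with
    | zero => simp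
    | succ k ih =>
      rw [List.range_succ, List.map_append, List.filter_append, ih]
      by_cases hk : k ∈ S
      · have h := hcard ▸ card_filter_lt_lt hk
        have hpos := (spread_pos_iff hcard hg k).2 hk
        have e : (S.filter fun s => s < k + 1) = insert k (S.filter fun s => s < k) := by
          ext s
          simp only [Finset.mem_filter, Finset.mem_insert]
          constructor
          · rintro ⟨h1, h2⟩
            by_cases h3 : s = k
            · exact Or.inl h3
            · exact Or.inr ⟨h1, by omega⟩
          · rintro (rfl | ⟨h1, h2⟩)
            · exact ⟨hk, by omega⟩
            · exact ⟨h1, by omega⟩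
        rw [e, Finset.card_insert_of_notMem (by simp), List.take_add_one,
          List.getElem?_eq_getElem h, List.map_singleton, List.filter_singleton]
        simp only [hpos, decide_true, Option.toList_some]
        rw [spread, if_pos hk, List.getD_eq_getElem _ _ h]
        rfl
      · have hpos := (spread_pos_iff hcard hg k).not.2 hk
        have e : (S.filter fun s => s < k + 1) = S.filter fun s => s < k := by
          refine Finset.filter_congr fun s hs => ?_
          have : s ≠ k := fun h => hk (h ▸ hs)
          omega
        rw [e, List.map_singleton, List.filter_singleton]
        simp [hpos]
  rw [key, Finset.filter_true_of_mem fun s hs => Finset.mem_range.1 (hS hs), hcard,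
    List.take_length]

/-- The runs in which the value `j` has the block sizes `gss j` and occurs in the runs `l j`. -/
def buildRuns (ρ : ℕ) (l : List (Finset ℕ)) (gss : List (List ℕ)) : List (List ℕ) :=
  (List.range ρ).map fun i => (List.range l.length).flatMap fun j =>
    List.replicate (spread (l.getD j ∅) (gss.getD j []) i) j

/-- The sets and the block sizes fit together. -/
structure FitsBlocks (ρ : ℕ) (l : List (Finset ℕ)) (gss : List (List ℕ)) : Prop where
  map_card : l.map Finset.card = gss.map List.length
  subset : ∀ S ∈ l, S ⊆ Finset.range ρ
  cover : ∀ u < ρ, ∃ S ∈ l, u ∈ S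
  chain : l.IsChain Separated
  ne_nil : ∀ g ∈ gss, g ≠ []
  pos : ∀ g ∈ gss, ∀ a ∈ g, 0 < a

section

variable {ρ : ℕ} {l : List (Finset ℕ)} {gss : List (List ℕ)}

theorem FitsBlocks.length_eq (h : FitsBlocks ρ l gss) : l.length = gss.length := by
  simpa using congrArg List.length h.map_card

theorem FitsBlocks.card_eq (h : FitsBlocks ρ l gss) {j : ℕ} (hj : j < l.length) :
    (l.getD j ∅).card = (gss.getD j []).length := by
  have := List.getElem_of_eq h.map_card (i := j) (by simpa using hj)
  have hj' := h.length_eq ▸ hj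
  rw [List.getD_eq_getElem _ _ hj, List.getD_eq_getElem _ _ hj']
  simpa using this

theorem FitsBlocks.getD_mem (h : FitsBlocks ρ l gss) {j : ℕ} (hj : j < l.length) :
    gss.getD j [] ∈ gss := by
  have hj' := h.length_eq ▸ hj
  rw [List.getD_eq_getElem _ _ hj']
  exact List.getElem_mem hj'

theorem getD_mem_of_lt {j : ℕ} (hj : j < l.length) : l.getD j ∅ ∈ l := by
  rw [List.getD_eq_getElem _ _ hj]
  exact List.getElem_mem hj

theorem FitsBlocks.spread_pos_iff (h : FitsBlocks ρ l gss) {j : ℕ} (hj : j < l.length) (i : ℕ) :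
    0 < spread (l.getD j ∅) (gss.getD j []) i ↔ i ∈ l.getD j ∅ :=
  _root_.spread_pos_iff (h.card_eq hj) (h.pos _ (h.getD_mem hj)) i

theorem FitsBlocks.mem_run_iff (h : FitsBlocks ρ l gss) {i j : ℕ} :
    (j ∈ (List.range l.length).flatMap fun j =>
      List.replicate (spread (l.getD j ∅) (gss.getD j []) i) j) ↔
    j < l.length ∧ i ∈ l.getD j ∅ := by
  simp only [List.mem_flatMap, List.mem_range, List.mem_replicate]
  constructor
  · rintro ⟨k, hk, h1, rfl⟩
    exact ⟨hk, (h.spread_pos_iff hk i).1 (Nat.pos_of_ne_zero h1)⟩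
  · rintro ⟨hj, hi⟩
    exact ⟨j, hj, ((h.spread_pos_iff hj i).2 hi).ne', rfl⟩

theorem count_flatMap_replicate {d : ℕ} (f : ℕ → ℕ) {j : ℕ} (hj : j < d) :
    ((List.range d).flatMap fun j => List.replicate (f j) j).count j = f j := by
  have key : ∀ d, ((List.range d).flatMap fun j => List.replicate (f j) j).count j =
      if j < d then f j else 0 := by
    intro d
    induction d with
    | zero => simp
    | succ d ih =>
      rw [List.range_succ, List.flatMap_append, List.count_append, ih]
      simp only [List.flatMap_singleton, List.count_replicate]
      by_cases h1 : j < d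
      · have h2 : d ≠ j := by omega
        have h3 : j < d + 1 := by omega
        simp [h1, h2, h3]
      · by_cases h2 : d = j
        · subst h2
          simp
        · have h3 : ¬ j < d + 1 := by omega
          simp [h1, h2, h3]
  rw [key, if_pos hj]

theorem FitsBlocks.isRunDecomposition (h : FitsBlocks ρ l gss) :
    IsRunDecomposition (buildRuns ρ l gss).flatten (buildRuns ρ l gss) := by
  refine ⟨rfl, fun r hr => ?_⟩
  obtain ⟨i, hi, rfl⟩ := List.mem_map.1 hr
  refine ⟨?_, ?_⟩
  · obtain ⟨S, hS, hiS⟩ := h.cover i (List.mem_range.1 hi)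
    obtain ⟨j, hj, rfl⟩ := List.getElem_of_mem hS
    refine List.ne_nil_of_mem (a := j) (h.mem_run_iff.2 ⟨hj, ?_⟩)
    rwa [List.getD_eq_getElem _ _ hj]
  · rw [List.pairwise_flatMap]
    refine ⟨fun j _ => List.pairwise_replicate.2 (Or.inr le_rfl),
      List.pairwise_lt_range.imp fun {a b} hab x hx y hy => ?_⟩
    rw [List.eq_of_mem_replicate hx, List.eq_of_mem_replicate hy]
    exact hab.le

theorem FitsBlocks.mem_flatten_iff (h : FitsBlocks ρ l gss) {j : ℕ} :
    j ∈ (buildRuns ρ l gss).flatten ↔ j < l.length := by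
  simp only [buildRuns, List.mem_flatten, List.mem_map, exists_exists_and_eq_and, h.mem_run_iff]
  constructor
  · rintro ⟨i, -, hj, -⟩
    exact hj
  · intro hj
    have hne : (l.getD j ∅).Nonempty := by
      rw [← Finset.card_pos, h.card_eq hj]
      exact List.length_pos_iff.2 (h.ne_nil _ (h.getD_mem hj))
    obtain ⟨i, hi⟩ := hne
    exact ⟨i, List.mem_range.2 (Finset.mem_range.1 (h.subset _ (getD_mem_of_lt hj) hi)), hj, hi⟩

theorem FitsBlocks.sameOwner_iff (h : FitsBlocks ρ l gss) {a b : ℕ} (ha : a < l.length)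
    (hb : b < l.length) (hab : SameOwner (buildRuns ρ l gss) a b) :
    ¬ Separated (l.getD a ∅) (l.getD b ∅) := by
  obtain ⟨h1, h2⟩ := hab
  simp only [buildRuns, List.mem_map, List.mem_range, forall_exists_index, and_imp,
    forall_apply_eq_imp_iff₂, h.mem_run_iff, ha, hb, true_and] at h1
  rw [Separated, not_not]
  refine ⟨?_, ?_⟩
  · ext i
    by_cases hi : i < ρ
    · exact h1 i hi
    · exact iff_of_false
        (fun h' => hi (Finset.mem_range.1 (h.subset _ (getD_mem_of_lt ha) h')))
        fun h' => hi (Finset.mem_range.1 (h.subset _ (getD_mem_of_lt hb) h'))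
  · rw [buildRuns, List.countP_map] at h2
    simp only [Function.comp_def, h.mem_run_iff, ha, true_and] at h2
    rw [← h2]
    have e : l.getD a ∅ = (Finset.range ρ).filter fun i => i ∈ l.getD a ∅ := by
      ext i
      simp only [Finset.mem_filter]
      exact ⟨fun h' => ⟨h.subset _ (getD_mem_of_lt ha) h', h'⟩, fun h' => h'.2⟩
    conv_lhs => rw [e]
    rw [List.countP_eq_length_filter]
    rfl

/-- Separation of adjacent sets keeps adjacent values from merging, so every value forms a member by
itself. -/
theorem FitsBlocks.outputPartition_eq (h : FitsBlocks ρ l gss) :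
    outputPartition (buildRuns ρ l gss) = (List.range l.length).map fun j => [j] := by
  refine outputPartition_eq_iff.2 ⟨?_, by simp, ?_, ?_⟩
  · rw [← List.flatMap_def, List.flatMap_singleton']
    exact distinctValues_eq List.nodup_range List.pairwise_le_range fun j => by
      rw [h.mem_flatten_iff, List.mem_range]
  · simp only [List.mem_map, forall_exists_index, and_imp, forall_apply_eq_imp_iff₂]
    exact fun j _ => List.isChain_singleton j
  · rw [List.isChain_map, List.isChain_iff_getElem]
    intro i hi
    rw [List.length_range] at hi
    refine ⟨by simp, by simp, fun hs => ?_⟩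
    simp only [List.getElem_range, List.getLast_singleton, List.head_cons] at hs
    refine h.sameOwner_iff (by omega) hi hs ?_
    have := List.isChain_iff_getElem.1 h.chain i hi
    rwa [List.getD_eq_getElem _ _ (by omega), List.getD_eq_getElem _ _ hi]

theorem FitsBlocks.memberBlockSizes_eq (h : FitsBlocks ρ l gss) {j : ℕ} (hj : j < l.length) :
    memberBlockSizes (buildRuns ρ l gss) [j] = gss.getD j [] := by
  rw [memberBlockSizes_singleton, buildRuns, List.map_map]
  have : ((fun r : List ℕ => r.count j) ∘ fun i => (List.range l.length).flatMap fun j =>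
      List.replicate (spread (l.getD j ∅) (gss.getD j []) i) j) =
      spread (l.getD j ∅) (gss.getD j []) := by
    funext i
    exact count_flatMap_replicate (fun j => spread (l.getD j ∅) (gss.getD j []) i) hj
  rw [this]
  exact filter_map_spread (h.subset _ (getD_mem_of_lt hj)) (h.card_eq hj)
    (h.pos _ (h.getD_mem hj))

theorem FitsBlocks.map_memberBlockSizes (h : FitsBlocks ρ l gss) :
    (outputPartition (buildRuns ρ l gss)).map (memberBlockSizes (buildRuns ρ l gss)) = gss := by
  rw [h.outputPartition_eq, List.map_map]
  refine List.ext_getElem (by simp [h.length_eq]) fun j h1 h2 => ?_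
  simp only [List.length_map, List.length_range] at h1
  simp only [List.getElem_map, List.getElem_range, Function.comp]
  rw [h.memberBlockSizes_eq h1, List.getD_eq_getElem _ _ h2]

theorem FitsBlocks.subParams_eq (h : FitsBlocks ρ l gss) :
    subParams (buildRuns ρ l gss) =
      ⟨gss.flatten.sum, ρ, gss.flatten, gss.map List.length⟩ := by
  have h1 := sum_blockSizes (buildRuns ρ l gss)
  have h2 := h.map_memberBlockSizes
  simp only [subParams, List.flatMap_def, h2] at h1 ⊢
  rw [← h1, ← Function.comp_def List.length, ← List.map_map, h2]
  simp [buildRuns]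

theorem FitsBlocks.injective {l' : List (Finset ℕ)} (h : FitsBlocks ρ l gss)
    (h' : FitsBlocks ρ l' gss) (heq : buildRuns ρ l gss = buildRuns ρ l' gss) : l = l' := by
  have hlen : l.length = l'.length := h.length_eq.trans h'.length_eq.symm
  refine List.ext_getElem hlen fun j hj hj' => ?_
  have key : ∀ {l : List (Finset ℕ)} (h : FitsBlocks ρ l gss) (hj : j < l.length) (i : ℕ),
      i ∈ l[j] ↔ j ∈ (buildRuns ρ l gss).getD i [] := by
    intro l h hj i
    rw [← List.getD_eq_getElem l ∅ hj]
    by_cases hi : i < ρ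
    · rw [List.getD_eq_getElem (buildRuns ρ l gss) [] (by simpa [buildRuns] using hi)]
      simp only [buildRuns, List.getElem_map, List.getElem_range]
      rw [h.mem_run_iff]
      simp [hj]
    · rw [List.getD_eq_default (buildRuns ρ l gss) [] (by simpa [buildRuns] using hi)]
      exact iff_of_false
        (fun h' => hi (Finset.mem_range.1 (h.subset _ (getD_mem_of_lt hj) h'))) (by simp)
  ext i
  rw [key h hj, key h' hj', heq]

/-- If a 0 lies after the cut, the first entry of `A` exceeds it. Otherwise the cut falls inside
`B`, and `t` from `A` exceeds everything after it. -/
theorem indecomposable_of_first_last {A B : List ℕ} {M : List (List ℕ)} {t : ℕ} (hA : 0 ∉ A)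
    (hB : 0 ∈ B) (htA : t ∈ A) (htB : t ∉ B) (hle : ∀ b ∈ B, b ≤ t) :
    Indecomposable (A :: (M ++ [B])).flatten := by
  intro l₁ l₂ he h1 h2
  rw [List.flatten_cons, List.flatten_append, List.flatten_singleton, ← List.append_assoc] at he
  by_cases h0 : 0 ∈ l₂
  · obtain ⟨a, A, rfl⟩ := List.exists_cons_of_ne_nil (List.ne_nil_of_mem htA)
    obtain ⟨c, l₁, rfl⟩ := List.exists_cons_of_ne_nil h1
    simp only [List.cons_append, List.cons.injEq] at he
    exact ⟨c, by simp, 0, h0, Nat.pos_of_ne_zero fun hc => hA (by simp [he.1, hc])⟩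
  · rcases List.append_eq_append_iff.1 he with ⟨c, rfl, rfl⟩ | ⟨c, -, rfl⟩
    · obtain ⟨b, hb⟩ := List.exists_mem_of_ne_nil _ h2
      refine ⟨t, by simp [htA], b, hb, lt_of_le_of_ne (hle b (by simp [hb])) ?_⟩
      rintro rfl
      exact htB (by simp [hb])
    · exact absurd (List.mem_append_right _ hB) h0

theorem FitsBlocks.indecomposable {ms : List ℕ} (h : FitsBlocks ρ l gss) (hρ : 2 ≤ ρ)
    (hl : IsIndecomposableSeq ρ ms l) : Indecomposable (buildRuns ρ l gss).flatten := by
  obtain ⟨S, hS, h0S, hρS⟩ := hl.head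
  obtain ⟨T, hT, h0T, hρT⟩ := hl.last
  have hne : l ≠ [] := by
    rintro rfl
    simp at hS
  have hpos := List.length_pos_iff.2 hne
  have eS : l.getD 0 ∅ = S := by
    obtain ⟨a, l, rfl⟩ := List.exists_cons_of_ne_nil hne
    simpa using hS
  have eT : l.getD (l.length - 1) ∅ = T := by
    rw [List.getLast?_eq_getElem?] at hT
    rw [List.getD_eq_getElem?_getD, hT]
    rfl
  obtain ⟨k, rfl⟩ : ∃ k, ρ = k + 2 := ⟨ρ - 2, by omega⟩
  rw [buildRuns, List.range_succ, List.range_succ_eq_map, List.map_append, List.map_cons,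
    List.cons_append, List.map_singleton]
  refine indecomposable_of_first_last (t := l.length - 1) ?_ ?_ ?_ ?_ ?_
  · rw [h.mem_run_iff, eS]
    exact fun h' => h0S h'.2
  · rw [h.mem_run_iff, eS]
    exact ⟨hpos, hρS⟩
  · rw [h.mem_run_iff, eT]
    exact ⟨by omega, h0T⟩
  · rw [h.mem_run_iff, eT]
    exact fun h' => hρT h'.2
  · intro b hb
    rw [h.mem_run_iff] at hb
    omega

end

/-! ### The parameters of an indecomposable list -/

/-- A least value that occurs in all runs would open the first run, and a cut right after that entry
would be admissible; a second run ensures that something follows the cut. -/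
theorem memberValues_head_lt {y : List ℕ} {R : List (List ℕ)} (h : IsRunDecomposition y R)
    (hi : Indecomposable y) (hρ : 2 ≤ R.length) {a : ℕ}
    (ha : a ∈ (subParams R).memberValues.head?) : a < R.length := by
  simp only [subParams, List.head?_map, Option.mem_def, Option.map_eq_some_iff] at ha
  obtain ⟨J, hJ, rfl⟩ := ha
  obtain ⟨Js, hJs⟩ : ∃ Js, outputPartition R = J :: Js :=
    ⟨_, (List.cons_head?_tail (l := outputPartition R) hJ).symm⟩
  have hJm : J ∈ outputPartition R := by simp [hJs]
  refine lt_of_le_of_ne (length_memberBlockSizes_le R J) fun heq => ?_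
  obtain ⟨v, J', rfl⟩ := List.exists_cons_of_ne_nil (ne_nil_of_mem_outputPartition hJm)
  rw [length_memberBlockSizes_eq hJm (List.mem_cons_self ..)] at heq
  have hall := List.countP_eq_length.1 heq
  have hmin : ∀ u ∈ y, v ≤ u := by
    intro u hu
    have h1 := pairwise_distinctValues R.flatten
    have h2 : u ∈ distinctValues R.flatten := by
      rw [mem_distinctValues, h.1]
      exact hu
    rw [← flatten_outputPartition, hJs, List.flatten_cons, List.cons_append] at h1 h2
    rcases List.mem_cons.1 h2 with rfl | h2
    · exact le_rfl
    · exact (List.pairwise_cons.1 h1).1 u h2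
  obtain ⟨rfl, h2⟩ := h
  obtain ⟨r, s, R', rfl⟩ : ∃ r s R', R = r :: s :: R' := by
    match R, hρ with
    | r :: s :: R', _ => exact ⟨r, s, R', rfl⟩
  obtain ⟨hr0, hrs⟩ := h2 r (by simp)
  obtain ⟨hs0, -⟩ := h2 s (by simp)
  have hvr : v ∈ r := by simpa using hall r (by simp)
  obtain ⟨c, r, rfl⟩ := List.exists_cons_of_ne_nil hr0
  have hcv : c ≤ v := by
    rcases List.mem_cons.1 hvr with rfl | h3
    · exact le_rfl
    · exact (List.pairwise_cons.1 hrs).1 v h3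
  obtain ⟨a, ha, b, hb, hba⟩ := hi [c] (r ++ (s :: R').flatten) (by simp) (by simp) (by
    simp [hs0])
  rw [List.mem_singleton] at ha
  have := hmin b (by
    rw [List.flatten_cons, List.cons_append]
    exact List.mem_cons_of_mem _ hb)
  omega

/-- Dually, a greatest value that occurs in all runs would close the last run and could be cut off.
-/
theorem memberValues_last_lt {y : List ℕ} {R : List (List ℕ)} (h : IsRunDecomposition y R)
    (hi : Indecomposable y) (hρ : 2 ≤ R.length) {a : ℕ}
    (ha : a ∈ (subParams R).memberValues.getLast?) : a < R.length := by
  simp only [subParams, List.getLast?_map, Option.mem_def, Option.map_eq_some_iff] at ha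
  obtain ⟨J, hJ, rfl⟩ := ha
  obtain ⟨Js, hJs⟩ : ∃ Js, outputPartition R = Js ++ [J] :=
    List.getLast?_eq_some_iff.1 hJ
  have hJm : J ∈ outputPartition R := by simp [hJs]
  refine lt_of_le_of_ne (length_memberBlockSizes_le R J) fun heq => ?_
  obtain ⟨J', v, rfl⟩ : ∃ J' v, J = J' ++ [v] :=
    ⟨_, _, (List.dropLast_append_getLast (ne_nil_of_mem_outputPartition hJm)).symm⟩
  rw [length_memberBlockSizes_eq (v := v) hJm (by simp)] at heq
  have hall := List.countP_eq_length.1 heq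
  have hmax : ∀ u ∈ y, u ≤ v := by
    intro u hu
    have h1 := pairwise_distinctValues R.flatten
    have h2 : u ∈ distinctValues R.flatten := by
      rw [mem_distinctValues, h.1]
      exact hu
    rw [← flatten_outputPartition, hJs, List.flatten_append, List.flatten_singleton,
      ← List.append_assoc] at h1 h2
    rcases List.mem_append.1 h2 with h2 | h2
    · exact (List.pairwise_append.1 h1).2.2 u h2 v (by simp)
    · exact (List.mem_singleton.1 h2).le
  obtain ⟨rfl, h2⟩ := h
  obtain ⟨R', s, rfl⟩ : ∃ R' s, R = R' ++ [s] := by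
    have : R ≠ [] := by
      rintro rfl
      simp at hρ
    exact ⟨_, _, (List.dropLast_append_getLast this).symm⟩
  obtain ⟨r, R', rfl⟩ : ∃ r R'', R' = r :: R'' := by
    refine List.exists_cons_of_ne_nil ?_
    rintro rfl
    simp at hρ
  obtain ⟨hr0, -⟩ := h2 r (by simp)
  obtain ⟨hs0, hss⟩ := h2 s (by simp)
  have hvs : v ∈ s := by simpa using hall s (by simp)
  obtain ⟨s, c, rfl⟩ : ∃ s' c, s = s' ++ [c] :=
    ⟨_, _, (List.dropLast_append_getLast hs0).symm⟩
  have hcv : v ≤ c := by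
    rcases List.mem_append.1 hvs with h3 | h3
    · exact (List.pairwise_append.1 hss).2.2 v h3 c (by simp)
    · exact (List.mem_singleton.1 h3).le
  obtain ⟨a, ha, b, hb, hba⟩ := hi ((r :: R').flatten ++ s) [c] (by simp) (by
    simp [hr0]) (by simp)
  rw [List.mem_singleton] at hb
  have := hmax a (by
    rw [List.flatten_append, List.flatten_singleton, ← List.append_assoc]
    exact List.mem_append_left _ ha)
  omega

/-! ### Counting the lists with given parameters -/

/-- The list is an indecomposable sub-instance with the given parameters. -/
def IsRealization (p : SubParams) (y : List ℕ) : Prop :=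
  y ≠ [] ∧ Indecomposable y ∧ ∃ R, IsRunDecomposition y R ∧ subParams R = p

theorem IsRealization.length_eq {p : SubParams} {y : List ℕ} (h : IsRealization p y) :
    y.length = p.size := by
  obtain ⟨-, -, R, hR, rfl⟩ := h
  rw [← hR.1]
  rfl

/-- With at most two runs every binomial is at most 4, so the given list alone is enough. -/
theorem exists_finset_of_runs_le {p : SubParams} {y : List ℕ} (h : IsRealization p y)
    (hρ : p.runs ≤ 2) :
    ∃ F : Finset (List ℕ), (∀ y ∈ F, IsRealization p y) ∧
      (∀ y ∈ F, ∀ y' ∈ F, OrderSimilar y y' → y = y') ∧ p.runChoices ≤ F.card * 768 ^ p.size := by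
  refine ⟨{y}, by simpa using h, by simp, ?_⟩
  obtain ⟨-, -, R, hR, rfl⟩ := h
  have hb := hR.isBounded
  have h1 : (subParams R).runChoices ≤ 4 ^ (subParams R).memberValues.length := by
    have := List.prod_le_pow_card ((subParams R).memberValues.map (subParams R).runs.choose) 4
      fun a ha => by
        obtain ⟨m, -, rfl⟩ := List.mem_map.1 ha
        exact (Nat.choose_le_two_pow _ _).trans (Nat.pow_le_pow_right (by norm_num) hρ)
    simpa [SubParams.runChoices] using this
  rw [Finset.card_singleton, one_mul]
  calc _ ≤ 4 ^ (subParams R).memberValues.length := h1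
    _ ≤ 4 ^ (subParams R).size := Nat.pow_le_pow_right (by norm_num) hb.length_memberValues
    _ ≤ _ := Nat.pow_le_pow_left (by norm_num) _

theorem exists_memberValues_eq {p : SubParams} {y : List ℕ} (h : IsRealization p y)
    (hρ : 2 ≤ p.runs) : ∃ a ms b, p.memberValues = a :: (ms ++ [b]) ∧ a < p.runs ∧
      b < p.runs := by
  obtain ⟨-, hi, R, hR, rfl⟩ := h
  have hsum := runs_le_sum_memberValues hR
  have h1 := fun a => memberValues_head_lt (a := a) hR hi hρ
  have h2 := fun a => memberValues_last_lt (a := a) hR hi hρ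
  change ∀ a, _ → a < (subParams R).runs at h1 h2
  generalize (subParams R).memberValues = mv at hsum h1 h2
  match mv with
  | [] =>
    rw [List.sum_nil] at hsum
    omega
  | [a] =>
    have := h1 a (by simp)
    simp only [List.sum_cons, List.sum_nil] at hsum
    omega
  | a :: b :: t =>
    refine ⟨a, (b :: t).dropLast, (b :: t).getLast (by simp), ?_, h1 a (by simp), h2 _ ?_⟩
    · rw [List.dropLast_append_getLast]
    · rw [List.getLast?_cons_cons, List.getLast?_eq_getLast_of_ne_nil (by simp)]
      rfl

open Classical in
theorem exists_finset_of_three_le {p : SubParams} {y : List ℕ} (h : IsRealization p y)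
    (hρ : 3 ≤ p.runs) :
    ∃ F : Finset (List ℕ), (∀ y ∈ F, IsRealization p y) ∧
      (∀ y ∈ F, ∀ y' ∈ F, OrderSimilar y y' → y = y') ∧ p.runChoices ≤ F.card * 768 ^ p.size := by
  obtain ⟨a, ms, b, hms, ha, hb⟩ := exists_memberValues_eq h (by omega)
  have hypos := h.length_eq ▸ List.length_pos_iff.2 h.1
  obtain ⟨-, -, R, hR, rfl⟩ := h
  have hbd := hR.isBounded
  set gss := (outputPartition R).map (memberBlockSizes R) with hgss
  have hlen : gss.map List.length = (subParams R).memberValues := by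
    rw [hgss, List.map_map]
    rfl
  have hval : ∀ m ∈ a :: (ms ++ [b]), 0 < m ∧ m ≤ (subParams R).runs := fun m hm =>
    ⟨memberValues_pos (hms ▸ hm), hbd.memberValues_le m (hms ▸ hm)⟩
  have hsum := runs_le_sum_memberValues hR
  rw [hms, List.sum_cons, List.sum_append, List.sum_singleton, ← add_assoc] at hsum
  obtain ⟨F, hF, hFc⟩ := exists_indecomposableSeqs hρ (hval a (by simp)).1 ha
    (hval b (by simp)).1 hb (fun m hm => hval m (by simp [hm])) hsum
  have hfit : ∀ l ∈ F, FitsBlocks (subParams R).runs l gss := by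
    intro l hl
    have h1 := hF l hl
    refine ⟨by rw [h1.map_card, hlen, hms], h1.subset, h1.cover, h1.chain, fun g hg => ?_,
      fun g hg c hc => ?_⟩
    · rw [← List.length_pos_iff]
      exact memberValues_pos (hlen ▸ List.mem_map_of_mem hg)
    · refine blockSizes_pos (R := R) ?_
      have : (subParams R).blockSizes = gss.flatten := by
        rw [hgss, ← List.flatMap_def]
        rfl
      rw [this]
      exact List.mem_flatten.2 ⟨g, hg, hc⟩
  set f : List (Finset ℕ) → List ℕ := fun l => (buildRuns (subParams R).runs l gss).flatten
    with hf
  have hsub : ∀ l ∈ F, subParams (buildRuns (subParams R).runs l gss) = subParams R := by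
    intro l hl
    have h1 : gss.flatten = (subParams R).blockSizes := by
      rw [hgss, ← List.flatMap_def]
      rfl
    rw [(hfit l hl).subParams_eq, h1, hlen, sum_blockSizes]
  refine ⟨F.image f, ?_, ?_, ?_⟩
  · intro y hy
    obtain ⟨l, hl, rfl⟩ := Finset.mem_image.1 hy
    refine ⟨?_, (hfit l hl).indecomposable (by omega) (hF l hl), _,
      (hfit l hl).isRunDecomposition, hsub l hl⟩
    rw [← List.length_pos_iff]
    have := congrArg SubParams.size (hsub l hl)
    change (f l).length = _ at this
    omega
  · intro y hy y' hy' hs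
    obtain ⟨l, hl, rfl⟩ := Finset.mem_image.1 hy
    obtain ⟨l', hl', rfl⟩ := Finset.mem_image.1 hy'
    refine hs.eq_of_toFinset (d := l.length) (d' := l'.length) ?_ ?_
    · ext j
      rw [List.mem_toFinset, Finset.mem_range]
      exact (hfit l hl).mem_flatten_iff
    · ext j
      rw [List.mem_toFinset, Finset.mem_range]
      exact (hfit l' hl').mem_flatten_iff
  -- Different sequences of sets may give the same list with different run boundaries. Recording the
  -- run lengths restores injectivity at the price of 8^size, which gives 8 · 32 · 3 = 768.
  · have hinj : F.card ≤ (F.image f ×ˢ natLists (2 * (subParams R).size)).card := by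
      refine Finset.card_le_card_of_injOn
        (fun l => (f l, (buildRuns (subParams R).runs l gss).map List.length)) ?_ ?_
      · intro l hl
        refine Finset.mem_product.2 ⟨Finset.mem_image_of_mem f hl, mem_natLists ?_⟩
        have h1 := congrArg SubParams.size (hsub l hl)
        have h2 := congrArg SubParams.runs (hsub l hl)
        change (f l).length = _ at h1
        change (buildRuns (subParams R).runs l gss).length = _ at h2
        rw [← List.length_flatten, List.length_map]
        change (f l).length + _ ≤ _
        have := hbd.runs_le
        omega
      · intro l hl l' hl' heq
        rw [Prod.mk.injEq] at heq
        exact (hfit l hl).injective (hfit l' hl') (List.eq_iff_flatten_eq.2 heq)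
    rw [Finset.card_product] at hinj
    have h1 := card_natLists_le (2 * (subParams R).size)
    have h2 : ms.length ≤ (subParams R).size := by
      have := hbd.length_memberValues
      rw [hms] at this
      simp only [List.length_cons, List.length_append] at this
      omega
    have h3 := hbd.runs_le
    have h4 : (subParams R).runChoices ≤ F.card *
        (32 ^ (subParams R).runs * 3 ^ ms.length) := by
      rw [SubParams.runChoices, hms]
      exact hFc
    have h5 : 2 ^ (2 * (subParams R).size + 1) ≤ 8 ^ (subParams R).size := by
      rw [show 8 = 2 ^ 3 by norm_num, ← pow_mul]
      exact Nat.pow_le_pow_right (by norm_num) (by omega)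
    calc _ ≤ F.card * (32 ^ (subParams R).runs * 3 ^ ms.length) := h4
      _ ≤ ((F.image f).card * 8 ^ (subParams R).size) *
          (32 ^ (subParams R).size * 3 ^ (subParams R).size) := by
        refine Nat.mul_le_mul (hinj.trans (Nat.mul_le_mul_left _ (h1.trans h5)))
          (Nat.mul_le_mul (Nat.pow_le_pow_right (by norm_num) h3)
            (Nat.pow_le_pow_right (by norm_num) h2))
      _ = (F.image f).card * (8 * (32 * 3)) ^ (subParams R).size := by
        rw [mul_pow, mul_pow]
        ring
      _ = _ := by norm_num

theorem exists_realizations {p : SubParams} (h : ∃ y, IsRealization p y) :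
    ∃ F : Finset (List ℕ), (∀ y ∈ F, IsRealization p y) ∧
      (∀ y ∈ F, ∀ y' ∈ F, OrderSimilar y y' → y = y') ∧ p.runChoices ≤ F.card * 768 ^ p.size := by
  obtain ⟨y, hy⟩ := h
  rcases le_or_gt p.runs 2 with hρ | hρ
  · exact exists_finset_of_runs_le hy hρ
  · exact exists_finset_of_three_le hy hρ

/-- The list is a concatenation of sub-instances with the given parameters. -/
def IsJointRealization (ps : List SubParams) (z : List ℕ) : Prop :=
  ∃ ys D, IsPivotCutting ys ∧ z = ys.flatten ∧ List.Forall₂ IsRunDecomposition ys D ∧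
    D.map subParams = ps

theorem IsJointRealization.length_eq {ps : List SubParams} {z : List ℕ}
    (h : IsJointRealization ps z) : z.length = (ps.map SubParams.size).sum := by
  obtain ⟨ys, D, -, rfl, hD, rfl⟩ := h
  rw [← map_flatten_eq_of_isRunDecomposition hD, List.length_flatten, List.map_map,
    List.map_map]
  rfl

/-- `y.sum` bounds every entry of `y`, so the shift places the rest above `y`. Equality across the
cut does no harm, as pivot positions require only `≤`. -/
theorem IsJointRealization.cons {p : SubParams} {ps : List SubParams} {y z : List ℕ}
    (hy : IsRealization p y) (hz : IsJointRealization ps z) :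
    IsJointRealization (p :: ps) (y ++ z.map (· + y.sum)) := by
  obtain ⟨hy0, hyi, R, hR, rfl⟩ := hy
  obtain ⟨ys, D, hys, rfl, hD, rfl⟩ := hz
  have hmono : StrictMono (· + y.sum) := fun a b h => Nat.add_lt_add_right h _
  refine ⟨y :: ys.map (List.map (· + y.sum)), R :: D.map (List.map (List.map (· + y.sum))),
    isPivotCutting_cons.2 ⟨hy0, hyi, fun a ha b hb => ?_, hys.map hmono⟩, ?_,
    .cons hR ?_, ?_⟩
  · rw [← List.map_flatten] at hb
    obtain ⟨c, -, rfl⟩ := List.mem_map.1 hb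
    exact (List.le_sum_of_mem ha).trans (Nat.le_add_left _ _)
  · rw [List.flatten_cons, List.map_flatten]
  · rw [List.forall₂_map_left_iff, List.forall₂_map_right_iff]
    exact hD.imp fun _ _ h => h.map hmono
  · rw [List.map_cons, List.map_map]
    congr 1
    exact List.map_congr_left fun R _ => subParams_map hmono R

/-- The sizes fix where the pieces begin, so the order of a concatenation determines the order of
each piece and the counts multiply. -/
theorem exists_jointRealizations (ps : List SubParams) (h : ∀ p ∈ ps, ∃ y, IsRealization p y) :
    ∃ F : Finset (List ℕ), (∀ z ∈ F, IsJointRealization ps z) ∧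
      (∀ z ∈ F, ∀ z' ∈ F, OrderSimilar z z' → z = z') ∧
      totalChoices ps ≤ F.card * 768 ^ (ps.map SubParams.size).sum := by
  induction ps with
  | nil =>
    exact ⟨{[]}, by
      simpa using ⟨[], [], ⟨by simp, by simp⟩, rfl, .nil, rfl⟩, by simp, by simp [totalChoices]⟩
  | cons p ps ih =>
    obtain ⟨F, hF, hFs, hFc⟩ := ih fun q hq => h q (by simp [hq])
    obtain ⟨G, hG, hGs, hGc⟩ := exists_realizations (h p (by simp))
    set f : List ℕ × List ℕ → List ℕ := fun q => q.1 ++ q.2.map (· + q.1.sum) with hf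
    have hmono : ∀ c : ℕ, StrictMono (· + c) := fun c a b h => Nat.add_lt_add_right h _
    have key : ∀ q ∈ G ×ˢ F, ∀ q' ∈ G ×ˢ F, OrderSimilar (f q) (f q') → q = q' := by
      intro q hq q' hq' hs
      rw [Finset.mem_product] at hq hq'
      obtain ⟨h1, h2⟩ := hs.of_append
        ((hG _ hq.1).length_eq.trans (hG _ hq'.1).length_eq.symm)
      exact Prod.ext (hGs _ hq.1 _ hq'.1 h1)
        (hFs _ hq.2 _ hq'.2 (h2.of_map (hmono _) (hmono _)))
    refine ⟨(G ×ˢ F).image f, fun z hz => ?_, fun z hz z' hz' hs => ?_, ?_⟩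
    · obtain ⟨q, hq, rfl⟩ := Finset.mem_image.1 hz
      rw [Finset.mem_product] at hq
      exact (hF _ hq.2).cons (hG _ hq.1)
    · obtain ⟨q, hq, rfl⟩ := Finset.mem_image.1 hz
      obtain ⟨q', hq', rfl⟩ := Finset.mem_image.1 hz'
      rw [key q hq q' hq' hs]
    · rw [Finset.card_image_of_injOn, Finset.card_product]
      · calc totalChoices (p :: ps) = p.runChoices * totalChoices ps := by
              simp [totalChoices]
          _ ≤ (G.card * 768 ^ p.size) * (F.card * 768 ^ (ps.map SubParams.size).sum) :=
            Nat.mul_le_mul hGc hFc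
          _ = _ := by
            rw [List.map_cons, List.sum_cons, pow_add]
            ring
      · intro q hq q' hq' heq
        refine key q hq q' hq' ?_
        rw [heq]
        exact OrderSimilar.refl _

/-! ### The lower bound -/

/-- Let d be the largest cost on the constructed family. From Q ≤ 3^d · 768^n ≤ 2^(2d+10n) and n ≤
2d follows B ≤ 2n + log Q ≤ 12n + 2d ≤ 26d. -/
theorem exists_cost_ge {n : ℕ} (hn : 2 ≤ n) {P : List SubParams}
    (hP : ∃ x₀ : Fin n → ℕ, HasParams x₀ P) {T : CompTree n} (hT : T.Sorts ℕ) :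
    ∃ x : Fin n → ℕ, HasParams x P ∧ 1 / 26 * comparisonBound n P ≤ (T.cost x : ℝ) := by
  obtain ⟨x₀, hx₀⟩ := hP
  have hn0 : n ≠ 0 := by omega
  obtain ⟨hbd, hsum, -⟩ := hx₀.bounds hn0
  obtain ⟨ys, hys, hxs, hsub⟩ := exists_subInstances_eq hn0 x₀
  obtain ⟨D, hD, rfl⟩ := hx₀
  rw [hsub] at hD
  obtain ⟨R₀, D, hR₀, hD', rfl⟩ := List.forall₂_cons_left_iff.1 hD
  -- The empty first sub-instance has no runs, as runs are nonempty, so it adds neither size nor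
  -- choices and can be split off.
  have hR0 : R₀ = [] := by
    by_contra hne
    obtain ⟨r, R, rfl⟩ := List.exists_cons_of_ne_nil hne
    have h1 := hR₀.1
    rw [List.flatten_cons, List.append_eq_nil_iff] at h1
    exact (hR₀.2 r (by simp)).1 h1.1
  subst hR0
  rw [List.map_cons] at hsum hbd ⊢
  have hreal : ∀ p ∈ D.map subParams, ∃ y, IsRealization p y := by
    intro p hp
    obtain ⟨R, hR, rfl⟩ := List.mem_map.1 hp
    obtain ⟨i, hi, rfl⟩ := List.getElem_of_mem hR
    have hi' : i < ys.length := hD'.length_eq ▸ hi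
    have hy := hys.1 _ (List.getElem_mem hi')
    exact ⟨ys[i], hy.1, hy.2, D[i], List.forall₂_iff_get.1 hD' |>.2 i hi' hi, rfl⟩
  obtain ⟨F, hF, hFs, hFc⟩ := exists_jointRealizations _ hreal
  have hsize : ((D.map subParams).map SubParams.size).sum = n := by
    rw [← hsum]
    simp [subParams]
  have htot : totalChoices (subParams ([] : List (List ℕ)) :: D.map subParams) =
      totalChoices (D.map subParams) := by
    simp [totalChoices, SubParams.runChoices, subParams, outputPartition]
  have hQ := totalChoices_pos hbd
  rw [htot] at hQ
  rw [hsize] at hFc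
  set f : List ℕ → Fin n → ℕ := fun z i => z.getD i 0 with hf
  have hofFn : ∀ z ∈ F, List.ofFn (f z) = z := by
    intro z hz
    have hl := (hF z hz).length_eq.trans hsize
    refine List.ext_getElem (by simp [hl]) fun i h1 h2 => ?_
    rw [List.getElem_ofFn]
    exact List.getD_eq_getElem _ _ h2
  have hparams : ∀ z ∈ F, HasParams (f z) (subParams ([] : List (List ℕ)) :: D.map subParams) := by
    intro z hz
    obtain ⟨zs, E, h1, h2, h3, h4⟩ := hF z hz
    refine ⟨[] :: E, ?_, by rw [List.map_cons, h4]⟩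
    rw [subInstances_eq hn0 (f z) h1 ((hofFn z hz).trans h2)]
    exact .cons ⟨rfl, by simp⟩ h3
  have hinj : ∀ z ∈ F, ∀ z' ∈ F, T.outcomes (f z) = T.outcomes (f z') → z = z' := by
    intro z hz z' hz' h
    have := orderSimilar_ofFn.2 (hT.le_iff_of_outcomes_eq h)
    rw [hofFn z hz, hofFn z' hz'] at this
    exact hFs z hz z' hz' this
  have hne : F.Nonempty := by
    rw [Finset.nonempty_iff_ne_empty]
    rintro rfl
    simp at hFc
    omega
  obtain ⟨z, hz, hmax⟩ := Finset.exists_max_image F (fun z => T.cost (f z)) hne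
  refine ⟨f z, hparams z hz, ?_⟩
  have hcard : F.card ≤ 3 ^ T.cost (f z) := by
    rw [← Finset.card_image_of_injOn (f := f) fun a ha b hb hab => by
      exact hinj a ha b hb (by rw [hab])]
    refine T.card_le_three_pow _ _ ?_ ?_
    · intro a ha b hb hab
      simp only [Finset.coe_image, Set.mem_image, Finset.mem_coe] at ha hb
      obtain ⟨a, ha, rfl⟩ := ha
      obtain ⟨b, hb, rfl⟩ := hb
      rw [hinj a ha b hb hab]
    · intro a ha
      obtain ⟨a, ha', rfl⟩ := Finset.mem_image.1 ha
      exact hmax a ha'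
  have hlin := hT.le_two_mul_cost hn (f z)
  set d := T.cost (f z)
  have hQle : totalChoices (D.map subParams) ≤ 2 ^ (2 * d + 10 * n) := by
    calc _ ≤ 3 ^ d * 768 ^ n := hFc.trans (Nat.mul_le_mul_right _ hcard)
      _ ≤ 4 ^ d * 1024 ^ n := Nat.mul_le_mul (Nat.pow_le_pow_left (by norm_num) _)
        (Nat.pow_le_pow_left (by norm_num) _)
      _ = _ := by
        rw [show 4 = 2 ^ 2 by norm_num, show 1024 = 2 ^ 10 by norm_num, ← pow_mul, ← pow_mul,
          ← pow_add]
  have hlog : Real.logb 2 (totalChoices (D.map subParams)) ≤ 2 * d + 10 * n := by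
    rw [Real.logb_le_iff_le_rpow one_lt_two (by exact_mod_cast hQ)]
    have : (2 * d + 10 * n : ℝ) = ((2 * d + 10 * n : ℕ) : ℝ) := by push_cast; ring
    rw [this, Real.rpow_natCast]
    exact_mod_cast hQle
  have hB := comparisonBound_le hbd hsum
  rw [htot] at hB
  have : (n : ℝ) ≤ 2 * d := by exact_mod_cast hlin
  linarith

/-! ### The main theorem -/

theorem mainTheorem6 :
    ∃ C c : ℝ, 0 < C ∧ 0 < c ∧
      (∃ A : (n : ℕ) → CompTree n,
        ∀ (α : Type*) [LinearOrder α] (n : ℕ),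
          (A n).Sorts α ∧
          ∀ (x : Fin n → α) (P : List SubParams), HasParams x P →
            (((A n).cost x : ℕ) : ℝ) ≤ C * comparisonBound n P) ∧
      (∀ (n : ℕ), 2 ≤ n → ∀ P : List SubParams,
        (∃ x₀ : Fin n → ℕ, HasParams x₀ P) →
        ∀ T : CompTree n, T.Sorts ℕ →
          ∃ x : Fin n → ℕ, HasParams x P ∧
            c * comparisonBound n P ≤ ((T.cost x : ℕ) : ℝ)) := by
  refine ⟨70, 1 / 26, by norm_num, by norm_num, ?_,
    fun n hn P hP T hT => exists_cost_ge hn hP hT⟩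
  choose A hA using exists_tree
  exact ⟨A, fun α _ n => hA n α⟩
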